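/- Let $d\in\{1,2,3\}$. Let either $\Omega\subset\mathbb R^d$ be a bounded convex domain (for instance a convex polygonal one), with Dirichlet or Neumann boundary conditions, or let $\Omega$ be the torus $\prod_{n=1}^d[0,L_n)$, $L_n>0$ (periodic boundary conditions). Put $H=L^2(\Omega)$, $V=W^{1,2}_0(\Omega)$ in the Dirichlet case and $V=W^{1,2}(\Omega)$ otherwise, identify $H=H'$, and let $A,A_0:V\to V'$, $\langle Aw,z\rangle=(\nabla w,\nabla z)_{L^2}+(w,z)_{L^2}$, $A_0=A-\mathbf 1$. Let $\mathrm D(A)=\{v\in V: Av\in H\}$, $\mathrm D(A^{3/2})=\{v\in \mathrm D(A): Av\in V\}$, $\|v\|_V^2=\langle Av,v\rangle$, $\|v\|_{\mathrm D(A)}=\|Av\|_H$; $A_0$ is extended to $H\to \mathrm D(A)'$ by $\langle A_0w,v\rangle=(w,A_0v)_H$. Product spaces carry the Euclidean combination of the norms. For nonlinearities $f:\mathbb R\to\mathbb R$ and $g$ (possibly depending on $x\in\Omega$) and a target $y_{1r}:(0,\infty)\times\Omega\to\mathbb R$, consider the following assumptions. (fgV) $f=F'$ with $F\ge0$ and $F(z)\in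 L^1(\Omega)$ for all $z\in \mathrm D(A^{3/2})$; and there are $C_{f*},C_{g*}\ge0$ such that for all $v\in \mathrm D(A)$ $$\|f(v)\|_{V'}^2\le C_{f*}\|v\|_V^2(1+\|v\|_H^2\|v\|_V^2),\qquad -\langle A_0f(v),v\rangle_{\mathrm D(A)',\mathrm D(A)}\le C_{f*}\|v\|_{\mathrm D(A)}\|v\|_V,$$ $$\|g(v)\|_{V'}^2\le C_{g*}\|v\|_V^2(1+\|v\|_H^2\|v\|_V^2),\qquad -\langle g(v),v\rangle_{\mathrm D(A)',\mathrm D(A)}\le C_{g*}\|v\|_{\mathrm D(A)}\|v\|_V$$ (in particular $f(v),g(v)\in V'$ and $f(v)\in H$). (N-dif) There are constants $\underline C_{f*},\underline C_{g*}\ge0$ such that for all $v,w\in \mathrm D(A^{3/2})$ one has $f(v)-f(w)\in V$, $g(v)-g(w)\in V'$ and, with $B(v,w)=(1+\|(v,w)\|_{V\times V})(1+\|(v,w)\|_{\mathrm D(A)\times \mathrm D(A)})\|v-w\|_V$, $$\|A_0(f(v)-f(w))\|_{V'}\le\underline C_{f*}B(v,w),\qquad \|g(v)-g(w)\|_{V'}\le\underline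 C_{g*}B(v,w).$$ (NfNg) With $N_f(t,z)=f(y_{1r}(t)+z)-f(y_{1r}(t))$ and $N_g(t,z)=g(y_{1r}(t)+z)-g(y_{1r}(t))$ there are an integer $n\ge1$ and nonnegative constants $C_f,C_g,\zeta_i^f,\eta_i^f,\zeta_i^g,\eta_i^g$ ($1\le i\le n$), with $\eta_i^f,\eta_i^g<2$ and $\zeta_i^f+\eta_i^f\ge2$, $\zeta_i^g+\eta_i^g\ge2$, such that for almost every $t>0$ and all $z\in \mathrm D(A)$ one has $N_f(t,z)\in H$, $N_g(t,z)\in \mathrm D(A)'$ and $$-\langle A_0N_f(t,z),z\rangle_{\mathrm D(A)',\mathrm D(A)}\le C_f\sum_{i=1}^n\|z\|_H^{\zeta_i^f}\|z\|_{\mathrm D(A)}^{\eta_i^f},\qquad -\langle N_g(t,z),z\rangle_{\mathrm D(A)',\mathrm D(A)}\le C_g\sum_{i=1}^n\|z\|_H^{\zeta_i^g}\|z\|_{\mathrm D(A)}^{\eta_i^g}.$$ (yr-bdd) $y_{1r}\in L^\infty((0,\infty)\times\Omega)$ and $\nabla y_{1r}\in L^\infty((0,\infty)\times\Omega)^d$.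 Let $\tau>0$, $F(\zeta)=\tau(\zeta^2-1)^2$, $f(\zeta)=F'(\zeta)=4\tau(\zeta^3-\zeta)$. Let $a_0\in L^2(\Omega)$, $a_1,a_2\in L^\infty(\Omega)$ with $a_1>0$ and $a_2>0$ almost everywhere, and $$\overline g(w)=a_1w+a_2w(|w|-1),\qquad g(w)=a_0+\overline g(w).$$ Then: 1. $F$, $f$ and $\overline g$ satisfy (fgV); $f$ and $\overline g$ satisfy (N-dif); and $f$ and $\overline g$ satisfy (NfNg) for every target $y_{1r}$ with (yr-bdd). The part of (NfNg) on $\overline g$ holds for every $y_{1r}\in L^\infty((0,\infty)\times\Omega)$. 2. The statements of 1 on (N-dif) and (NfNg) hold with $g$ in place of $\overline g$. 3. The term $a_0$ can be moved into the external force: for $v\in\mathrm D(A)$ one has $g(v)=a_0+\overline g(v)$ in $V'$ (where $\overline g(v)$ is a functional $\ell\in V'$ if and only if $g(v)$ is the functional $a_0+\ell$), and if $h=(h_1,h_2)\in L^2_{\rm loc}(\mathbb R_+,V'\times V')$, then also $(h_1-a_0,h_2)\in L^2_{\rm loc}(\mathbb R_+,V'\times V')$. Here $h\in L^2_{\rm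 loc}(\mathbb R_+,V'\times V')$ means $h\in L^2((0,T),V'\times V')$ for all $T>0$. -/

import Mathlib

open MeasureTheory Set
open scoped ENNReal ContDiff

noncomputable section

namespace CahnHilliard

/-- The space `ℝ^d` with its Euclidean structure. -/
abbrev E (d : ℕ) : Type := EuclideanSpace ℝ (Fin d)

/-- A spatial domain together with its boundary conditions. In the periodic case the domain is the
torus with periods `L 0, …, L (d-1)`, represented by the box `∏ [0, L i)`. -/
inductive Setting (d : ℕ) : Type
  | dirichlet (Ω : Set (E d)) : Setting d
  | neumann (Ω : Set (E d)) : Setting d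
  | periodic (L : Fin d → ℝ) : Setting d

namespace Setting

variable {d : ℕ}

/-- `Ω` is a (nonempty) bounded convex domain; respectively, the periods are positive. -/
def Admissible : Setting d → Prop
  | dirichlet Ω => Ω.Nonempty ∧ IsOpen Ω ∧ Bornology.IsBounded Ω ∧ Convex ℝ Ω
  | neumann Ω => Ω.Nonempty ∧ IsOpen Ω ∧ Bornology.IsBounded Ω ∧ Convex ℝ Ω
  | periodic L => ∀ i, 0 < L i

/-- The spatial domain, as a subset of `ℝ^d`. -/
def dom : Setting d → Set (E d)
  | dirichlet Ω => Ω
  | neumann Ω => Ω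
  | periodic L => {x | ∀ i, 0 ≤ x i ∧ x i < L i}

/-- Lebesgue measure on the spatial domain. -/
def mu (S : Setting d) : Measure (E d) := volume.restrict S.dom

/-- Test functions: `C_c^∞(Ω)` for a domain `Ω ⊆ ℝ^d`, and `C^∞` of the torus (that is, smooth
periodic functions) in the periodic case. -/
def IsTest : Setting d → (E d → ℝ) → Prop
  | dirichlet Ω, φ => ContDiff ℝ ∞ φ ∧ HasCompactSupport φ ∧ tsupport φ ⊆ Ω
  | neumann Ω, φ => ContDiff ℝ ∞ φ ∧ HasCompactSupport φ ∧ tsupport φ ⊆ Ω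
  | periodic L, φ => ContDiff ℝ ∞ φ ∧ ∀ i x, φ (x + EuclideanSpace.single i (L i)) = φ x

/-- The classical partial derivative `∂φ/∂x_i`. -/
def partialD (i : Fin d) (φ : E d → ℝ) (x : E d) : ℝ :=
  fderiv ℝ φ x (EuclideanSpace.single i 1)

/-- `(G_0, …, G_{d-1})` is the weak gradient of `u` on the domain (on the torus in the periodic
case). Used for square integrable and for essentially bounded `u`, `G` only. -/
def IsWeakGrad (S : Setting d) (u : E d → ℝ) (G : Fin d → E d → ℝ) : Prop :=
  ∀ φ, S.IsTest φ → ∀ i,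
    ∫ x, u x * partialD i φ x ∂S.mu = - ∫ x, G i x * φ x ∂S.mu

/-- The pivot space `H = L²(Ω)`. -/
abbrev H (S : Setting d) : Type := Lp ℝ 2 S.mu

/-- `L²(Ω) × L²(Ω)^d` with its Hilbert structure. -/
abbrev Pair (S : Setting d) : Type := WithLp 2 (S.H × PiLp 2 (fun _ : Fin d => S.H))

lemma memLp_box (L : Fin d → ℝ) {φ : E d → ℝ} (h : Continuous φ) :
    MemLp φ 2 (mu (periodic L)) := by
  set K : Set (E d) := (EuclideanSpace.equiv (Fin d) ℝ) ⁻¹' (Icc 0 L) with hK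
  have hKc : IsCompact K :=
    (EuclideanSpace.equiv (Fin d) ℝ).toHomeomorph.isCompact_preimage.2 isCompact_Icc
  have hsub : dom (periodic L) ⊆ K := fun x hx =>
    ⟨fun i => (hx i).1, fun i => (hx i).2.le⟩
  obtain ⟨C, hC⟩ := hKc.exists_bound_of_continuousOn h.continuousOn
  have : IsFiniteMeasure (volume.restrict K) := ⟨by simpa using hKc.measure_lt_top⟩
  refine MemLp.mono_measure (Measure.restrict_mono hsub le_rfl) ?_
  refine MemLp.of_bound h.aestronglyMeasurable C ?_
  exact (ae_restrict_iff' hKc.measurableSet).2 (Filter.Eventually.of_forall hC)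

lemma continuous_partialD {φ : E d → ℝ} (h : ContDiff ℝ ∞ φ) (i : Fin d) :
    Continuous (partialD i φ) :=
  (h.continuous_fderiv (by simp)).clm_apply continuous_const

lemma hasCompactSupport_partialD {φ : E d → ℝ} (h : HasCompactSupport φ) (i : Fin d) :
    HasCompactSupport (partialD i φ) :=
  h.fderiv_apply ℝ (EuclideanSpace.single i 1)

lemma IsTest.memLp {S : Setting d} {φ : E d → ℝ} (h : S.IsTest φ) : MemLp φ 2 S.mu := by
  cases S with
  | dirichlet Ω => exact (h.1.continuous.memLp_of_hasCompactSupport h.2.1).restrict _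
  | neumann Ω => exact (h.1.continuous.memLp_of_hasCompactSupport h.2.1).restrict _
  | periodic L => exact memLp_box L h.1.continuous

lemma IsTest.memLp_partialD {S : Setting d} {φ : E d → ℝ} (h : S.IsTest φ) (i : Fin d) :
    MemLp (partialD i φ) 2 S.mu := by
  cases S with
  | dirichlet Ω =>
    exact ((continuous_partialD h.1 i).memLp_of_hasCompactSupport
      (hasCompactSupport_partialD h.2.1 i)).restrict _
  | neumann Ω =>
    exact ((continuous_partialD h.1 i).memLp_of_hasCompactSupport
      (hasCompactSupport_partialD h.2.1 i)).restrict _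
  | periodic L => exact memLp_box L (continuous_partialD h.1 i)

lemma integral_add_mul {S : Setting d} (u v : S.H) {ψ : E d → ℝ} (h : MemLp ψ 2 S.mu) :
    ∫ x, (u + v : S.H) x * ψ x ∂S.mu = ∫ x, u x * ψ x ∂S.mu + ∫ x, v x * ψ x ∂S.mu := by
  have hu : Integrable (fun x => u x * ψ x) S.mu := (Lp.memLp u).integrable_mul h
  have hv : Integrable (fun x => v x * ψ x) S.mu := (Lp.memLp v).integrable_mul h
  rw [← integral_add hu hv]
  refine integral_congr_ae ?_
  filter_upwards [Lp.coeFn_add u v] with x hx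
  rw [hx, Pi.add_apply, add_mul]

lemma integral_smul_mul {S : Setting d} (c : ℝ) (u : S.H) (ψ : E d → ℝ) :
    ∫ x, (c • u : S.H) x * ψ x ∂S.mu = c * ∫ x, u x * ψ x ∂S.mu := by
  rw [← integral_const_mul]
  refine integral_congr_ae ?_
  filter_upwards [Lp.coeFn_smul c u] with x hx
  rw [hx, Pi.smul_apply, smul_eq_mul, mul_assoc]

/-- `W^{1,2}`, as the space of the pairs `(u, ∇u)` with `u ∈ L²` and weak gradient `∇u ∈ (L²)^d`. -/
def W12 (S : Setting d) : Submodule ℝ S.Pair where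
  carrier := {p | S.IsWeakGrad p.fst (fun i => p.snd i)}
  zero_mem' := by
    intro φ hφ i
    have h0 : ∀ ψ : E d → ℝ, ∫ x, ((0 : S.H) : E d → ℝ) x * ψ x ∂S.mu = 0 := fun ψ => by
      have h := integral_smul_mul (S := S) 0 0 ψ
      rwa [zero_smul, zero_mul] at h
    have h1 : ∫ x, ((0 : S.H) : E d → ℝ) x * partialD i φ x ∂S.mu
        = - ∫ x, ((0 : S.H) : E d → ℝ) x * φ x ∂S.mu := by rw [h0, h0, neg_zero]
    exact h1
  add_mem' := by
    intro p q hp hq φ hφ i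
    have h1 := hp φ hφ i
    have h2 := hq φ hφ i
    simp only [WithLp.add_fst, WithLp.add_snd, PiLp.add_apply]
    rw [integral_add_mul _ _ (hφ.memLp_partialD i), integral_add_mul _ _ hφ.memLp, h1, h2]
    ring
  smul_mem' := by
    intro c p hp φ hφ i
    have h1 := hp φ hφ i
    simp only [WithLp.smul_fst, WithLp.smul_snd, PiLp.smul_apply]
    rw [integral_smul_mul, integral_smul_mul, h1]
    ring

/-- `W_0^{1,2}`: the closure in `W^{1,2}` of the space of test functions. -/
def W012 (S : Setting d) : Submodule ℝ S.Pair :=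
  (Submodule.span ℝ {p : S.Pair | ∃ φ, S.IsTest φ ∧ p.fst =ᵐ[S.mu] φ ∧
    ∀ i, p.snd i =ᵐ[S.mu] partialD i φ}).topologicalClosure

/-- The space `V`, as a space of pairs `(u, ∇u)`. Its inner product, inherited from
`L² × (L²)^d`, is `(u, w)_{L²} + (∇u, ∇w)_{L²}`. -/
def Vsub : (S : Setting d) → Submodule ℝ S.Pair
  | dirichlet Ω => W012 (dirichlet Ω)
  | neumann Ω => W12 (neumann Ω)
  | periodic L => W12 (periodic L)

/-- The space `V`; `‖u‖` for `u : S.V` is the norm of `V`. -/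
abbrev V (S : Setting d) : Type := S.Vsub

/-- The continuous dual `V'`, with the dual norm. -/
abbrev V' (S : Setting d) : Type := S.V →L[ℝ] ℝ

/-- The inclusion `V → H`. -/
def inclH (S : Setting d) : S.V →L[ℝ] S.H :=
  (WithLp.fstL 2 ℝ S.H (PiLp 2 (fun _ : Fin d => S.H))).comp S.Vsub.subtypeL

/-- The gradient `V → (L²)^d`. -/
def grad (S : Setting d) : S.V →L[ℝ] PiLp 2 (fun _ : Fin d => S.H) :=
  (WithLp.sndL 2 ℝ S.H (PiLp 2 (fun _ : Fin d => S.H))).comp S.Vsub.subtypeL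

/-- The inclusion `H → V'` given by the pivot space identification `H = H'`. -/
def ofH (S : Setting d) (h : S.H) : S.V' := (innerSL ℝ h).comp S.inclH

/-- The nonshifted Laplacian `A₀ : V → V'`, `⟨A₀ w, z⟩ = (∇w, ∇z)`. -/
def A0 (S : Setting d) (w : S.V) : S.V' := (innerSL ℝ (S.grad w)).comp S.grad

/-- The shifted Laplacian `A : V → V'`, `⟨A w, z⟩ = (∇w, ∇z) + (w, z)`. -/
def A (S : Setting d) (w : S.V) : S.V' := S.A0 w + S.ofH (S.inclH w)

/-- `D(A) = {v | A v ∈ H}`; an element is given by `v ∈ V` together with `A v ∈ H`. -/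
structure DomA (S : Setting d) : Type where
  toV : S.V
  Aval : S.H
  eq : S.A toV = S.ofH Aval

/-- The function on the domain underlying an element of `V`. -/
def V.fn {S : Setting d} (v : S.V) : E d → ℝ := S.inclH v

namespace DomA

variable {S : Setting d}

/-- The function on the domain underlying an element of `D(A)`. -/
def fn (v : S.DomA) : E d → ℝ := V.fn v.toV

def normH (v : S.DomA) : ℝ := ‖S.inclH v.toV‖

def normV (v : S.DomA) : ℝ := ‖v.toV‖

/-- The norm of `D(A)`, `‖A v‖_H`. -/
def normDA (v : S.DomA) : ℝ := ‖v.Aval‖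

/-- `v ∈ D(A^{3/2})`, that is, `A v ∈ D(A^{1/2}) = V`. -/
def MemDomA32 (v : S.DomA) : Prop := ∃ w : S.V, S.inclH w = v.Aval

end DomA

/-- The function `w` is an element of `V'`, namely the functional `ℓ`: `⟨w, z⟩ = ∫ w z`. -/
def Represents (S : Setting d) (w : E d → ℝ) (l : S.V') : Prop :=
  ∀ z : S.V, Integrable (fun x => w x * V.fn z x) S.mu ∧ ∫ x, w x * V.fn z x ∂S.mu = l z

/-- The function `w` is an element of `D(A)'`, acting as `⟨w, z⟩ = ∫ w z`. -/
def MemDomADual (S : Setting d) (w : E d → ℝ) : Prop :=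
  ∃ K : ℝ, ∀ z : S.DomA, Integrable (fun x => w x * z.fn x) S.mu ∧
    |∫ x, w x * z.fn x ∂S.mu| ≤ K * z.normDA

/-- The pairing `⟨A₀ w, v⟩_{D(A)', D(A)}` for `w ∈ H`, where `A₀ : H → D(A)'` is the extension by
duality: `⟨A₀ w, v⟩ = (w, A₀ v)_H` with `A₀ v = A v - v`. -/
def pairA0 (S : Setting d) (w : E d → ℝ) (v : S.DomA) : ℝ :=
  ∫ x, w x * (v.Aval x - v.fn x) ∂S.mu

/-! ### The assumptions

Here `f : ℝ → ℝ`, `F : ℝ → ℝ`, while `g : E d → ℝ → ℝ` may also depend on the point of space;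
`y : ℝ → E d → ℝ` is the first component of the target trajectory. -/

/-- The part of the first assumption that concerns `f`. -/
def GrowthF (S : Setting d) (F f : ℝ → ℝ) : Prop :=
  (∀ s, HasDerivAt F (f s) s) ∧ (∀ s, 0 ≤ F s) ∧
  (∀ z : S.DomA, z.MemDomA32 → Integrable (fun x => F (z.fn x)) S.mu) ∧
  ∃ C : ℝ, 0 ≤ C ∧ ∀ v : S.DomA,
    (∃ l : S.V', S.Represents (fun x => f (v.fn x)) l ∧
      ‖l‖ ^ 2 ≤ C * v.normV ^ 2 * (1 + v.normH ^ 2 * v.normV ^ 2)) ∧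
    MemLp (fun x => f (v.fn x)) 2 S.mu ∧
    -(S.pairA0 (fun x => f (v.fn x)) v) ≤ C * v.normDA * v.normV

/-- The part of the first assumption that concerns `g`. -/
def GrowthG (S : Setting d) (g : E d → ℝ → ℝ) : Prop :=
  ∃ C : ℝ, 0 ≤ C ∧ ∀ v : S.DomA,
    ∃ l : S.V', S.Represents (fun x => g x (v.fn x)) l ∧
      ‖l‖ ^ 2 ≤ C * v.normV ^ 2 * (1 + v.normH ^ 2 * v.normV ^ 2) ∧
      -(l v.toV) ≤ C * v.normDA * v.normV

/-- The growth and monotonicity assumption on `f = F'` and `g`. -/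
def AssumptionFGV (S : Setting d) (F f : ℝ → ℝ) (g : E d → ℝ → ℝ) : Prop :=
  S.GrowthF F f ∧ S.GrowthG g

/-- The factor
`(1 + ‖(v,w)‖_{V×V}) (1 + ‖(v,w)‖_{D(A)×D(A)}) ‖v - w‖_V`. -/
def difBound {S : Setting d} (v w : S.DomA) : ℝ :=
  (1 + √(v.normV ^ 2 + w.normV ^ 2)) * (1 + √(v.normDA ^ 2 + w.normDA ^ 2)) * ‖v.toV - w.toV‖

/-- The part of the second assumption that concerns `f`: here `f(v) - f(w)` is an element `u` of
`V`, and `A₀ u ∈ V'`. -/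
def DifF (S : Setting d) (f : ℝ → ℝ) : Prop :=
  ∃ C : ℝ, 0 ≤ C ∧ ∀ v w : S.DomA, v.MemDomA32 → w.MemDomA32 →
    ∃ u : S.V, V.fn u =ᵐ[S.mu] (fun x => f (v.fn x) - f (w.fn x)) ∧
      ‖S.A0 u‖ ≤ C * difBound v w

/-- The part of the second assumption that concerns `g`. -/
def DifG (S : Setting d) (g : E d → ℝ → ℝ) : Prop :=
  ∃ C : ℝ, 0 ≤ C ∧ ∀ v w : S.DomA, v.MemDomA32 → w.MemDomA32 →
    ∃ l : S.V', S.Represents (fun x => g x (v.fn x) - g x (w.fn x)) l ∧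
      ‖l‖ ≤ C * difBound v w

/-- The local Lipschitz assumption on `f` and `g`. -/
def AssumptionNdif (S : Setting d) (f : ℝ → ℝ) (g : E d → ℝ → ℝ) : Prop :=
  S.DifF f ∧ S.DifG g

/-- The conditions on the exponents in the third assumption. -/
def ExponentsOK {n : ℕ} (ζ η : Fin n → ℝ) : Prop :=
  ∀ i, 0 ≤ ζ i ∧ 0 ≤ η i ∧ η i < 2 ∧ 2 ≤ ζ i + η i

/-- The part of the third assumption that concerns `N_f(t,z) = f(y(t) + z) - f(y(t))`, with `n`
terms in the bound. -/
def BoundNf (S : Setting d) (n : ℕ) (f : ℝ → ℝ) (y : ℝ → E d → ℝ) : Prop :=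
  ∃ (C : ℝ) (ζ η : Fin n → ℝ), 0 ≤ C ∧ ExponentsOK ζ η ∧
    ∀ᵐ t ∂(volume.restrict (Ioi (0 : ℝ))), ∀ z : S.DomA,
      MemLp (fun x => f (y t x + z.fn x) - f (y t x)) 2 S.mu ∧
      -(S.pairA0 (fun x => f (y t x + z.fn x) - f (y t x)) z) ≤
        C * ∑ i, z.normH ^ ζ i * z.normDA ^ η i

/-- The part of the third assumption that concerns `N_g(t,z) = g(y(t) + z) - g(y(t))`, with `n`
terms in the bound. -/
def BoundNg (S : Setting d) (n : ℕ) (g : E d → ℝ → ℝ) (y : ℝ → E d → ℝ) : Prop :=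
  ∃ (C : ℝ) (ζ η : Fin n → ℝ), 0 ≤ C ∧ ExponentsOK ζ η ∧
    ∀ᵐ t ∂(volume.restrict (Ioi (0 : ℝ))), ∀ z : S.DomA,
      S.MemDomADual (fun x => g x (y t x + z.fn x) - g x (y t x)) ∧
      -(∫ x, (g x (y t x + z.fn x) - g x (y t x)) * z.fn x ∂S.mu) ≤
        C * ∑ i, z.normH ^ ζ i * z.normDA ^ η i

/-- The assumption on `N_f` and `N_g` along the target `y`. -/
def AssumptionNfNg (S : Setting d) (f : ℝ → ℝ) (g : E d → ℝ → ℝ) (y : ℝ → E d → ℝ) : Prop :=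
  ∃ n : ℕ, 0 < n ∧ S.BoundNf n f y ∧ S.BoundNg n g y

/-- `y ∈ L^∞((0,∞) × Ω)`. -/
def EssBdd (S : Setting d) (y : ℝ → E d → ℝ) : Prop :=
  MemLp (Function.uncurry y) ∞ ((volume.restrict (Ioi (0 : ℝ))).prod S.mu)

/-- `y ∈ L^∞((0,∞) × Ω)` and `∇y ∈ L^∞((0,∞) × Ω)^d`, with `∇` the weak gradient in space. -/
def AssumptionYrBdd (S : Setting d) (y : ℝ → E d → ℝ) : Prop :=
  S.EssBdd y ∧ ∃ G : Fin d → ℝ → E d → ℝ, (∀ i, S.EssBdd (G i)) ∧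
    ∀ᵐ t ∂(volume.restrict (Ioi (0 : ℝ))), S.IsWeakGrad (y t) (fun i => G i t)

/-- The external force `h = (h₁, h₂)` is in `L²_loc(ℝ₊, V' × V')`. -/
def AssumptionH (S : Setting d) (h : ℝ → S.V' × S.V') : Prop :=
  ∀ T : ℝ, 0 < T → MemLp (fun t => (h t).1) 2 (volume.restrict (Ioo 0 T)) ∧
    MemLp (fun t => (h t).2) 2 (volume.restrict (Ioo 0 T))

end Setting

/-- The double-well potential `F(ζ) = τ (ζ² - 1)²`. -/
def doubleWell (τ : ℝ) (s : ℝ) : ℝ := τ * (s ^ 2 - 1) ^ 2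

/-- The double-well nonlinearity `f(ζ) = 4 τ (ζ³ - ζ)`. -/
def doubleWellNL (τ : ℝ) (s : ℝ) : ℝ := 4 * τ * (s ^ 3 - s)

/-- `g(w) = a₀ + a₁ w + a₂ w (|w| - 1)`, with coefficients depending on the point of space. -/
def gClass {d : ℕ} (a₀ a₁ a₂ : E d → ℝ) (x : E d) (w : ℝ) : ℝ :=
  a₀ x + a₁ x * w + a₂ x * w * (|w| - 1)

/-- The nonlinearity `g(w) - a₀ = a₁ w + a₂ w (|w| - 1)`. -/
def gBar {d : ℕ} (a₁ a₂ : E d → ℝ) (x : E d) (w : ℝ) : ℝ :=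
  a₁ x * w + a₂ x * w * (|w| - 1)

end CahnHilliard

end

noncomputable section

open Filter Topology

namespace CahnHilliard

/-! Everything rests on three facts about `V` and `D(A)`. First, `V` embeds into `L^6` because `d ≤
3` (`exists_sobolevBound`). Second, Agmon's inequality `‖v‖_∞² ≤ K² ‖v‖_V ‖Av‖_H` holds on `D(A)`
(`exists_abs_fn_le`). Third, there is a weighted energy estimate `‖e ∇w‖² ≤ K ‖w‖_V ‖Aw‖_H ‖e‖_V²`
for `w` in `D(A)` and bounded `e` in `V` (`exists_integral_sq_mul_grad_sq_le`). No `W^{2,2}`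
regularity of `D(A)` enters: the second fact is a Stampacchia iteration over the level sets of `v`,
the third is a Caccioppoli argument testing `Aw` with `e² w`.

The Sobolev embedding and the density of nice functions in `V` are proved by hand. On a bounded
convex domain every point can move inside the domain along `d` independent directions that are fixed
locally, so a Loomis–Whitney argument gives `W^{1,1} → L^{3/2}`, and the power `φ⁴` turns this into
`W^{1,2} → L^6`. Density comes from mollification at points contracted towards the interior, or, on
the torus, from a periodic kernel. The chain rule in `V` then follows by passing to limits.

For `f(s) = 4τ(s³ - s)` the cubic part is monotone, so its pairing with `A₀ v` is nonnegative and
only lower order terms have to be bounded. The gradient of `f(v) - f(w)` splits into a bounded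
coefficient times `∇(v - w)` and one times `(v - w)∇w`; the latter is what the weighted estimate is
for. For `g` the maps `s ↦ a₁ s` and `s ↦ a₂ s|s|` are monotone, which leaves only `-a₂ s` with the
wrong sign. Along a target `y`, `f(y + z) - f(y)` is a cubic polynomial in `z`: the cubic term again
has a sign, and the linear and quadratic terms yield the exponents `(1, 1)` and `(5/4, 7/4)`.
Passing from `g - a₀` to `g` changes no difference. -/

/-! ### The embedding of `W^{1,2}` into `L^6` on bounded convex domains. -/

lemma abs_zero_le_integral {ξ : ℝ → ℝ} (h : ContDiff ℝ 1 ξ) :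
    |ξ 0| ≤ ∫ s in (0:ℝ)..1, (|ξ s| + |deriv ξ s|) := by
  have hd : Continuous (deriv ξ) := h.continuous_deriv le_rfl
  have hc : Continuous ξ := h.continuous
  have key : ∀ s ∈ Icc (0:ℝ) 1, |ξ 0| ≤ |ξ s| + ∫ t in (0:ℝ)..1, |deriv ξ t| := by
    intro s hs
    have h1 : ∫ t in (0:ℝ)..s, deriv ξ t = ξ s - ξ 0 :=
      intervalIntegral.integral_deriv_eq_sub
        (fun x _ => (h.differentiable one_ne_zero).differentiableAt) (hd.intervalIntegrable _ _)
    have h2 : |∫ t in (0:ℝ)..s, deriv ξ t| ≤ ∫ t in (0:ℝ)..s, |deriv ξ t| :=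
      intervalIntegral.abs_integral_le_integral_abs hs.1
    have h3 : ∫ t in (0:ℝ)..s, |deriv ξ t| ≤ ∫ t in (0:ℝ)..1, |deriv ξ t| :=
      intervalIntegral.integral_mono_interval le_rfl hs.1 hs.2
        (Filter.Eventually.of_forall fun _ => abs_nonneg _) (hd.abs.intervalIntegrable _ _)
    have h4 : ξ 0 = ξ s - ∫ t in (0:ℝ)..s, deriv ξ t := by rw [h1]; ring
    rw [h4]
    exact (abs_sub _ _).trans (by linarith)
  have h5 : ∫ _ in (0:ℝ)..1, |ξ 0| ≤
      ∫ s in (0:ℝ)..1, (|ξ s| + ∫ t in (0:ℝ)..1, |deriv ξ t|) :=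
    intervalIntegral.integral_mono_on zero_le_one (by simp)
      ((hc.abs.add continuous_const).intervalIntegrable _ _) key
  rw [intervalIntegral.integral_add (hc.abs.intervalIntegrable _ _) (by simp)] at h5
  rw [intervalIntegral.integral_add (hc.abs.intervalIntegrable _ _)
    (hd.abs.intervalIntegrable _ _)]
  simpa using h5

/-- The integrand of the `W^{1,1}` norm. -/
def sob {d : ℕ} (φ : E d → ℝ) (x : E d) : ℝ≥0∞ := ‖φ x‖ₑ + ‖fderiv ℝ φ x‖ₑ

lemma continuous_sob {d : ℕ} {φ : E d → ℝ} (h : ContDiff ℝ 1 φ) : Continuous (sob φ) :=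
  h.continuous.enorm.add (h.continuous_fderiv one_ne_zero).enorm

/-- The fundamental theorem of calculus on the segment from `x` to `x + θ`, averaged over the end
point (`abs_zero_le_integral`), so that no boundary value of `φ` appears. -/
lemma enorm_le_lintegral_sob {d : ℕ} {φ : E d → ℝ} (h : ContDiff ℝ 1 φ) (x θ : E d) :
    ‖φ x‖ₑ ≤ (1 + ‖θ‖ₑ) * ∫⁻ s in Icc (0:ℝ) 1, sob φ (x + s • θ) := by
  set ξ : ℝ → ℝ := fun s => φ (x + s • θ) with hξ
  have hline : ContDiff ℝ 1 fun s : ℝ => x + s • θ := by fun_prop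
  have hξ1 : ContDiff ℝ 1 ξ := h.comp hline
  have hder : ∀ s, deriv ξ s = fderiv ℝ φ (x + s • θ) θ := by
    intro s
    have h1 : HasDerivAt (fun s : ℝ => x + s • θ) θ s := by
      simpa using ((hasDerivAt_id s).smul_const θ).const_add x
    exact ((h.differentiable one_ne_zero _).hasFDerivAt.comp_hasDerivAt s h1).deriv
  have hcont : Continuous fun s => |ξ s| + |deriv ξ s| :=
    hξ1.continuous.abs.add (hξ1.continuous_deriv le_rfl).abs
  have h1 := abs_zero_le_integral hξ1
  rw [intervalIntegral.integral_of_le zero_le_one, ← integral_Icc_eq_integral_Ioc] at h1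
  have h2 : ‖φ x‖ₑ ≤ ∫⁻ s in Icc (0:ℝ) 1, ENNReal.ofReal (|ξ s| + |deriv ξ s|) := by
    rw [← ofReal_integral_eq_lintegral_ofReal (hcont.integrableOn_Icc)
      (Filter.Eventually.of_forall fun s => by positivity)]
    rw [Real.enorm_eq_ofReal_abs]
    refine ENNReal.ofReal_le_ofReal ?_
    simpa [hξ] using h1
  refine h2.trans ?_
  rw [← lintegral_const_mul (f := fun s : ℝ => sob φ (x + s • θ)) _
    ((continuous_sob h).comp hline.continuous).measurable]
  refine lintegral_mono fun s => ?_
  rw [ENNReal.ofReal_add (abs_nonneg _) (abs_nonneg _), ← Real.enorm_eq_ofReal_abs,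
    ← Real.enorm_eq_ofReal_abs, hder, sob, add_mul, one_mul]
  have h3 : ‖fderiv ℝ φ (x + s • θ) θ‖ₑ ≤ ‖θ‖ₑ * ‖fderiv ℝ φ (x + s • θ)‖ₑ := by
    rw [mul_comm]; exact ContinuousLinearMap.le_opENorm _ _
  calc ‖ξ s‖ₑ + ‖fderiv ℝ φ (x + s • θ) θ‖ₑ
      ≤ (‖φ (x + s • θ)‖ₑ + ‖fderiv ℝ φ (x + s • θ)‖ₑ) + ‖θ‖ₑ * (‖φ (x + s • θ)‖ₑ + ‖fderiv ℝ φ (x + s • θ)‖ₑ) := by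
        refine add_le_add le_self_add (h3.trans (by gcongr; exact le_add_self))

/-- A form of the Loomis–Whitney inequality: a function that is bounded, for every coordinate
direction, by the integrals of `g` along lines in that direction is in `L^{d/(d-1)}`. -/
lemma exists_eLpNorm_le_of_le_lintegral_update {d : ℕ} (hd1 : 1 ≤ d) (hd3 : d ≤ 3) :
    ∃ p : ℝ≥0∞, 3/2 ≤ p ∧ ∀ (ψ : (Fin d → ℝ) → ℝ) (g : (Fin d → ℝ) → ℝ≥0∞)
      (s : Set (Fin d → ℝ)) (c : ℝ≥0∞), c ≠ ⊤ → Measurable g → MeasurableSet s →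
      (∀ y ∈ s, ∀ i, ‖ψ y‖ₑ ≤ c * ∫⁻ t, g (Function.update y i t)) →
      eLpNorm ψ p (volume.restrict s) ≤ c * ∫⁻ y, g y := by
  -- In dimension one the line is the whole space, so `p = ∞` works. Otherwise `p = d/(d-1)`, which
  -- is at least `3/2` exactly because `d ≤ 3`.
  rcases hd1.eq_or_lt with rfl | hd
  · refine ⟨⊤, le_top, fun ψ g s c _ hg hs h => ?_⟩
    rw [eLpNorm_exponent_top]
    refine essSup_le_of_ae_le _ ((ae_restrict_iff' hs).2 (Filter.Eventually.of_forall fun y hy => ?_))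
    refine (h y hy 0).trans_eq ?_
    congr 1
    refine Eq.trans ?_ (((volume_preserving_funUnique (Fin 1) ℝ).symm _).lintegral_comp hg)
    refine lintegral_congr fun t => congrArg g ?_
    ext j
    fin_cases j
    simp
  · have hd0 : (0:ℝ) < (d:ℝ) - 1 := by
      have : (1:ℝ) < d := by exact_mod_cast hd
      linarith
    have hd0' : (0:ℝ) < d := by linarith
    set p : ℝ := d / (d - 1) with hp
    have hp0 : 0 < p := by positivity
    have hp32 : 3/2 ≤ p := by
      rw [hp, div_le_div_iff₀ two_pos hd0]
      have : (d:ℝ) ≤ 3 := by exact_mod_cast hd3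
      linarith
    have hconj : Real.HolderConjugate (Fintype.card (Fin d)) p := by
      rw [Fintype.card_fin]
      exact Real.HolderConjugate.conjExponent (by exact_mod_cast hd)
    refine ⟨ENNReal.ofReal p, ?_, fun ψ g s c hc hg hs h => ?_⟩
    · refine le_trans (le_of_eq ?_) (ENNReal.ofReal_le_ofReal hp32)
      rw [ENNReal.ofReal_div_of_pos two_pos]; simp
    rw [eLpNorm_eq_lintegral_rpow_enorm_toReal (by simpa using hp0) ENNReal.ofReal_ne_top,
      ENNReal.toReal_ofReal hp0.le]
    have key : ∫⁻ y in s, ‖ψ y‖ₑ ^ p ≤ (c * ∫⁻ y, g y) ^ p := by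
      calc ∫⁻ y in s, ‖ψ y‖ₑ ^ p
          ≤ ∫⁻ y in s, c ^ p * ∏ i, (∫⁻ t, g (Function.update y i t)) ^ ((1:ℝ) / (d - 1)) := by
            refine setLIntegral_mono' hs fun y hy => ?_
            have h1 : ‖ψ y‖ₑ ^ p = ∏ _i : Fin d, ‖ψ y‖ₑ ^ ((1:ℝ) / (d - 1)) := by
              rw [Finset.prod_const, Finset.card_univ, Fintype.card_fin, ← ENNReal.rpow_natCast,
                ← ENNReal.rpow_mul]
              congr 1; rw [hp]; ring
            have h2 : c ^ p = ∏ _i : Fin d, c ^ ((1:ℝ) / (d - 1)) := by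
              rw [Finset.prod_const, Finset.card_univ, Fintype.card_fin, ← ENNReal.rpow_natCast,
                ← ENNReal.rpow_mul]
              congr 1; rw [hp]; ring
            rw [h1, h2, ← Finset.prod_mul_distrib]
            refine Finset.prod_le_prod' fun i _ => ?_
            rw [← ENNReal.mul_rpow_of_nonneg _ _ (by positivity)]
            exact ENNReal.rpow_le_rpow (h y hy i) (by positivity)
        _ ≤ ∫⁻ y, c ^ p * ∏ i, (∫⁻ t, g (Function.update y i t)) ^ ((1:ℝ) / (d - 1)) :=
            setLIntegral_le_lintegral _ _
        _ = c ^ p * ∫⁻ y, ∏ i, (∫⁻ t, g (Function.update y i t)) ^ ((1:ℝ) / (d - 1)) := by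
            rw [lintegral_const_mul']
            exact ENNReal.rpow_ne_top_of_nonneg hp0.le hc
        _ ≤ c ^ p * (∫⁻ y, g y) ^ p := by
            gcongr
            have := lintegral_prod_lintegral_pow_le (fun _ : Fin d => (volume : Measure ℝ)) hconj hg
            rw [Fintype.card_fin] at this
            exact this
        _ = (c * ∫⁻ y, g y) ^ p := by rw [ENNReal.mul_rpow_of_nonneg _ _ hp0.le]
    calc (∫⁻ y in s, ‖ψ y‖ₑ ^ p) ^ (1 / p) ≤ ((c * ∫⁻ y, g y) ^ p) ^ (1 / p) := by gcongr
      _ = _ := by rw [one_div, ENNReal.rpow_rpow_inv hp0.ne']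

/-- The `W^{1,1}` Sobolev inequality on a part `U` of `Ω` from every point of which one can move in
`d` fixed independent directions inside `Ω`. -/
lemma eLpNorm_patch {d : ℕ} (hd1 : 1 ≤ d) (hd3 : d ≤ 3) {Ω U : Set (E d)} (hΩ : MeasurableSet Ω)
    (hU : MeasurableSet U) (hfin : volume Ω ≠ ⊤)
    (B : (Fin d → ℝ) ≃L[ℝ] E d)
    (hB : ∀ x ∈ Ω ∩ U, ∀ i, ∀ s ∈ Icc (0:ℝ) 1, x + s • B (Pi.single i 1) ∈ Ω) :
    ∃ C : ℝ≥0∞, C ≠ ⊤ ∧ ∀ φ : E d → ℝ, ContDiff ℝ 1 φ →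
      eLpNorm φ (3/2) (volume.restrict (Ω ∩ U)) ≤ C * ∫⁻ x in Ω, sob φ x := by
  obtain ⟨c, hc, hc'⟩ : ∃ c : ℝ≥0∞, c ≠ ⊤ ∧ ∀ i, 1 + ‖B (Pi.single i 1)‖ₑ ≤ c :=
    ⟨∑ i, (1 + ‖B (Pi.single i 1)‖ₑ), by simp, fun i =>
      Finset.single_le_sum (f := fun i => 1 + ‖B (Pi.single i 1)‖ₑ) (fun _ _ => zero_le)
        (Finset.mem_univ i)⟩
  -- The Sobolev integrand extended by zero outside `Ω`, read in coordinates whose axes are the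
  -- admissible directions. The extension lets segments in `Ω` be enlarged to full coordinate lines.
  set g : (E d → ℝ) → (Fin d → ℝ) → ℝ≥0∞ := fun φ y => Ω.indicator (sob φ) (B y) with hg
  have hgm : ∀ φ, ContDiff ℝ 1 φ → Measurable (g φ) := fun φ hφ =>
    ((continuous_sob hφ).measurable.indicator hΩ).comp B.continuous.measurable
  have hline : ∀ φ, ContDiff ℝ 1 φ → ∀ y, B y ∈ Ω ∩ U → ∀ i,
      ‖φ (B y)‖ₑ ≤ c * ∫⁻ t, g φ (Function.update y i t) := by
    intro φ hφ y hy i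
    refine (enorm_le_lintegral_sob hφ (B y) (B (Pi.single i 1))).trans ?_
    refine mul_le_mul' (hc' i) ?_
    have h1 : ∀ t, Function.update y i (t + y i) = y + t • Pi.single i 1 := by
      intro t
      ext j
      by_cases hj : j = i
      · subst hj; simp [add_comm]
      · simp [hj]
    calc ∫⁻ s in Icc (0:ℝ) 1, sob φ (B y + s • B (Pi.single i 1))
        ≤ ∫⁻ s in Icc (0:ℝ) 1, g φ (Function.update y i (s + y i)) := by
          refine setLIntegral_mono' measurableSet_Icc fun s hs => ?_
          rw [h1, hg]
          simp only [map_add, map_smul]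
          rw [indicator_of_mem (hB _ hy i s hs)]
      _ ≤ ∫⁻ s, g φ (Function.update y i (s + y i)) := setLIntegral_le_lintegral _ _
      _ = ∫⁻ t, g φ (Function.update y i t) :=
        lintegral_add_right_eq_self (fun t => g φ (Function.update y i t)) (y i)
  obtain ⟨κ, hκ, hκt, hvol⟩ : ∃ κ : ℝ≥0∞, κ ≠ 0 ∧ κ ≠ ⊤ ∧
      (volume : Measure (E d)) = κ • Measure.map B volume := by
    have : (Measure.map B (volume : Measure (Fin d → ℝ))).IsAddHaarMeasure :=
      B.isAddHaarMeasure_map volume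
    refine ⟨Measure.addHaarScalarFactor volume (Measure.map B volume), ?_, ENNReal.coe_ne_top, ?_⟩
    · simpa using (Measure.addHaarScalarFactor_pos_of_isAddHaarMeasure volume
        (Measure.map B volume)).ne'
    · exact Measure.isAddLeftInvariant_eq_smul _ _
  have hBm : Measurable B := B.continuous.measurable
  obtain ⟨p, hp, hLW⟩ := exists_eLpNorm_le_of_le_lintegral_update hd1 hd3
  have hp0 : p ≠ 0 := (lt_of_lt_of_le (by simp) hp).ne'
  have hμ : volume.restrict (Ω ∩ U) univ ≠ ⊤ := by
    rw [Measure.restrict_apply_univ]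
    exact measure_ne_top_of_subset inter_subset_left hfin
  have hexp : 0 ≤ 1 / (3/2 : ℝ≥0∞).toReal - 1 / p.toReal := by
    by_cases hpt : p = ⊤
    · simp [hpt]
      norm_num
    · rw [sub_nonneg]
      refine one_div_le_one_div_of_le (by simp) ?_
      exact ENNReal.toReal_mono hpt hp
  refine ⟨(volume.restrict (Ω ∩ U) univ) ^ (1 / (3/2 : ℝ≥0∞).toReal - 1 / p.toReal) *
    (κ ^ (1 / p).toReal * c * κ⁻¹), ?_, fun φ hφ => ?_⟩
  · refine ENNReal.mul_ne_top (ENNReal.rpow_ne_top_of_nonneg hexp hμ)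
      (ENNReal.mul_ne_top (ENNReal.mul_ne_top ?_ hc) (by simpa using hκ))
    exact ENNReal.rpow_ne_top_of_nonneg ENNReal.toReal_nonneg hκt
  have hI : ∫⁻ x in Ω, sob φ x = κ * ∫⁻ y, g φ y := by
    rw [← lintegral_indicator hΩ, hvol, lintegral_smul_measure,
      lintegral_map ((continuous_sob hφ).measurable.indicator hΩ) hBm, smul_eq_mul]
  have hN : eLpNorm φ p (volume.restrict (Ω ∩ U)) ≤ κ ^ (1 / p).toReal * (c * ∫⁻ y, g φ y) := by
    rw [hvol, Measure.restrict_smul, Measure.restrict_map hBm (hΩ.inter hU),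
      eLpNorm_smul_measure_of_ne_zero hκ,
      eLpNorm_map_measure hφ.continuous.aestronglyMeasurable hBm.aemeasurable, smul_eq_mul]
    gcongr
    exact hLW _ _ _ c hc (hgm φ hφ) (hBm (hΩ.inter hU)) fun y hy i => hline φ hφ y hy i
  -- The measure is finite, so the exponent `p ≥ 3/2` may be lowered to `3/2`, uniformly in the
  -- dimension.
  refine (eLpNorm_le_eLpNorm_mul_rpow_measure_univ hp hφ.continuous.aestronglyMeasurable).trans ?_
  rw [mul_comm, mul_assoc]
  gcongr
  refine hN.trans (le_of_eq ?_)
  rw [hI, mul_assoc, mul_assoc, ← mul_assoc κ⁻¹, ENNReal.inv_mul_cancel hκ hκt, one_mul]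

/-- The map is `y ↦ ρ y + (∑ yᵢ) a`. Summing the coordinates of an element sent to zero gives `(ρ +
∑ aᵢ) ∑ yᵢ = 0`, so the single value `ρ = -∑ aᵢ` must be avoided; one of `r/2` and `r/4` does that.
-/
lemma exists_equiv_add_smul_single {d : ℕ} (a : E d) {r : ℝ} (hr : 0 < r) :
    ∃ (ρ : ℝ) (B : (Fin d → ℝ) ≃L[ℝ] E d), 0 < ρ ∧ ρ < r ∧
      ∀ i, B (Pi.single i 1) = a + ρ • EuclideanSpace.single i 1 := by
  obtain ⟨ρ, hρ, hρr, hne⟩ : ∃ ρ : ℝ, 0 < ρ ∧ ρ < r ∧ ρ + ∑ i, a i ≠ 0 := by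
    by_cases h : r / 2 + ∑ i, a i = 0
    · exact ⟨r / 4, by linarith, by linarith, fun h' => by linarith⟩
    · exact ⟨r / 2, by linarith, by linarith, h⟩
  let T : (Fin d → ℝ) →ₗ[ℝ] E d :=
    ρ • (WithLp.linearEquiv 2 ℝ (Fin d → ℝ)).symm.toLinearMap +
      (∑ i, LinearMap.proj i : (Fin d → ℝ) →ₗ[ℝ] ℝ).smulRight a
  have hT : ∀ y, T y = ρ • WithLp.toLp 2 y + (∑ i, y i) • a := fun y => by simp [T]
  have hinj : Function.Injective T := by
    rw [injective_iff_map_eq_zero]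
    intro y hy
    rw [hT] at hy
    have hc : ∀ i, ρ * y i + (∑ j, y j) * a i = 0 := fun i => by
      have := congrArg (fun z : E d => z i) hy
      simpa using this
    have hs : (ρ + ∑ i, a i) * ∑ j, y j = 0 := by
      have : ∑ i, (ρ * y i + (∑ j, y j) * a i) = 0 := Finset.sum_eq_zero fun i _ => hc i
      rw [Finset.sum_add_distrib, ← Finset.mul_sum, ← Finset.mul_sum] at this
      linear_combination this
    have hs' : ∑ j, y j = 0 := (mul_eq_zero.1 hs).resolve_left hne
    ext i
    have := hc i
    rw [hs', zero_mul, add_zero] at this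
    exact (mul_eq_zero.1 this).resolve_left hρ.ne'
  refine ⟨ρ, (LinearEquiv.ofInjectiveOfFinrankEq T hinj (by simp)).toContinuousLinearEquiv,
    hρ, hρr, fun i => ?_⟩
  change T _ = _
  rw [hT]
  ext j
  simp [Pi.single_apply, add_comm]

/-- The admissible directions may depend on the base point, but only locally. Compactness of the
closure of `Ω` reduces the estimate to finitely many patches, each covered by `eLpNorm_patch`. -/
lemma eLpNorm_le_lintegral_sob {d : ℕ} (hd1 : 1 ≤ d) (hd3 : d ≤ 3) {Ω : Set (E d)}
    (hne : Ω.Nonempty) (ho : IsOpen Ω) (hb : Bornology.IsBounded Ω) (hconv : Convex ℝ Ω) :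
    ∃ C : ℝ≥0∞, C ≠ ⊤ ∧ ∀ φ : E d → ℝ, ContDiff ℝ 1 φ →
      eLpNorm φ (3/2) (volume.restrict Ω) ≤ C * ∫⁻ x in Ω, sob φ x := by
  obtain ⟨x₀, hx₀⟩ := hne
  obtain ⟨r, hr, hball⟩ := Metric.isOpen_iff.1 ho x₀ hx₀
  have hcl : IsCompact (closure Ω) := hb.isCompact_closure
  have main : ∃ C : ℝ≥0∞, C ≠ ⊤ ∧ ∀ φ : E d → ℝ, ContDiff ℝ 1 φ →
      eLpNorm φ (3/2) (volume.restrict (Ω ∩ closure Ω)) ≤ C * ∫⁻ x in Ω, sob φ x := by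
    refine hcl.induction_on (p := fun s => ∃ C : ℝ≥0∞, C ≠ ⊤ ∧ ∀ φ : E d → ℝ, ContDiff ℝ 1 φ →
      eLpNorm φ (3/2) (volume.restrict (Ω ∩ s)) ≤ C * ∫⁻ x in Ω, sob φ x) ?_ ?_ ?_ ?_
    · exact ⟨0, by simp, by simp⟩
    · rintro s t hst ⟨C, hC, h⟩
      exact ⟨C, hC, fun φ hφ => (eLpNorm_mono_measure _ (Measure.restrict_mono
        (inter_subset_inter_right _ hst) le_rfl)).trans (h φ hφ)⟩
    · rintro s t ⟨C, hC, h⟩ ⟨C', hC', h'⟩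
      refine ⟨C + C', by simp [hC, hC'], fun φ hφ => ?_⟩
      rw [add_mul]
      refine le_trans ?_ (add_le_add (h φ hφ) (h' φ hφ))
      rw [inter_union_distrib_left]
      refine (eLpNorm_mono_measure _ (Measure.restrict_union_le _ _)).trans ?_
      have h32 : (0:ℝ) ≤ 1 / (3/2 : ℝ≥0∞).toReal := by positivity
      have h32' : 1 / (3/2 : ℝ≥0∞).toReal ≤ 1 := by
        simp only [ENNReal.toReal_div, ENNReal.toReal_ofNat]; norm_num
      simp only [eLpNorm_eq_lintegral_rpow_enorm_toReal (show (3/2 : ℝ≥0∞) ≠ 0 by simp)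
        (show (3/2 : ℝ≥0∞) ≠ ⊤ by simp [ENNReal.div_eq_top]), lintegral_add_measure]
      -- Subadditivity of `t ↦ t^{2/3}` glues the estimates on two patches.
      exact ENNReal.rpow_add_le_add_rpow _ _ h32 h32'
    -- Near `c` the directions are `x₀ - c + ρ eᵢ`. They carry a point within `r/2` of `c` into the
    -- ball of radius `r` about `x₀`, hence into `Ω`, and convexity keeps the whole segment in `Ω`.
    · intro c _
      obtain ⟨ρ, B, hρ, hρr, hB⟩ := exists_equiv_add_smul_single (x₀ - c) (half_pos hr)
      refine ⟨Metric.ball c (r / 2), mem_nhdsWithin_of_mem_nhds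
        (Metric.ball_mem_nhds _ (half_pos hr)),
        eLpNorm_patch hd1 hd3 ho.measurableSet measurableSet_ball
          (hb.measure_lt_top).ne B fun x hx i s hs => ?_⟩
      refine hconv.add_smul_mem hx.1 (hball ?_) hs
      rw [hB, Metric.mem_ball, dist_eq_norm]
      have h1 : ‖x - c‖ < r / 2 := by simpa [dist_eq_norm] using hx.2
      have h2 : ‖ρ • (EuclideanSpace.single i 1 : E d)‖ = ρ := by
        rw [norm_smul]; simp [abs_of_pos hρ]
      calc ‖x + (x₀ - c + ρ • EuclideanSpace.single i 1) - x₀‖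
          = ‖(x - c) + ρ • EuclideanSpace.single i 1‖ := by congr 1; abel
        _ ≤ ‖x - c‖ + ‖ρ • (EuclideanSpace.single i 1 : E d)‖ := norm_add_le _ _
        _ < r := by linarith
  rwa [inter_eq_left.2 subset_closure] at main

/-- The embedding `W^{1,2} → L^6` for `C^1` functions on a bounded convex domain. -/
lemma eLpNorm_six_le {d : ℕ} (hd1 : 1 ≤ d) (hd3 : d ≤ 3) {Ω : Set (E d)}
    (hne : Ω.Nonempty) (ho : IsOpen Ω) (hb : Bornology.IsBounded Ω) (hconv : Convex ℝ Ω) :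
    ∃ C : ℝ≥0∞, C ≠ ⊤ ∧ ∀ φ : E d → ℝ, ContDiff ℝ 1 φ →
      eLpNorm φ 6 (volume.restrict Ω) ≤ C * (eLpNorm φ 2 (volume.restrict Ω) +
        eLpNorm (fderiv ℝ φ) 2 (volume.restrict Ω)) := by
  obtain ⟨C, hC, h⟩ := eLpNorm_le_lintegral_sob hd1 hd3 hne ho hb hconv
  refine ⟨C * 4, ENNReal.mul_ne_top hC (by simp), fun φ hφ => ?_⟩
  set μ := volume.restrict Ω with hμ
  set X := eLpNorm φ 6 μ with hX
  -- Finiteness of the `L^6` norm is needed beforehand, since the argument ends by cancelling `X³`.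
  have hXt : X ≠ ⊤ := by
    have : IsFiniteMeasure μ := ⟨by simpa [hμ] using hb.measure_lt_top⟩
    obtain ⟨K, hK⟩ := hb.isCompact_closure.exists_bound_of_continuousOn hφ.continuous.continuousOn
    refine (MemLp.of_bound hφ.continuous.aestronglyMeasurable K ?_).2.ne
    exact (ae_restrict_iff' ho.measurableSet).2
      (Filter.Eventually.of_forall fun x hx => hK x (subset_closure hx))
  have hX6 : ∫⁻ x, ‖φ x‖ₑ ^ (6:ℝ) ∂μ = X ^ (6:ℝ) := by
    rw [hX, eLpNorm_eq_lintegral_rpow_enorm_toReal (by simp) (by simp)]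
    simp only [ENNReal.toReal_ofNat]
    rw [← ENNReal.rpow_mul]; norm_num
  have h4 := h (fun x => φ x ^ 4) (hφ.pow 4)
  have hL : eLpNorm (fun x => φ x ^ 4) (3/2) μ = X ^ (4:ℝ) := by
    rw [eLpNorm_eq_lintegral_rpow_enorm_toReal (by simp) (by simp [ENNReal.div_eq_top])]
    have h32 : (3/2 : ℝ≥0∞).toReal = 3/2 := by simp
    have : ∀ x, ‖φ x ^ 4‖ₑ ^ (3/2 : ℝ) = ‖φ x‖ₑ ^ (6:ℝ) := fun x => by
      rw [enorm_pow, ← ENNReal.rpow_natCast, ← ENNReal.rpow_mul]; norm_num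
    rw [h32]
    simp_rw [this]
    rw [hX6, ← ENNReal.rpow_mul]; norm_num
  have hsob : ∀ x, sob (fun x => φ x ^ 4) x ≤ 4 * (‖φ x‖ₑ ^ (3:ℝ) * sob φ x) := by
    intro x
    have h1 : fderiv ℝ (fun x => φ x ^ 4) x = (4 * φ x ^ 3) • fderiv ℝ φ x := by
      have := ((hφ.differentiable one_ne_zero x).hasFDerivAt.pow 4).fderiv
      simpa using this
    have h3 : ‖φ x‖ₑ ^ (3:ℝ) = ‖φ x‖ₑ ^ 3 := by
      rw [← ENNReal.rpow_natCast]; norm_num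
    have h4 : ‖(4:ℝ)‖ₑ = 4 := by
      rw [Real.enorm_eq_ofReal (by norm_num)]; simp
    rw [sob, sob, h1, enorm_smul, enorm_mul, enorm_pow, enorm_pow, h3, h4]
    calc ‖φ x‖ₑ ^ 4 + 4 * ‖φ x‖ₑ ^ 3 * ‖fderiv ℝ φ x‖ₑ
        ≤ 4 * ‖φ x‖ₑ ^ 4 + 4 * ‖φ x‖ₑ ^ 3 * ‖fderiv ℝ φ x‖ₑ := by
          gcongr
          exact le_mul_of_one_le_left zero_le (by norm_num)
      _ = _ := by ring
  have hY : (∫⁻ x, sob φ x ^ (2:ℝ) ∂μ) ^ (1 / (2:ℝ)) ≤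
      eLpNorm φ 2 μ + eLpNorm (fderiv ℝ φ) 2 μ := by
    rw [eLpNorm_eq_lintegral_rpow_enorm_toReal (by simp) (by simp),
      eLpNorm_eq_lintegral_rpow_enorm_toReal (by simp) (by simp)]
    exact ENNReal.lintegral_Lp_add_le hφ.continuous.enorm.aemeasurable
      (hφ.continuous_fderiv one_ne_zero).enorm.aemeasurable one_le_two
  have hR : ∫⁻ x, ‖φ x‖ₑ ^ (3:ℝ) * sob φ x ∂μ ≤
      X ^ (3:ℝ) * (eLpNorm φ 2 μ + eLpNorm (fderiv ℝ φ) 2 μ) := by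
    refine (ENNReal.lintegral_mul_le_Lp_mul_Lq μ Real.HolderConjugate.two_two
      (hφ.continuous.enorm.measurable.pow_const _).aemeasurable
      (continuous_sob hφ).aemeasurable).trans ?_
    refine mul_le_mul' (le_of_eq ?_) hY
    have : ∀ x, (‖φ x‖ₑ ^ (3:ℝ)) ^ (2:ℝ) = ‖φ x‖ₑ ^ (6:ℝ) := fun x => by
      rw [← ENNReal.rpow_mul]; norm_num
    simp_rw [this]
    rw [hX6, ← ENNReal.rpow_mul]; norm_num
  by_cases hX0 : X = 0
  · rw [hX0]; exact zero_le
  have hX30 : X ^ (3:ℝ) ≠ 0 := by simp [hX0]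
  have hX3t : X ^ (3:ℝ) ≠ ⊤ := ENNReal.rpow_ne_top_of_nonneg (by norm_num) hXt
  rw [← ENNReal.mul_le_mul_iff_right hX30 hX3t]
  calc X ^ (3:ℝ) * X = X ^ (4:ℝ) := by
        nth_rw 2 [← ENNReal.rpow_one X]
        rw [← ENNReal.rpow_add _ _ hX0 hXt]; norm_num
    _ ≤ C * ∫⁻ x, sob (fun x => φ x ^ 4) x ∂μ := hL ▸ h4
    _ ≤ C * ∫⁻ x, 4 * (‖φ x‖ₑ ^ (3:ℝ) * sob φ x) ∂μ := by gcongr with x; exact hsob x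
    _ = C * (4 * ∫⁻ x, ‖φ x‖ₑ ^ (3:ℝ) * sob φ x ∂μ) := by
        rw [lintegral_const_mul' _ _ (by simp)]
    _ ≤ C * (4 * (X ^ (3:ℝ) * (eLpNorm φ 2 μ + eLpNorm (fderiv ℝ φ) 2 μ))) := by gcongr
    _ = _ := by ring

/-! ### Approximate identities and mollification in `L²`. -/

/-- The Schur test in `L²` for a nonnegative kernel. -/
lemma eLpNorm_integral_mul_le {α : Type*} [MeasurableSpace α] {μ : Measure α} [SFinite μ]
    {K : α → α → ℝ} (hK : Measurable (Function.uncurry K)) (h0 : ∀ x y, 0 ≤ K x y)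
    {C : ℝ≥0∞} (h1 : ∀ᵐ x ∂μ, ∫⁻ y, ENNReal.ofReal (K x y) ∂μ ≤ 1)
    (h2 : ∀ᵐ y ∂μ, ∫⁻ x, ENNReal.ofReal (K x y) ∂μ ≤ C ^ (2:ℝ))
    {f : α → ℝ} (hf : AEStronglyMeasurable f μ) :
    eLpNorm (fun x => ∫ y, f y * K x y ∂μ) 2 μ ≤ C * eLpNorm f 2 μ := by
  have hKx : ∀ x, Measurable fun y => ENNReal.ofReal (K x y) := fun x =>
    (hK.comp measurable_prodMk_left).ennreal_ofReal
  have hpt : ∀ᵐ x ∂μ, ‖∫ y, f y * K x y ∂μ‖ₑ ^ (2:ℝ) ≤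
      ∫⁻ y, ‖f y‖ₑ ^ (2:ℝ) * ENNReal.ofReal (K x y) ∂μ := by
    filter_upwards [h1] with x hx
    -- The kernel is split as `K^{1/2} K^{1/2}`. Cauchy–Schwarz then leaves `∫ f² K`, as the
    -- remaining factor is at most one by the row bound.
    have ha : ‖∫ y, f y * K x y ∂μ‖ₑ ≤ ∫⁻ y, (‖f y‖ₑ * ENNReal.ofReal (K x y) ^ (1/2:ℝ)) *
        ENNReal.ofReal (K x y) ^ (1/2:ℝ) ∂μ := by
      refine (enorm_integral_le_lintegral_enorm _).trans (lintegral_mono fun y => le_of_eq ?_)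
      rw [mul_assoc, ← ENNReal.rpow_add_of_nonneg _ _ (by norm_num) (by norm_num), enorm_mul,
        Real.enorm_eq_ofReal (h0 x y)]
      norm_num
    have hb := ha.trans (ENNReal.lintegral_mul_le_Lp_mul_Lq μ Real.HolderConjugate.two_two
      (hf.enorm.mul ((hKx x).pow_const _).aemeasurable) ((hKx x).pow_const _).aemeasurable)
    have e1 : ∀ y, (‖f y‖ₑ * ENNReal.ofReal (K x y) ^ (1/2:ℝ)) ^ (2:ℝ) =
        ‖f y‖ₑ ^ (2:ℝ) * ENNReal.ofReal (K x y) := fun y => by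
      rw [ENNReal.mul_rpow_of_nonneg _ _ (by norm_num), ← ENNReal.rpow_mul]; norm_num
    have e2 : ∀ y, (ENNReal.ofReal (K x y) ^ (1/2:ℝ)) ^ (2:ℝ) = ENNReal.ofReal (K x y) := fun y => by
      rw [← ENNReal.rpow_mul]; norm_num
    simp only [e1, e2] at hb
    have hc : ‖∫ y, f y * K x y ∂μ‖ₑ ≤
        (∫⁻ y, ‖f y‖ₑ ^ (2:ℝ) * ENNReal.ofReal (K x y) ∂μ) ^ (1/2:ℝ) := by
      refine hb.trans ((mul_le_mul_right (ENNReal.rpow_le_one hx (by norm_num)) _).trans ?_)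
      rw [mul_one]
    refine (ENNReal.rpow_le_rpow hc (by norm_num)).trans (le_of_eq ?_)
    rw [← ENNReal.rpow_mul]; norm_num
  rw [eLpNorm_eq_lintegral_rpow_enorm_toReal (by simp) (by simp),
    eLpNorm_eq_lintegral_rpow_enorm_toReal (by simp) (by simp)]
  simp only [ENNReal.toReal_ofNat]
  have hint : ∫⁻ x, ‖∫ y, f y * K x y ∂μ‖ₑ ^ (2:ℝ) ∂μ ≤
      C ^ (2:ℝ) * ∫⁻ y, ‖f y‖ₑ ^ (2:ℝ) ∂μ := by
    refine (lintegral_mono_ae hpt).trans ?_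
    rw [lintegral_lintegral_swap]
    · have : ∀ y, ∫⁻ x, ‖f y‖ₑ ^ (2:ℝ) * ENNReal.ofReal (K x y) ∂μ =
          ‖f y‖ₑ ^ (2:ℝ) * ∫⁻ x, ENNReal.ofReal (K x y) ∂μ := fun y =>
        lintegral_const_mul _ (hK.comp measurable_prodMk_right).ennreal_ofReal
      simp_rw [this]
      rw [← lintegral_const_mul'' _ (hf.enorm.pow_const _)]
      refine lintegral_mono_ae ?_
      filter_upwards [h2] with y hy
      rw [mul_comm]
      gcongr
    · exact ((hf.enorm.pow_const _).comp_quasiMeasurePreserving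
        Measure.quasiMeasurePreserving_snd).mul hK.ennreal_ofReal.aemeasurable
  refine (ENNReal.rpow_le_rpow hint (by norm_num)).trans (le_of_eq ?_)
  rw [ENNReal.mul_rpow_of_nonneg _ _ (by norm_num), ← ENNReal.rpow_mul]
  norm_num

/-- Dominated convergence in `L²`. -/
lemma tendsto_eLpNorm_two_of_dominated {α : Type*} [MeasurableSpace α] {μ : Measure α}
    {h : ℕ → α → ℝ} {b : α → ℝ} (hm : ∀ n, AEStronglyMeasurable (h n) μ) (hb : MemLp b 2 μ)
    (hle : ∀ n, ∀ᵐ x ∂μ, |h n x| ≤ b x) (hlim : ∀ᵐ x ∂μ, Tendsto (fun n => h n x) atTop (𝓝 0)) :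
    Tendsto (fun n => eLpNorm (h n) 2 μ) atTop (𝓝 0) := by
  have key : Tendsto (fun n => ∫⁻ x, ‖h n x‖ₑ ^ (2:ℝ) ∂μ) atTop (𝓝 (∫⁻ _, 0 ∂μ)) := by
    refine tendsto_lintegral_of_dominated_convergence' (fun x => ‖b x‖ₑ ^ (2:ℝ))
      (fun n => (hm n).enorm.pow_const _) ?_ ?_ ?_
    · intro n
      filter_upwards [hle n] with x hx
      refine ENNReal.rpow_le_rpow ?_ (by norm_num)
      rw [enorm_le_iff_norm_le]
      exact hx.trans (le_abs_self _)
    · have := lintegral_rpow_enorm_lt_top_of_eLpNorm_lt_top (by simp) (by simp) hb.2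
      simpa using this.ne
    · filter_upwards [hlim] with x hx
      have := ((ENNReal.continuous_rpow_const (y := 2)).tendsto _).comp hx.enorm
      simpa [Function.comp_def] using this
  simp only [eLpNorm_eq_lintegral_rpow_enorm_toReal (show (2 : ℝ≥0∞) ≠ 0 by simp)
    (show (2 : ℝ≥0∞) ≠ ⊤ by simp), ENNReal.toReal_ofNat]
  have := ((ENNReal.continuous_rpow_const (y := 1/2)).tendsto _).comp key
  simpa [Function.comp_def] using this

/-- Convergence in `L²` of integral operators whose kernels form an approximate identity. -/
lemma tendsto_eLpNorm_integral_mul_sub {d : ℕ} {μ : Measure (E d)} [IsFiniteMeasure μ]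
    {K : ℕ → E d → E d → ℝ} (hK : ∀ n, Continuous (Function.uncurry (K n)))
    (h0 : ∀ n x y, 0 ≤ K n x y) {C : ℝ≥0∞} (hC : C ≠ ⊤)
    (h1 : ∀ n, ∀ᵐ x ∂μ, ∫⁻ y, ENNReal.ofReal (K n x y) ∂μ ≤ 1)
    (h2 : ∀ n, ∀ᵐ y ∂μ, ∫⁻ x, ENNReal.ofReal (K n x y) ∂μ ≤ C ^ (2:ℝ))
    (hbd : ∀ n x, ∃ M, ∀ᵐ y ∂μ, |K n x y| ≤ M)
    (happ : ∀ g : E d → ℝ, Continuous g → ∀ᵐ x ∂μ,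
      Tendsto (fun n => ∫ y, g y * K n x y ∂μ) atTop (𝓝 (g x)))
    {f : E d → ℝ} (hf : MemLp f 2 μ) :
    Tendsto (fun n => eLpNorm (fun x => (∫ y, f y * K n x y ∂μ) - f x) 2 μ) atTop (𝓝 0) := by
  have hmeas : ∀ n (g : E d → ℝ), AEStronglyMeasurable g μ →
      AEStronglyMeasurable (fun x => ∫ y, g y * K n x y ∂μ) μ := by
    intro n g hg
    have : AEStronglyMeasurable (Function.uncurry fun x y => g y * K n x y) (μ.prod μ) :=
      (hg.comp_quasiMeasurePreserving Measure.quasiMeasurePreserving_snd).mul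
        (hK n).aestronglyMeasurable
    exact this.integral_prod_right'
  have hint : ∀ n x (g : E d → ℝ), MemLp g 2 μ → Integrable (fun y => g y * K n x y) μ := by
    intro n x g hg
    obtain ⟨M, hM⟩ := hbd n x
    exact (hg.integrable (by norm_num)) |>.mul_bdd (c := M)
      ((hK n).comp (Continuous.prodMk_right x)).aestronglyMeasurable hM
  rw [ENNReal.tendsto_nhds_zero]
  intro ε hε
  -- With `g` continuous, compactly supported and `δ`-close to `f`, the total error is `Cδ` from the
  -- operator applied to `f - g`, `δ` from the convergence for `g`, and `δ` from `f - g` itself.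
  obtain ⟨δ, hδ, hδε⟩ : ∃ δ : ℝ≥0∞, δ ≠ 0 ∧ (C + 1) * δ + δ ≤ ε := by
    by_cases hεt : ε = ⊤
    · exact ⟨1, one_ne_zero, by simp [hεt]⟩
    refine ⟨ε / (C + 2), (ENNReal.div_pos hε.ne' (by simp [hC])).ne', le_of_eq ?_⟩
    rw [← add_one_mul, add_assoc, one_add_one_eq_two, ENNReal.mul_div_cancel (by simp) (by simp [hC])]
  obtain ⟨g, hgs, hfg, hgc, hg2⟩ := hf.exists_hasCompactSupport_eLpNorm_sub_le (by simp) hδ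
  obtain ⟨M, hM⟩ := hgs.exists_bound_of_continuous hgc
  have hgconv : Tendsto (fun n => eLpNorm (fun x => (∫ y, g y * K n x y ∂μ) - g x) 2 μ) atTop
      (𝓝 0) := by
    refine tendsto_eLpNorm_two_of_dominated (fun n => (hmeas n _ hg2.1).sub hg2.1)
      (memLp_const (M + M)) (fun n => ?_) ?_
    · filter_upwards [h1 n] with x hx
      refine (abs_sub _ _).trans (add_le_add ?_ (hM x))
      have hKi : Integrable (fun y => K n x y) μ := by
        simpa using hint n x 1 (memLp_const 1)
      have hK1 : ∫ y, K n x y ∂μ ≤ 1 := by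
        rw [integral_eq_lintegral_of_nonneg_ae (Eventually.of_forall (h0 n x)) hKi.1]
        exact ENNReal.toReal_le_of_le_ofReal zero_le_one (by simpa using hx)
      have hM0 : 0 ≤ M := (norm_nonneg _).trans (hM x)
      calc ‖∫ y, g y * K n x y ∂μ‖ ≤ ∫ y, M * K n x y ∂μ := by
            refine norm_integral_le_of_norm_le (hKi.const_mul M) (Eventually.of_forall fun y => ?_)
            rw [norm_mul, Real.norm_of_nonneg (h0 n x y)]
            exact mul_le_mul_of_nonneg_right (hM y) (h0 n x y)
        _ ≤ M := by
            rw [integral_const_mul]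
            exact mul_le_of_le_one_right hM0 hK1
    · filter_upwards [happ g hgc] with x hx
      simpa using hx.sub_const (g x)
  filter_upwards [(ENNReal.tendsto_nhds_zero.1 hgconv) δ (pos_iff_ne_zero.2 hδ)] with n hn
  have hdec : (fun x => (∫ y, f y * K n x y ∂μ) - f x) =
      ((fun x => ∫ y, (f - g) y * K n x y ∂μ) + (fun x => (∫ y, g y * K n x y ∂μ) - g x)) -
        (f - g) := by
    ext x
    have : ∫ y, (f - g) y * K n x y ∂μ = ∫ y, f y * K n x y ∂μ - ∫ y, g y * K n x y ∂μ := by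
      rw [← integral_sub (hint n x f hf) (hint n x g hg2)]
      simp [sub_mul]
    simp only [Pi.sub_apply, Pi.add_apply] at this ⊢
    rw [this]; ring
  rw [hdec]
  have hfgm := hf.1.sub hg2.1
  refine (eLpNorm_sub_le ((hmeas n _ hfgm).add ((hmeas n _ hg2.1).sub hg2.1)) hfgm one_le_two).trans ?_
  refine (add_le_add (eLpNorm_add_le (hmeas n _ hfgm) ((hmeas n _ hg2.1).sub hg2.1) one_le_two)
    le_rfl).trans ?_
  refine (add_le_add (add_le_add
    ((eLpNorm_integral_mul_le (hK n).measurable (h0 n) (h1 n) (h2 n) hfgm).trans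
      (mul_le_mul_right hfg C)) hn) hfg).trans (le_trans (le_of_eq ?_) hδε)
  ring

/-- The function `x ↦ ∫ f(y) k(l x + b - y) dμ(y)`. -/
def smear {d : ℕ} (μ : Measure (E d)) (k : E d → ℝ) (l : ℝ) (b : E d) (f : E d → ℝ) (x : E d) : ℝ :=
  ∫ y, f y * k (l • x + b - y) ∂μ

section smear
variable {d : ℕ} {μ : Measure (E d)} {k : E d → ℝ} {l : ℝ} {b : E d} {f : E d → ℝ} {R : ℝ}

lemma exists_bound_of_bounded {F : Type*} [NormedAddCommGroup F] {k : E d → F}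
    (hk : Continuous k) (l : ℝ) (b x₀ : E d) (R : ℝ) :
    ∃ M, ∀ x ∈ Metric.ball x₀ 1, ∀ y, ‖y‖ ≤ R → ‖k (l • x + b - y)‖ ≤ M := by
  obtain ⟨M, hM⟩ := (isCompact_closedBall (0 : E d) (|l| * (‖x₀‖ + 1) + ‖b‖ + R)).exists_bound_of_continuousOn
    hk.continuousOn
  refine ⟨M, fun x hx y hy => hM _ ?_⟩
  rw [mem_closedBall_zero_iff]
  have hx' : ‖x‖ ≤ ‖x₀‖ + 1 := by
    have h1 : ‖x - x₀‖ < 1 := by simpa [dist_eq_norm] using hx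
    calc ‖x‖ = ‖x₀ + (x - x₀)‖ := by congr 1; abel
      _ ≤ ‖x₀‖ + ‖x - x₀‖ := norm_add_le _ _
      _ ≤ _ := by linarith
  calc ‖l • x + b - y‖ ≤ ‖l • x + b‖ + ‖y‖ := norm_sub_le _ _
    _ ≤ (‖l • x‖ + ‖b‖) + R := add_le_add (norm_add_le _ _) hy
    _ ≤ _ := by rw [norm_smul, Real.norm_eq_abs]; gcongr

lemma integrable_mul_smear_kernel (hk : Continuous k) (hR : ∀ᵐ y ∂μ, ‖y‖ ≤ R)
    (hf : Integrable f μ) (x : E d) : Integrable (fun y => f y * k (l • x + b - y)) μ := by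
  obtain ⟨M, hM⟩ := exists_bound_of_bounded hk l b x R
  refine hf.mul_bdd (c := M) (by fun_prop) ?_
  filter_upwards [hR] with y hy using hM x (Metric.mem_ball_self one_pos) y hy

lemma hasFDerivAt_smear (hk : ContDiff ℝ 1 k) (hR : ∀ᵐ y ∂μ, ‖y‖ ≤ R) (hf : Integrable f μ)
    (x₀ : E d) : Integrable (fun y => (f y * l) • fderiv ℝ k (l • x₀ + b - y)) μ ∧
    HasFDerivAt (smear μ k l b f) (∫ y, (f y * l) • fderiv ℝ k (l • x₀ + b - y) ∂μ) x₀ := by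
  have hk' : Continuous (fderiv ℝ k) := hk.continuous_fderiv one_ne_zero
  obtain ⟨M, hM⟩ := exists_bound_of_bounded hk' l b x₀ R
  have hm : AEStronglyMeasurable (fun y => (f y * l) • fderiv ℝ k (l • x₀ + b - y)) μ :=
    (hf.1.mul_const l).smul (by fun_prop : Continuous fun y => fderiv ℝ k (l • x₀ + b - y)).aestronglyMeasurable
  have hbound : Integrable (fun y => ‖f y * l‖ * M) μ := (hf.mul_const l).norm.mul_const M
  refine ⟨hbound.mono' hm ?_, ?_⟩
  · filter_upwards [hR] with y hy
    rw [norm_smul]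
    gcongr
    exact hM x₀ (Metric.mem_ball_self one_pos) y hy
  refine hasFDerivAt_integral_of_dominated_of_fderiv_le (F := fun x y => f y * k (l • x + b - y))
    (F' := fun x y => (f y * l) • fderiv ℝ k (l • x + b - y))
    (Metric.ball_mem_nhds x₀ one_pos) ?_ (integrable_mul_smear_kernel hk.continuous hR hf x₀) hm
    (bound := fun y => ‖f y * l‖ * M) ?_ hbound ?_
  · exact Eventually.of_forall fun x => (integrable_mul_smear_kernel hk.continuous hR hf x).1
  · filter_upwards [hR] with y hy x hx
    rw [norm_smul]
    gcongr
    exact hM x hx y hy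
  · refine Eventually.of_forall fun y x _ => ?_
    have h1 : HasFDerivAt (fun x : E d => l • x + b - y) (l • ContinuousLinearMap.id ℝ (E d)) x :=
      (((hasFDerivAt_id x).const_smul l).add_const b).sub_const y
    have h2 := ((hk.differentiable one_ne_zero (l • x + b - y)).hasFDerivAt.comp x h1).const_mul (f y)
    convert! h2 using 1
    ext v
    simp [mul_assoc]

lemma contDiff_smear (hk : ContDiff ℝ 1 k) (hR : ∀ᵐ y ∂μ, ‖y‖ ≤ R) (hf : Integrable f μ) :
    ContDiff ℝ 1 (smear μ k l b f) := by
  have hk' : Continuous (fderiv ℝ k) := hk.continuous_fderiv one_ne_zero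
  rw [contDiff_one_iff_fderiv]
  refine ⟨fun x => (hasFDerivAt_smear hk hR hf x).2.differentiableAt, ?_⟩
  have : fderiv ℝ (smear μ k l b f) =
      fun x => ∫ y, (f y * l) • fderiv ℝ k (l • x + b - y) ∂μ :=
    funext fun x => (hasFDerivAt_smear hk hR hf x).2.fderiv
  rw [this, continuous_iff_continuousAt]
  intro x₀
  obtain ⟨M, hM⟩ := exists_bound_of_bounded hk' l b x₀ R
  refine continuousAt_of_dominated (bound := fun y => ‖f y * l‖ * M) ?_ ?_
    ((hf.mul_const l).norm.mul_const M) ?_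
  · exact Eventually.of_forall fun x => (hasFDerivAt_smear hk hR hf x).1.1
  · filter_upwards [Metric.ball_mem_nhds x₀ one_pos] with x hx
    filter_upwards [hR] with y hy
    rw [norm_smul]
    gcongr
    exact hM x hx y hy
  · exact Eventually.of_forall fun y => by fun_prop

lemma partialD_smear (hk : ContDiff ℝ 1 k) (hR : ∀ᵐ y ∂μ, ‖y‖ ≤ R) (hf : Integrable f μ)
    (i : Fin d) (x : E d) : Setting.partialD i (smear μ k l b f) x =
      l * ∫ y, f y * Setting.partialD i k (l • x + b - y) ∂μ := by
  obtain ⟨h1, h2⟩ := hasFDerivAt_smear (l := l) (b := b) hk hR hf x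
  rw [Setting.partialD, h2.fderiv, ContinuousLinearMap.integral_apply h1, ← integral_const_mul]
  refine integral_congr_ae (Eventually.of_forall fun y => ?_)
  simp only [Setting.partialD, smul_apply, smul_eq_mul]
  ring

lemma partialD_const_sub (hk : ContDiff ℝ 1 k) (i : Fin d) (p y : E d) :
    Setting.partialD i (fun y => k (p - y)) y = - Setting.partialD i k (p - y) := by
  have h1 : HasFDerivAt (fun y : E d => p - y) (-ContinuousLinearMap.id ℝ (E d)) y :=
    (hasFDerivAt_id y).const_sub p
  have := ((hk.differentiable one_ne_zero (p - y)).hasFDerivAt.comp y h1).fderiv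
  simp only [Setting.partialD]
  rw [show (fun y => k (p - y)) = k ∘ fun y => p - y from rfl, this]
  simp

end smear

namespace Setting
variable {d : ℕ} {S : Setting d}

/-- The gradient of a mollification is the mollification of the weak gradient. -/
lemma IsWeakGrad.partialD_smear {u : E d → ℝ} {G : Fin d → E d → ℝ} (h : S.IsWeakGrad u G)
    {k : E d → ℝ} {l : ℝ} {b : E d} {R : ℝ} (hk : ContDiff ℝ 1 k) (hR : ∀ᵐ y ∂S.mu, ‖y‖ ≤ R)
    (hu : Integrable u S.mu) {x : E d} (hx : S.IsTest fun y => k (l • x + b - y)) (i : Fin d) :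
    partialD i (smear S.mu k l b u) x = l * smear S.mu k l b (G i) x := by
  rw [CahnHilliard.partialD_smear hk hR hu]
  have := h _ hx i
  -- The reflection `y ↦ l x + b - y` in the test function produces a sign that cancels the one in
  -- the definition of the weak gradient.
  simp only [partialD_const_sub hk, mul_neg, integral_neg, neg_inj] at this
  rw [this]
  rfl

end Setting

namespace Setting
variable {d : ℕ} {S : Setting d}

/-- Approximation of a pair `(u, ∇u)` by mollification with a family of kernels. -/
lemma IsWeakGrad.tendsto_smear [IsFiniteMeasure S.mu] {k : ℕ → E d → ℝ} {l : ℕ → ℝ} {b : ℕ → E d}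
    {R : ℝ} (hk : ∀ n, ContDiff ℝ 1 (k n)) (hR : ∀ᵐ y ∂S.mu, ‖y‖ ≤ R)
    (hl : Tendsto l atTop (𝓝 1)) (h0 : ∀ n x, 0 ≤ k n x) {C : ℝ≥0∞} (hC : C ≠ ⊤)
    (htest : ∀ n, ∀ᵐ x ∂S.mu, S.IsTest fun y => k n (l n • x + b n - y))
    (h1 : ∀ n, ∀ᵐ x ∂S.mu, ∫⁻ y, ENNReal.ofReal (k n (l n • x + b n - y)) ∂S.mu ≤ 1)
    (h2 : ∀ n, ∀ᵐ y ∂S.mu, ∫⁻ x, ENNReal.ofReal (k n (l n • x + b n - y)) ∂S.mu ≤ C ^ (2:ℝ))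
    (happ : ∀ g : E d → ℝ, Continuous g → ∀ᵐ x ∂S.mu,
      Tendsto (fun n => ∫ y, g y * k n (l n • x + b n - y) ∂S.mu) atTop (𝓝 (g x)))
    {u : E d → ℝ} {G : Fin d → E d → ℝ} (hu : MemLp u 2 S.mu) (hG : ∀ i, MemLp (G i) 2 S.mu)
    (h : S.IsWeakGrad u G) :
    Tendsto (fun n => eLpNorm (fun x => smear S.mu (k n) (l n) (b n) u x - u x) 2 S.mu)
      atTop (𝓝 0) ∧ ∀ i, Tendsto (fun n => eLpNorm (fun x =>
        partialD i (smear S.mu (k n) (l n) (b n) u) x - G i x) 2 S.mu) atTop (𝓝 0) := by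
  have hconv : ∀ f : E d → ℝ, MemLp f 2 S.mu → Tendsto (fun n =>
      eLpNorm (fun x => smear S.mu (k n) (l n) (b n) f x - f x) 2 S.mu) atTop (𝓝 0) := by
    intro f hf
    refine tendsto_eLpNorm_integral_mul_sub (K := fun n x y => k n (l n • x + b n - y))
      (fun n => (hk n).continuous.comp (by fun_prop)) (fun n x y => h0 n _) hC h1 h2 ?_ happ hf
    intro n x
    obtain ⟨M, hM⟩ := exists_bound_of_bounded (hk n).continuous (l n) (b n) x R
    exact ⟨M, by filter_upwards [hR] with y hy using hM x (Metric.mem_ball_self one_pos) y hy⟩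
  refine ⟨hconv u hu, fun i => ?_⟩
  have hle : ∀ n, eLpNorm (fun x => partialD i (smear S.mu (k n) (l n) (b n) u) x - G i x) 2 S.mu ≤
      ‖l n‖ₑ * eLpNorm (fun x => smear S.mu (k n) (l n) (b n) (G i) x - G i x) 2 S.mu +
        ‖l n - 1‖ₑ * eLpNorm (G i) 2 S.mu := by
    intro n
    -- The gradient of the smeared function is `l` times the smeared weak gradient. The factor `l`
    -- tends to one and costs only the extra term `(l - 1) G`.
    have hae : (fun x => partialD i (smear S.mu (k n) (l n) (b n) u) x - G i x) =ᵐ[S.mu]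
        l n • (fun x => smear S.mu (k n) (l n) (b n) (G i) x - G i x) + (l n - 1) • G i := by
      filter_upwards [htest n] with x hx
      rw [h.partialD_smear (hk n) hR (hu.integrable (by norm_num)) hx i]
      simp only [Pi.add_apply, Pi.smul_apply, smul_eq_mul]
      ring
    rw [eLpNorm_congr_ae hae]
    have hm : AEStronglyMeasurable (fun x => smear S.mu (k n) (l n) (b n) (G i) x - G i x) S.mu :=
      (contDiff_smear (hk n) hR ((hG i).integrable (by norm_num))).continuous.aestronglyMeasurable.sub
        (hG i).1
    refine (eLpNorm_add_le (hm.const_smul _) ((hG i).1.const_smul _) one_le_two).trans ?_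
    rw [eLpNorm_const_smul, eLpNorm_const_smul]
  have hlim : Tendsto (fun n => ‖l n‖ₑ * eLpNorm (fun x =>
      smear S.mu (k n) (l n) (b n) (G i) x - G i x) 2 S.mu + ‖l n - 1‖ₑ * eLpNorm (G i) 2 S.mu)
      atTop (𝓝 (‖(1:ℝ)‖ₑ * 0 + ‖(1:ℝ) - 1‖ₑ * eLpNorm (G i) 2 S.mu)) := by
    refine (ENNReal.Tendsto.mul hl.enorm (by simp) (hconv _ (hG i)) (by simp)).add
      (ENNReal.Tendsto.mul_const (hl.sub_const 1).enorm (Or.inr (hG i).2.ne))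
  refine tendsto_of_tendsto_of_tendsto_of_le_of_le tendsto_const_nhds ?_
    (fun _ => zero_le) hle
  simpa using hlim

end Setting

/-! ### Density of smooth functions on convex domains. -/

section bump
variable {d : ℕ}

lemma lintegral_ofReal_normed (φ : ContDiffBump (0 : E d)) :
    ∫⁻ y, ENNReal.ofReal (φ.normed volume y) = 1 := by
  rw [← ofReal_integral_eq_lintegral_ofReal φ.integrable_normed
    (Eventually.of_forall φ.nonneg_normed), φ.integral_normed, ENNReal.ofReal_one]

/-- The substitution has Jacobian `l^{-d} ≤ 2^d`. This is the column bound in the Schur test for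
mollification at contracted points. -/
lemma lintegral_ofReal_normed_comp_smul (φ : ContDiffBump (0 : E d)) {l : ℝ} (hl : 1/2 ≤ l)
    (b : E d) : ∫⁻ x, ENNReal.ofReal (φ.normed volume (l • x + b)) ≤ 2 ^ d := by
  have hl0 : l ≠ 0 := by linarith
  set F : E d → ℝ≥0∞ := fun x => ENNReal.ofReal (φ.normed volume (x + b)) with hF
  have hFm : Measurable F := (φ.continuous_normed.comp (by fun_prop)).measurable.ennreal_ofReal
  have h1 : ∫⁻ x, F (l • x) = ∫⁻ x, F x ∂(Measure.map (l • ·) (volume : Measure (E d))) :=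
    (lintegral_map hFm (measurable_const_smul l)).symm
  change ∫⁻ x, F (l • x) ≤ _
  rw [h1, Measure.map_addHaar_smul _ hl0, lintegral_smul_measure]
  have h2 : ∫⁻ x, F x = 1 := by
    rw [hF, lintegral_add_right_eq_self (fun x => ENNReal.ofReal (φ.normed volume x)) b]
    exact lintegral_ofReal_normed φ
  rw [h2, smul_eq_mul, mul_one, finrank_euclideanSpace_fin]
  have h3 : |(l ^ d)⁻¹| ≤ 2 ^ d := by
    rw [abs_of_nonneg (by positivity), ← inv_pow]
    refine pow_le_pow_left₀ (by positivity) ?_ d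
    rw [inv_le_comm₀ (by linarith) two_pos]; linarith
  refine (ENNReal.ofReal_le_ofReal h3).trans (le_of_eq ?_)
  rw [ENNReal.ofReal_pow (by norm_num)]; simp

/-- A point of this ball is `(1 - s) x + s x'` with `x'` in the ball of radius `r` about `x₀`, hence
a convex combination of points of `Ω`. -/
lemma closedBall_homothety_subset {Ω : Set (E d)} (hconv : Convex ℝ Ω) {x₀ : E d} {r : ℝ}
    (hball : Metric.ball x₀ r ⊆ Ω) {x : E d} (hx : x ∈ Ω) {s ρ : ℝ} (hs : 0 < s) (hs1 : s ≤ 1)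
    (hρ : ρ < s * r) : Metric.closedBall ((1 - s) • x + s • x₀) ρ ⊆ Ω := by
  intro y hy
  rw [mem_closedBall_iff_norm] at hy
  have h1 : x₀ + s⁻¹ • (y - ((1 - s) • x + s • x₀)) ∈ Ω := by
    refine hball ?_
    rw [mem_ball_iff_norm, add_sub_cancel_left, norm_smul, norm_inv, Real.norm_of_nonneg hs.le,
      inv_mul_lt_iff₀ hs]
    exact hy.trans_lt hρ
  have h2 := hconv hx h1 (sub_nonneg.2 hs1) hs.le (by ring)
  rw [smul_add, smul_smul, mul_inv_cancel₀ hs.ne', one_smul] at h2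
  convert! h2 using 1
  abel

/-- Mollifying at `(1 - s) x + s x₀` with radius `s r / 2` only sees values inside `Ω`, and the
translated kernel is a genuine test function there. Thus neither an extension operator nor boundary
regularity beyond convexity is needed. -/
lemma exists_contDiff_tendsto_of_isWeakGrad_neumann {Ω : Set (E d)}
    (hne : Ω.Nonempty) (ho : IsOpen Ω) (hb : Bornology.IsBounded Ω) (hconv : Convex ℝ Ω)
    {u : E d → ℝ} {G : Fin d → E d → ℝ} (hu : MemLp u 2 (Setting.neumann Ω).mu)
    (hG : ∀ i, MemLp (G i) 2 (Setting.neumann Ω).mu) (h : (Setting.neumann Ω).IsWeakGrad u G) :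
    ∃ φ : ℕ → E d → ℝ, (∀ n, ContDiff ℝ 1 (φ n)) ∧
      Tendsto (fun n => eLpNorm (fun x => φ n x - u x) 2 (Setting.neumann Ω).mu) atTop (𝓝 0) ∧
      ∀ i, Tendsto (fun n => eLpNorm (fun x => Setting.partialD i (φ n) x - G i x) 2
        (Setting.neumann Ω).mu) atTop (𝓝 0) := by
  obtain ⟨x₀, hx₀⟩ := hne
  obtain ⟨r, hr, hball⟩ := Metric.isOpen_iff.1 ho x₀ hx₀
  obtain ⟨R, hR⟩ := hb.exists_norm_le
  have hmu : (Setting.neumann Ω).mu = volume.restrict Ω := rfl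
  have hfin : IsFiniteMeasure (Setting.neumann Ω).mu :=
    ⟨by rw [hmu, Measure.restrict_apply_univ]; exact hb.measure_lt_top⟩
  have hae : ∀ {p : E d → Prop}, (∀ x ∈ Ω, p x) → ∀ᵐ x ∂(Setting.neumann Ω).mu, p x := fun hp =>
    (ae_restrict_iff' ho.measurableSet).2 (Eventually.of_forall hp)
  -- Starting at `1/2` keeps the contraction factor `1 - s` at least `1/2`, as the Jacobian bound
  -- requires.
  set s : ℕ → ℝ := fun n => 1 / ((n : ℝ) + 1 + 1) with hs
  have hs0 : ∀ n, 0 < s n := fun n => by positivity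
  have hs12 : ∀ n, s n ≤ 1 / 2 := fun n => by
    refine one_div_le_one_div_of_le two_pos ?_
    have : (0:ℝ) ≤ n := Nat.cast_nonneg n
    linarith
  have hslim : Tendsto s atTop (𝓝 0) :=
    (tendsto_one_div_add_atTop_nhds_zero_nat (𝕜 := ℝ)).comp (tendsto_add_atTop_nat 1) |>.congr
      fun n => by simp [hs]
  let φ : ℕ → ContDiffBump (0 : E d) := fun n =>
    ⟨s n * r / 4, s n * r / 2, by have := hs0 n; positivity, by
      have := mul_pos (hs0 n) hr; linarith⟩
  have hρ : ∀ n, (φ n).rOut < s n * r := fun n => by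
    have := mul_pos (hs0 n) hr
    change s n * r / 2 < _; linarith
  have hk : ∀ n, ContDiff ℝ ∞ ((φ n).normed volume) := fun n => (φ n).contDiff_normed
  refine ⟨fun n => smear (Setting.neumann Ω).mu ((φ n).normed volume) (1 - s n) (s n • x₀) u,
    fun n => contDiff_smear ((hk n).of_le (by simp)) (hae hR) (hu.integrable (by norm_num)), ?_⟩
  refine h.tendsto_smear (k := fun n => (φ n).normed volume) (l := fun n => 1 - s n)
    (b := fun n => s n • x₀) (C := (2 ^ d) ^ (1/2 : ℝ)) (fun n => (hk n).of_le (by simp))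
    (hae hR) (by simpa using hslim.const_sub 1) (fun n => (φ n).nonneg_normed) 
    (ENNReal.rpow_ne_top_of_nonneg (by norm_num) (by simp)) ?_ ?_ ?_ ?_ hu hG
  · refine fun n => hae fun x hx => ?_
    set p := (1 - s n) • x + s n • x₀
    have hsupp : Function.support (fun y => (φ n).normed volume (p - y)) ⊆
        Metric.closedBall p (φ n).rOut := by
      intro y hy
      have : p - y ∈ Function.support ((φ n).normed volume) := hy
      rw [(φ n).support_normed_eq, mem_ball_zero_iff] at this
      rw [mem_closedBall_iff_norm']
      exact this.le
    refine ⟨(hk n).comp (by fun_prop), HasCompactSupport.of_support_subset_isCompact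
      (isCompact_closedBall _ _) hsupp, ?_⟩
    exact (closure_minimal hsupp Metric.isClosed_closedBall).trans
      (closedBall_homothety_subset hconv hball hx (hs0 n) (by linarith [hs12 n]) (hρ n))
  · refine fun n => Eventually.of_forall fun x => ?_
    refine (setLIntegral_le_lintegral _ _).trans ?_
    rw [lintegral_sub_left_eq_self (fun y => ENNReal.ofReal ((φ n).normed volume y)),
      lintegral_ofReal_normed]
  · refine fun n => Eventually.of_forall fun y => ?_
    refine (setLIntegral_le_lintegral _ _).trans ?_
    rw [← ENNReal.rpow_mul]
    have := lintegral_ofReal_normed_comp_smul (φ n) (l := 1 - s n) (by linarith [hs12 n])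
      (s n • x₀ - y)
    simpa [add_sub_assoc] using this
  · intro g hg
    refine hae fun x hx => ?_
    -- The evaluation points move with `n` but converge to `x`. Cutting `g` off outside the open set
    -- `Ω` does not affect continuity at `x`.
    have h1 : Tendsto (fun n => convolution ((φ n).normed volume)
        (Ω.indicator g) (ContinuousLinearMap.lsmul ℝ ℝ) volume ((1 - s n) • x + s n • x₀)) atTop
        (𝓝 (g x)) := by
      refine ContDiffBump.convolution_tendsto_right (x₀ := x) ?_ ?_ ?_ ?_
      · have := (hslim.mul_const r).div_const 2
        simpa [φ] using this
      · exact Eventually.of_forall fun n => hg.aestronglyMeasurable.indicator ho.measurableSet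
      · have : ContinuousAt (Ω.indicator g) x := 
          (hg.continuousAt (x := x)).congr (by
            filter_upwards [ho.mem_nhds hx] with y hy
            rw [indicator_of_mem hy])
        have h2 : Ω.indicator g x = g x := indicator_of_mem hx _
        rw [← h2]
        exact this.tendsto.comp tendsto_snd
      · have := ((hslim.const_sub 1).smul_const x).add (hslim.smul_const x₀)
        simpa using this
    refine h1.congr fun n => ?_
    rw [convolution_eq_swap, hmu, ← integral_indicator ho.measurableSet]
    refine integral_congr_ae (Eventually.of_forall fun y => ?_)
    by_cases hy : y ∈ Ω <;> simp [hy, mul_comm]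

end bump

/-! ### Density of smooth periodic functions on the torus. -/

section box
open scoped Pointwise
variable {d : ℕ} {L : Fin d → ℝ}

lemma ofLp_preimage_ae_eq {s t : Set (Fin d → ℝ)} (h : s =ᵐ[volume] t) :
    ((WithLp.ofLp ⁻¹' s : Set (E d))) =ᵐ[volume] (WithLp.ofLp ⁻¹' t : Set (E d)) :=
  (PiLp.volume_preserving_ofLp (Fin d)).quasiMeasurePreserving.preimage_ae_eq h

lemma dom_periodic_eq (L : Fin d → ℝ) :
    (Setting.periodic L).dom = WithLp.ofLp ⁻¹' (univ.pi fun i => Ico 0 (L i)) := by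
  ext x; simp [Setting.dom]

/-- The open box with side lengths `L`. -/
def openBox (L : Fin d → ℝ) : Set (E d) := WithLp.ofLp ⁻¹' (univ.pi fun i => Ioo 0 (L i))

/-- The closed box with side lengths `L`. -/
def closedBox (L : Fin d → ℝ) : Set (E d) := WithLp.ofLp ⁻¹' (univ.pi fun i => Icc 0 (L i))

lemma mu_periodic_eq_openBox (L : Fin d → ℝ) :
    (Setting.periodic L).mu = volume.restrict (openBox L) := by
  rw [Setting.mu, dom_periodic_eq]
  refine Measure.restrict_congr_set (ofLp_preimage_ae_eq ?_)
  exact (Measure.univ_pi_Ico_ae_eq_Icc (f := fun _ => (0:ℝ)) (g := L)).trans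
    (Measure.univ_pi_Ioo_ae_eq_Icc (f := fun _ => (0:ℝ)) (g := L)).symm

lemma mu_periodic_eq_closedBox (L : Fin d → ℝ) :
    (Setting.periodic L).mu = volume.restrict (closedBox L) := by
  rw [Setting.mu, dom_periodic_eq]
  refine Measure.restrict_congr_set (ofLp_preimage_ae_eq ?_)
  rw [pi_univ_Icc]
  exact Measure.univ_pi_Ico_ae_eq_Icc (f := fun _ => (0:ℝ)) (g := L)

lemma isOpen_openBox (L : Fin d → ℝ) : IsOpen (openBox L) :=
  (isOpen_set_pi finite_univ fun _ _ => isOpen_Ioo).preimage (PiLp.continuous_ofLp 2 _)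

lemma isCompact_closedBox (L : Fin d → ℝ) : IsCompact (closedBox L) :=
  (EuclideanSpace.equiv (Fin d) ℝ).toHomeomorph.isCompact_preimage.2
    (isCompact_univ_pi fun _ => isCompact_Icc)

lemma openBox_subset_closedBox (L : Fin d → ℝ) : openBox L ⊆ closedBox L :=
  preimage_mono (pi_mono fun _ _ => Ioo_subset_Icc_self)

lemma convex_openBox (L : Fin d → ℝ) : Convex ℝ (openBox L) :=
  (convex_pi fun i _ => convex_Ioo 0 (L i)).linear_preimage
    (WithLp.linearEquiv 2 ℝ (Fin d → ℝ)).toLinearMap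

lemma nonempty_openBox (hL : ∀ i, 0 < L i) : (openBox L).Nonempty :=
  ⟨WithLp.toLp 2 fun i => L i / 2, fun i _ => ⟨by simpa using half_pos (hL i),
    by simpa using half_lt_self (hL i)⟩⟩

/-- The integral of a periodic function over the box is invariant under translations. -/
lemma integral_periodic_add (hL : ∀ i, 0 < L i) {h : E d → ℝ}
    (hper : ∀ i x, h (x + EuclideanSpace.single i (L i)) = h x) (a : E d) :
    ∫ y, h (y + a) ∂(Setting.periodic L).mu = ∫ y, h y ∂(Setting.periodic L).mu := by
  -- The box is the fundamental domain of the lattice spanned by the vectors `Lᵢ eᵢ`, and so is each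
  -- of its translates. A lattice-invariant function has the same integral over both.
  let b : Module.Basis (Fin d) ℝ (E d) :=
    (EuclideanSpace.basisFun (Fin d) ℝ).toBasis.isUnitSMul (w := L) fun i => (hL i).ne'.isUnit
  have hb : ∀ i, b i = EuclideanSpace.single i (L i) := fun i => by
    rw [Module.Basis.isUnitSMul_apply]
    ext j; simp
  have hdom : ZSpan.fundamentalDomain b = (Setting.periodic L).dom := by
    ext x
    simp only [ZSpan.mem_fundamentalDomain, Setting.dom, mem_ofPred_eq]
    refine forall_congr' fun i => ?_
    have : b.repr x i = (L i)⁻¹ * x i := by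
      rw [Module.Basis.repr_isUnitSMul]
      simp [Units.smul_def]
    rw [this, mem_Ico, inv_mul_lt_iff₀ (hL i), mul_one]
    refine and_congr_left fun _ => ?_
    exact mul_nonneg_iff_of_pos_left (inv_pos.2 (hL i))
  have hfd := ZSpan.isAddFundamentalDomain b (volume : Measure (E d))
  have hinv : ∀ (g : Submodule.span ℤ (range b)) (x : E d), h (g +ᵥ x) = h x := by
    rintro ⟨g, hg⟩ x
    change h (g + x) = h x
    induction hg using Submodule.span_induction generalizing x with
    | mem y hy =>
      obtain ⟨i, rfl⟩ := hy
      rw [hb, add_comm, hper]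
    | zero => simp
    | add y z _ _ h1 h2 => rw [add_assoc, h1, h2]
    | smul c y _ h1 =>
      induction c using Int.induction_on generalizing x with
      | zero => simp
      | succ n ih => rw [add_smul, one_smul, add_assoc, ih, h1]
      | pred n ih =>
        have := h1 ((-(n:ℤ) - 1) • y + x)
        rw [← this, sub_smul, one_smul, ← add_assoc, add_sub_cancel, ih]
  have : VAddInvariantMeasure (Submodule.span ℤ (range b)) (E d) volume :=
    inferInstanceAs <| VAddInvariantMeasure (Submodule.span ℤ (range b)).toAddSubgroup (E d) volume
  have htr := hfd.setIntegral_eq (hfd.vadd_of_comm a) hinv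
  rw [hdom] at htr
  rw [Setting.mu, htr]
  have : a +ᵥ (Setting.periodic L).dom = (fun y => y + a) '' (Setting.periodic L).dom := by
    simp only [add_comm _ a]
    rfl
  rw [this, (measurePreserving_add_right volume a).setIntegral_image_emb
    (measurableEmbedding_addRight a)]

lemma norm_le_of_mem_closedBox (L : Fin d → ℝ) : ∃ R, ∀ x ∈ closedBox L, ‖x‖ ≤ R :=
  (isCompact_closedBox L).isBounded.exists_norm_le

lemma isFiniteMeasure_mu_periodic (L : Fin d → ℝ) : IsFiniteMeasure (Setting.periodic L).mu :=
  ⟨by rw [mu_periodic_eq_closedBox, Measure.restrict_apply_univ]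
      exact (isCompact_closedBox L).measure_lt_top⟩

lemma ae_mu_periodic_of_openBox {p : E d → Prop} (hp : ∀ x ∈ openBox L, p x) :
    ∀ᵐ x ∂(Setting.periodic L).mu, p x := by
  rw [mu_periodic_eq_openBox]
  exact (ae_restrict_iff' (isOpen_openBox L).measurableSet).2 (Eventually.of_forall hp)

/-- The integral of the translates `y ↦ h (y - x)` over the box does not depend on `x`.
Differentiating this constant under the integral at `x = 0` gives the claim. -/
lemma integral_partialD_periodic (hL : ∀ i, 0 < L i) {h : E d → ℝ} (hh : ContDiff ℝ 1 h)
    (hper : ∀ i x, h (x + EuclideanSpace.single i (L i)) = h x) (i : Fin d) :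
    ∫ y, Setting.partialD i h y ∂(Setting.periodic L).mu = 0 := by
  have hfin := isFiniteMeasure_mu_periodic L
  obtain ⟨R, hR⟩ := norm_le_of_mem_closedBox L
  have hR' : ∀ᵐ y ∂(Setting.periodic L).mu, ‖y‖ ≤ R :=
    ae_mu_periodic_of_openBox fun x hx => hR x (openBox_subset_closedBox L hx)
  set k : E d → ℝ := fun z => h (0 - z) with hk
  have hk1 : ContDiff ℝ 1 k := hh.comp (by fun_prop)
  have hconst : smear (Setting.periodic L).mu k 1 0 (fun _ => 1) =
      fun _ => ∫ y, h y ∂(Setting.periodic L).mu := by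
    ext x
    rw [← integral_periodic_add hL hper (-x)]
    refine integral_congr_ae (Eventually.of_forall fun y => ?_)
    simp [hk, sub_eq_add_neg]
  have h1 := partialD_smear (l := 1) (b := 0) (f := fun _ => 1) hk1 hR' (integrable_const 1) i 0
  rw [hconst] at h1
  have h2 : ∀ z, Setting.partialD i k z = - Setting.partialD i h (0 - z) :=
    fun z => partialD_const_sub hh i 0 z
  have h3 : Setting.partialD i (fun _ : E d => ∫ y, h y ∂(Setting.periodic L).mu) 0 = 0 := by
    simp [Setting.partialD]
  simp only [h2, h3, one_mul, smul_zero, zero_add, zero_sub, neg_neg, integral_neg] at h1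
  exact neg_eq_zero.1 h1.symm

lemma partialD_mul {φ ψ : E d → ℝ} (hφ : ContDiff ℝ 1 φ) (hψ : ContDiff ℝ 1 ψ) (i : Fin d)
    (x : E d) : Setting.partialD i (fun x => φ x * ψ x) x =
      φ x * Setting.partialD i ψ x + Setting.partialD i φ x * ψ x := by
  have := ((hφ.differentiable one_ne_zero x).hasFDerivAt.mul
    (hψ.differentiable one_ne_zero x).hasFDerivAt).fderiv
  simp only [Setting.partialD]
  rw [show (fun x => φ x * ψ x) = φ * ψ from rfl, this]
  simp [mul_comm]

lemma continuous_partialD_of_contDiff {φ : E d → ℝ} (h : ContDiff ℝ 1 φ) (i : Fin d) :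
    Continuous (Setting.partialD i φ) :=
  (h.continuous_fderiv one_ne_zero).clm_apply continuous_const

/-- The kernel `∏ cos²(π x_i / L_i)` of the periodic approximate identity. -/
def cosKernel (L : Fin d → ℝ) (x : E d) : ℝ := ∏ i, Real.cos (Real.pi * x i / L i) ^ 2

lemma contDiff_cosKernel (L : Fin d → ℝ) : ContDiff ℝ ∞ (cosKernel L) := by
  unfold cosKernel
  refine contDiff_prod fun i _ => ContDiff.pow (Real.contDiff_cos.comp ?_) 2
  fun_prop

lemma cosKernel_nonneg (L : Fin d → ℝ) (x : E d) : 0 ≤ cosKernel L x :=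
  Finset.prod_nonneg fun _ _ => sq_nonneg _

lemma cosKernel_neg (L : Fin d → ℝ) (x : E d) : cosKernel L (-x) = cosKernel L x := by
  simp [cosKernel, neg_div]

lemma cosKernel_add (hL : ∀ i, 0 < L i) (i : Fin d) (x : E d) :
    cosKernel L (x + EuclideanSpace.single i (L i)) = cosKernel L x := by
  refine Finset.prod_congr rfl fun j _ => ?_
  by_cases hj : j = i
  · subst hj
    have : Real.pi * (x j + L j) / L j = Real.pi * x j / L j + Real.pi := by
      field_simp [(hL j).ne']
    simp [this, Real.cos_add_pi]
  · simp [hj]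

/-- Each factor `cos²(π xᵢ / Lᵢ)` equals one only at multiples of `Lᵢ`, and zero is the only such
multiple in the allowed range. This makes the peak of the kernel unique. -/
lemma cosKernel_lt_one (hL : ∀ i, 0 < L i) {x : E d} (hx : ∀ i, |x i| < L i) (h0 : x ≠ 0) :
    cosKernel L x < 1 := by
  obtain ⟨i, hi⟩ : ∃ i, x i ≠ 0 := by
    by_contra! h
    exact h0 (by ext i; simp [h i])
  have hlt : Real.cos (Real.pi * x i / L i) ^ 2 < 1 := by
    rw [Real.cos_sq', sub_lt_self_iff]
    have hpi := Real.pi_pos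
    have hab : |Real.pi * x i / L i| < Real.pi := by
      rw [abs_div, abs_mul, abs_of_pos hpi, abs_of_pos (hL i), div_lt_iff₀ (hL i)]
      exact mul_lt_mul_of_pos_left (hx i) hpi
    have hne : Real.sin (Real.pi * x i / L i) ≠ 0 := by
      intro h
      have h3 := (Real.sin_eq_zero_iff_of_lt_of_lt (abs_lt.1 hab).1 (abs_lt.1 hab).2).1 h
      have h4 : Real.pi * x i ≠ 0 := mul_ne_zero hpi.ne' hi
      exact div_ne_zero h4 (hL i).ne' h3
    positivity
  rw [cosKernel, ← Finset.mul_prod_erase _ _ (Finset.mem_univ i)]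
  refine mul_lt_one_of_nonneg_of_lt_one_left (sq_nonneg _) hlt ?_
  exact Finset.prod_le_one (fun _ _ => sq_nonneg _) fun j _ => Real.cos_sq_le_one _

/-- The mollifiers are normalised powers of `cosKernel`. They are smooth, periodic and even, hence
admissible test functions on the torus, and they concentrate at the origin modulo the lattice. -/
lemma exists_contDiff_tendsto_of_isWeakGrad_periodic (hL : ∀ i, 0 < L i)
    {u : E d → ℝ} {G : Fin d → E d → ℝ} (hu : MemLp u 2 (Setting.periodic L).mu)
    (hG : ∀ i, MemLp (G i) 2 (Setting.periodic L).mu) (h : (Setting.periodic L).IsWeakGrad u G) :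
    ∃ φ : ℕ → E d → ℝ, (∀ n, ContDiff ℝ 1 (φ n) ∧
        ∀ i x, φ n (x + EuclideanSpace.single i (L i)) = φ n x) ∧
      Tendsto (fun n => eLpNorm (fun x => φ n x - u x) 2 (Setting.periodic L).mu) atTop (𝓝 0) ∧
      ∀ i, Tendsto (fun n => eLpNorm (fun x => Setting.partialD i (φ n) x - G i x) 2
        (Setting.periodic L).mu) atTop (𝓝 0) := by
  have hfin := isFiniteMeasure_mu_periodic L
  obtain ⟨R, hR⟩ := norm_le_of_mem_closedBox L
  have hR' : ∀ᵐ y ∂(Setting.periodic L).mu, ‖y‖ ≤ R :=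
    ae_mu_periodic_of_openBox fun x hx => hR x (openBox_subset_closedBox L hx)
  have hc : ∀ n, ContDiff ℝ ∞ fun x => cosKernel L x ^ n := fun n => (contDiff_cosKernel L).pow n
  set c : ℕ → ℝ := fun n => ∫ y, cosKernel L y ^ n ∂(Setting.periodic L).mu with hcdef
  have hc0 : ∀ n, 0 ≤ c n := fun n => integral_nonneg fun y => pow_nonneg (cosKernel_nonneg L y) n
  set k : ℕ → E d → ℝ := fun n x => (c n)⁻¹ * cosKernel L x ^ n with hk
  have hks : ∀ n, ContDiff ℝ ∞ (k n) := fun n => contDiff_const.mul (hc n)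
  have hk1 : ∀ n, ContDiff ℝ 1 (k n) := fun n => (hks n).of_le (by simp)
  have hk0 : ∀ n x, 0 ≤ k n x := fun n x =>
    mul_nonneg (inv_nonneg.2 (hc0 n)) (pow_nonneg (cosKernel_nonneg L x) n)
  have hper : ∀ n i x, k n (x + EuclideanSpace.single i (L i)) = k n x := fun n i x => by
    simp only [hk, cosKernel_add hL]
  have htrans : ∀ n a, ∫ y, cosKernel L (y + a) ^ n ∂(Setting.periodic L).mu = c n := fun n a =>
    integral_periodic_add hL (h := fun y => cosKernel L y ^ n)
      (fun i x => by simp only [cosKernel_add hL]) a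
  have hneg : ∀ n x y, k n (x - y) = k n (y - x) := fun n x y => by
    simp only [hk]; rw [← neg_sub, cosKernel_neg]
  have hmass : ∀ n a, ∫⁻ y, ENNReal.ofReal (k n (y - a)) ∂(Setting.periodic L).mu ≤ 1 := by
    intro n a
    have hi : Integrable (fun y => k n (y - a)) (Setting.periodic L).mu := by
      have := integrable_mul_smear_kernel (f := fun _ => 1) (l := 1) (b := 0)
        (hk1 n).continuous hR' (integrable_const 1) a
      simpa [hneg n a] using this
    rw [← ofReal_integral_eq_lintegral_ofReal hi (Eventually.of_forall fun y => hk0 n _)]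
    simp only [hk, integral_const_mul, sub_eq_add_neg]
    rw [htrans n (-a), ENNReal.ofReal_le_one]
    exact inv_mul_le_one
  refine ⟨fun n => smear (Setting.periodic L).mu (k n) 1 0 u, fun n => ⟨contDiff_smear (hk1 n) hR'
    (hu.integrable (by norm_num)), fun i x => ?_⟩, ?_⟩
  · refine integral_congr_ae (Eventually.of_forall fun y => ?_)
    have : (1:ℝ) • (x + EuclideanSpace.single i (L i)) + 0 - y =
        ((1:ℝ) • x + 0 - y) + EuclideanSpace.single i (L i) := by
      simp only [one_smul, add_zero]; abel
    simp only [this, hper]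
  refine h.tendsto_smear (k := k) (l := fun _ => 1) (b := fun _ => 0) (C := 1) hk1
    hR' tendsto_const_nhds hk0 (by simp) ?_ ?_ ?_ ?_ hu hG
  · refine fun n => Eventually.of_forall fun x => ⟨(hks n).comp (by fun_prop), fun i y => ?_⟩
    have := hper n i ((1:ℝ) • x + 0 - (y + EuclideanSpace.single i (L i)))
    refine this.symm.trans (congrArg (k n) ?_)
    abel
  · refine fun n => Eventually.of_forall fun x => ?_
    simpa [hneg n x] using hmass n x
  · refine fun n => Eventually.of_forall fun y => ?_
    simpa using hmass n y
  · intro g hg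
    refine ae_mu_periodic_of_openBox fun x hx => ?_
    -- For `x` in the open box and `y` in the closed one, `|yᵢ - xᵢ| < Lᵢ`, so `y = x` is the only
    -- maximum. The excluded boundary points form a null set.
    have hpk := tendsto_setIntegral_pow_smul_of_unique_maximum_of_isCompact_of_continuousOn
      (μ := volume) (g := g) (x₀ := x) (c := fun y => cosKernel L (y - x)) (isCompact_closedBox L)
      ((contDiff_cosKernel L).continuous.comp (by fun_prop)).continuousOn ?_
      (fun _ _ => cosKernel_nonneg L _) (by simp [cosKernel]) ?_ hg.continuousOn
    · rw [← mu_periodic_eq_closedBox] at hpk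
      refine hpk.congr fun n => ?_
      have := htrans n (-x)
      simp only [← sub_eq_add_neg] at this
      rw [this, smul_eq_mul, ← integral_const_mul]
      refine integral_congr_ae (Eventually.of_forall fun y => ?_)
      simp only [one_smul, add_zero, hneg n x y]
      simp only [hk, smul_eq_mul]
      ring
    · intro y hy hyx
      have h0 : cosKernel L (x - x) = 1 := by simp [cosKernel]
      rw [h0]
      refine cosKernel_lt_one hL (fun i => ?_) (sub_ne_zero.2 hyx)
      have h1 := hx i (mem_univ i)
      have h2 := hy i (mem_univ i)
      simp only [PiLp.sub_apply]
      rw [abs_lt]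
      exact ⟨by linarith [h1.2, h2.1], by linarith [h1.1, h2.2]⟩
    · exact subset_closure ((isOpen_openBox L).subset_interior_iff.2 (openBox_subset_closedBox L) hx)

end box

/-! ### Density of core functions in `V`, for all boundary conditions. -/

namespace Setting
variable {d : ℕ} {S : Setting d}

/-- The half-open box agrees with an open convex box up to a null set, so the inequalities on convex
domains cover all three cases at once. -/
lemma Admissible.exists_convex (hS : S.Admissible) : ∃ Ω : Set (E d), Ω.Nonempty ∧ IsOpen Ω ∧
    Bornology.IsBounded Ω ∧ Convex ℝ Ω ∧ S.mu = volume.restrict Ω := by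
  cases S with
  | dirichlet Ω => exact ⟨Ω, hS.1, hS.2.1, hS.2.2.1, hS.2.2.2, rfl⟩
  | neumann Ω => exact ⟨Ω, hS.1, hS.2.1, hS.2.2.1, hS.2.2.2, rfl⟩
  | periodic L => exact ⟨openBox L, nonempty_openBox hS, isOpen_openBox L,
      (isCompact_closedBox L).isBounded.subset (openBox_subset_closedBox L), convex_openBox L,
      mu_periodic_eq_openBox L⟩

lemma Admissible.isFiniteMeasure (hS : S.Admissible) : IsFiniteMeasure S.mu := by
  obtain ⟨Ω, -, -, hb, -, h⟩ := hS.exists_convex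
  exact ⟨by rw [h, Measure.restrict_apply_univ]; exact hb.measure_lt_top⟩

lemma Admissible.memLp_of_continuous (hS : S.Admissible) {F : Type*} [NormedAddCommGroup F]
    {φ : E d → F} (hφ : Continuous φ) (p : ℝ≥0∞) :
    MemLp φ p S.mu := by
  have := hS.isFiniteMeasure
  obtain ⟨Ω, -, ho, hb, -, h⟩ := hS.exists_convex
  obtain ⟨K, hK⟩ := hb.isCompact_closure.exists_bound_of_continuousOn hφ.continuousOn
  refine MemLp.of_bound hφ.aestronglyMeasurable K ?_
  rw [h]
  exact (ae_restrict_iff' ho.measurableSet).2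
    (Eventually.of_forall fun x hx => hK x (subset_closure hx))

/-- A class of `C^1` functions that is dense in `V`. -/
def IsCore : Setting d → (E d → ℝ) → Prop
  | dirichlet Ω, φ => (dirichlet Ω).IsTest φ
  | neumann _, φ => ContDiff ℝ 1 φ
  | periodic L, φ => ContDiff ℝ 1 φ ∧ ∀ i x, φ (x + EuclideanSpace.single i (L i)) = φ x

lemma IsCore.contDiff {φ : E d → ℝ} (h : S.IsCore φ) : ContDiff ℝ 1 φ := by
  cases S with
  | dirichlet Ω => exact h.1.of_le (by simp)
  | neumann Ω => exact h
  | periodic L => exact h.1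

lemma IsCore.comp {φ : E d → ℝ} (h : S.IsCore φ) {ψ : ℝ → ℝ} (hψ : ContDiff ℝ ∞ ψ)
    (h0 : ψ 0 = 0) : S.IsCore fun x => ψ (φ x) := by
  cases S with
  | dirichlet Ω =>
    exact ⟨hψ.comp h.1, h.2.1.comp_left h0, (closure_mono (Function.support_comp_subset h0 φ)).trans h.2.2⟩
  | neumann Ω => exact (hψ.of_le (by simp)).comp (show ContDiff ℝ 1 φ from h)
  | periodic L => exact ⟨(hψ.of_le (by simp)).comp h.1, fun i x => by simp only [h.2 i x]⟩

/-- The pair of square integrable functions `(u, G)` as an element of `L² × (L²)^d`. -/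
def pairOf {u : E d → ℝ} {G : Fin d → E d → ℝ} (hu : MemLp u 2 S.mu) (hG : ∀ i, MemLp (G i) 2 S.mu) :
    S.Pair :=
  WithLp.toLp 2 (hu.toLp u, WithLp.toLp 2 fun i => (hG i).toLp (G i))

lemma pairOf_mem_W12_iff {u : E d → ℝ} {G : Fin d → E d → ℝ} (hu : MemLp u 2 S.mu)
    (hG : ∀ i, MemLp (G i) 2 S.mu) : pairOf hu hG ∈ S.W12 ↔ S.IsWeakGrad u G := by
  refine forall_congr' fun φ => forall_congr' fun _ => forall_congr' fun i => ?_
  have h1 : ∫ x, (pairOf hu hG).fst x * partialD i φ x ∂S.mu = ∫ x, u x * partialD i φ x ∂S.mu := by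
    refine integral_congr_ae ?_
    filter_upwards [hu.coeFn_toLp] with x hx
    rw [← hx]; rfl
  have h2 : ∫ x, (pairOf hu hG).snd i x * φ x ∂S.mu = ∫ x, G i x * φ x ∂S.mu := by
    refine integral_congr_ae ?_
    filter_upwards [(hG i).coeFn_toLp] with x hx
    rw [← hx]; rfl
  rw [h1, h2]

lemma integral_mul_eq_inner (u : S.H) {ψ : E d → ℝ} (h : MemLp ψ 2 S.mu) :
    ∫ x, u x * ψ x ∂S.mu = inner ℝ (h.toLp ψ) u := by
  rw [L2.inner_def]
  refine integral_congr_ae ?_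
  filter_upwards [h.coeFn_toLp] with x hx
  simp [hx]

/-- Each defining identity pairs the components with fixed `L²` functions, hence is a closed linear
condition. -/
lemma isClosed_W12 : IsClosed (S.W12 : Set S.Pair) := by
  have : (S.W12 : Set S.Pair) = ⋂ (φ : E d → ℝ) (_ : S.IsTest φ) (i : Fin d),
      {p : S.Pair | ∫ x, p.fst x * partialD i φ x ∂S.mu = - ∫ x, p.snd i x * φ x ∂S.mu} := by
    ext p
    simp only [mem_iInter]
    rfl
  rw [this]
  refine isClosed_iInter fun φ => isClosed_iInter fun hφ => isClosed_iInter fun i => ?_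
  simp only [integral_mul_eq_inner _ (hφ.memLp_partialD i), integral_mul_eq_inner _ hφ.memLp]
  refine isClosed_eq ?_ ?_
  · exact continuous_const.inner (WithLp.continuous_fst ..)
  · exact (continuous_const.inner ((PiLp.continuous_apply 2 _ i).comp (WithLp.continuous_snd ..))).neg

lemma isClosed_Vsub : IsClosed (S.Vsub : Set S.Pair) := by
  cases S with
  | dirichlet Ω => exact Submodule.isClosed_topologicalClosure _
  | neumann Ω => exact isClosed_W12
  | periodic L => exact isClosed_W12

lemma isWeakGrad_of_contDiff_neumann {Ω : Set (E d)} {φ : E d → ℝ} (hφ : ContDiff ℝ 1 φ) :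
    (neumann Ω).IsWeakGrad φ fun i => partialD i φ := by
  rintro θ ⟨hθ, hθc, hθΩ⟩ i
  have hθ0 : ∀ x ∉ Ω, θ x = 0 := fun x hx => image_eq_zero_of_notMem_tsupport fun h => hx (hθΩ h)
  have hθ0' : ∀ x ∉ Ω, partialD i θ x = 0 := fun x hx => by
    have : fderiv ℝ θ x = 0 := by
      by_contra hne
      exact hx (hθΩ (support_fderiv_subset ℝ hne))
    simp [partialD, this]
  have hθ1 : ContDiff ℝ 1 θ := hθ.of_le (by simp)
  rw [mu]
  change ∫ x in Ω, _ = - ∫ x in Ω, _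
  rw [setIntegral_eq_integral_of_forall_compl_eq_zero fun x hx => by rw [hθ0' x hx, mul_zero],
    setIntegral_eq_integral_of_forall_compl_eq_zero fun x hx => by rw [hθ0 x hx, mul_zero]]
  have hcs : HasCompactSupport (partialD i θ) := hasCompactSupport_partialD hθc i
  exact integral_mul_fderiv_eq_neg_fderiv_mul_of_integrable
    (((continuous_partialD_of_contDiff hφ i).mul hθ.continuous).integrable_of_hasCompactSupport
      hθc.mul_left)
    ((hφ.continuous.mul (continuous_partialD_of_contDiff hθ1 i)).integrable_of_hasCompactSupport
      hcs.mul_left)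
    ((hφ.continuous.mul hθ.continuous).integrable_of_hasCompactSupport hθc.mul_left)
    (fun x _ => hφ.differentiable one_ne_zero x) (fun x _ => hθ1.differentiable one_ne_zero x)

lemma isWeakGrad_of_contDiff_periodic {L : Fin d → ℝ} (hL : ∀ i, 0 < L i) {φ : E d → ℝ}
    (hφ : ContDiff ℝ 1 φ) (hper : ∀ i x, φ (x + EuclideanSpace.single i (L i)) = φ x) :
    (periodic L).IsWeakGrad φ fun i => partialD i φ := by
  rintro θ ⟨hθ, hθper⟩ i
  have hθ1 : ContDiff ℝ 1 θ := hθ.of_le (by simp)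
  have h0 := integral_partialD_periodic hL (hφ.mul hθ1) (fun i x => by rw [hper, hθper]) i
  have hL' : (periodic L).Admissible := hL
  have := hL'.isFiniteMeasure
  simp only [partialD_mul hφ hθ1] at h0
  rw [integral_add] at h0
  · linarith
  · exact (hL'.memLp_of_continuous (hφ.continuous.mul (continuous_partialD_of_contDiff hθ1 i))
      1).integrable le_rfl
  · exact (hL'.memLp_of_continuous ((continuous_partialD_of_contDiff hφ i).mul hθ.continuous)
      1).integrable le_rfl

lemma IsCore.pairOf_mem (hS : S.Admissible) {φ : E d → ℝ} (h : S.IsCore φ)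
    (hu : MemLp φ 2 S.mu) (hG : ∀ i, MemLp (partialD i φ) 2 S.mu) : pairOf hu hG ∈ S.Vsub := by
  cases S with
  | dirichlet Ω =>
    exact subset_closure (Submodule.subset_span ⟨φ, h, hu.coeFn_toLp, fun i => (hG i).coeFn_toLp⟩)
  | neumann Ω => exact (pairOf_mem_W12_iff hu hG).2 (isWeakGrad_of_contDiff_neumann h)
  | periodic L => exact (pairOf_mem_W12_iff hu hG).2 (isWeakGrad_of_contDiff_periodic hS h.1 h.2)

/-- The Dirichlet test functions already form a linear space, so elements of `W_0^{1,2}` are limits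
of single test functions rather than of formal combinations. -/
lemma exists_isTest_of_mem_span {p : S.Pair} (hp : p ∈ Submodule.span ℝ {p : S.Pair | ∃ φ, S.IsTest φ ∧
    p.fst =ᵐ[S.mu] φ ∧ ∀ i, p.snd i =ᵐ[S.mu] partialD i φ}) (hS : ∃ Ω, S = dirichlet Ω) :
    ∃ φ, S.IsTest φ ∧ p.fst =ᵐ[S.mu] φ ∧ ∀ i, p.snd i =ᵐ[S.mu] partialD i φ := by
  obtain ⟨Ω, rfl⟩ := hS
  induction hp using Submodule.span_induction with
  | mem p hp => exact hp
  | zero =>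
    refine ⟨fun _ => 0, ⟨contDiff_const, HasCompactSupport.zero, by simp [tsupport]⟩, ?_, fun i => ?_⟩
    · exact Lp.coeFn_zero ..
    · refine (Lp.coeFn_zero ..).trans (Eventually.of_forall fun x => ?_)
      simp [partialD]
  | add p q _ _ hp hq =>
    obtain ⟨φ, hφ, h1, h2⟩ := hp
    obtain ⟨ψ, hψ, h3, h4⟩ := hq
    refine ⟨φ + ψ, ⟨hφ.1.add hψ.1, hφ.2.1.add hψ.2.1, (tsupport_add φ ψ).trans
      (union_subset hφ.2.2 hψ.2.2)⟩, (Lp.coeFn_add ..).trans (h1.add h3), fun i => ?_⟩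
    refine ((Lp.coeFn_add ..).trans ((h2 i).add (h4 i))).trans (Eventually.of_forall fun x => ?_)
    simp only [Pi.add_apply, partialD]
    rw [fderiv_add (hφ.1.differentiable (by simp) x) (hψ.1.differentiable (by simp) x)]
    rfl
  | smul c p _ hp =>
    obtain ⟨φ, hφ, h1, h2⟩ := hp
    refine ⟨c • φ, ⟨contDiff_const.smul hφ.1, hφ.2.1.smul_left, ?_⟩,
      (Lp.coeFn_smul ..).trans (h1.const_smul c), fun i => ?_⟩
    · exact (tsupport_smul_subset_right (fun _ => c) φ).trans hφ.2.2
    · refine ((Lp.coeFn_smul ..).trans ((h2 i).const_smul c)).trans (Eventually.of_forall fun x => ?_)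
      simp only [Pi.smul_apply, partialD]
      rw [fderiv_const_smul (hφ.1.differentiable (by simp) x)]
      rfl

/-- Core functions are dense in `V`. -/
lemma exists_isCore_tendsto (hS : S.Admissible) (v : S.V) : ∃ φ : ℕ → E d → ℝ,
    (∀ n, S.IsCore (φ n)) ∧
      Tendsto (fun n => eLpNorm (fun x => φ n x - V.fn v x) 2 S.mu) atTop (𝓝 0) ∧
      ∀ i, Tendsto (fun n => eLpNorm (fun x => partialD i (φ n) x - S.grad v i x) 2 S.mu)
        atTop (𝓝 0) := by
  have hwg : ∀ i, MemLp (S.grad v i : E d → ℝ) 2 S.mu := fun i => Lp.memLp _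
  have hwv : MemLp (V.fn v) 2 S.mu := Lp.memLp _
  cases S with
  | dirichlet Ω =>
    obtain ⟨p, hp, hlim⟩ := mem_closure_iff_seq_limit.1 v.2
    have hp' := fun n => exists_isTest_of_mem_span (hp n) ⟨Ω, rfl⟩
    choose φ hφ h1 h2 using hp'
    refine ⟨φ, hφ, ?_, fun i => ?_⟩
    · have := ((WithLp.continuous_fst ..).tendsto v.1).comp hlim
      refine ((Lp.tendsto_Lp_iff_tendsto_eLpNorm' _ _).1 this).congr fun n => eLpNorm_congr_ae ?_
      filter_upwards [h1 n] with x hx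
      simp only [Function.comp, Pi.sub_apply, hx]
      rfl
    · have := (((PiLp.continuous_apply 2 _ i).comp (WithLp.continuous_snd ..)).tendsto v.1).comp hlim
      refine ((Lp.tendsto_Lp_iff_tendsto_eLpNorm' _ _).1 this).congr fun n => eLpNorm_congr_ae ?_
      filter_upwards [h2 n i] with x hx
      simp only [Function.comp, Pi.sub_apply, hx]
      rfl
  | neumann Ω =>
    exact exists_contDiff_tendsto_of_isWeakGrad_neumann hS.1 hS.2.1 hS.2.2.1 hS.2.2.2 hwv hwg v.2
  | periodic L =>
    exact exists_contDiff_tendsto_of_isWeakGrad_periodic hS hwv hwg v.2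

end Setting

/-! ### Chain rule, product rule and Sobolev embedding in `V`. -/

namespace Setting
variable {d : ℕ} {S : Setting d}

lemma V.memLp_fn (v : S.V) : MemLp (V.fn v) 2 S.mu := Lp.memLp _

lemma memLp_grad (v : S.V) (i : Fin d) : MemLp (S.grad v i : E d → ℝ) 2 S.mu := Lp.memLp _

lemma norm_sq_eq (v : S.V) : ‖v‖ ^ 2 = ‖S.inclH v‖ ^ 2 + ∑ i, ‖S.grad v i‖ ^ 2 := by
  have h1 : ‖v‖ ^ 2 = ‖(v : S.Pair).fst‖ ^ 2 + ‖(v : S.Pair).snd‖ ^ 2 :=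
    WithLp.prod_norm_sq_eq_of_L2 _
  rw [h1, PiLp.norm_sq_eq_of_L2]
  rfl

lemma norm_inclH_le (v : S.V) : ‖S.inclH v‖ ≤ ‖v‖ := by
  refine le_of_sq_le_sq ?_ (norm_nonneg _)
  rw [norm_sq_eq]
  exact le_add_of_nonneg_right (Finset.sum_nonneg fun _ _ => sq_nonneg _)

lemma norm_grad_apply_le (v : S.V) (i : Fin d) : ‖S.grad v i‖ ≤ ‖v‖ := by
  refine le_of_sq_le_sq ?_ (norm_nonneg _)
  rw [norm_sq_eq]
  exact (Finset.single_le_sum (f := fun i => ‖S.grad v i‖ ^ 2) (fun _ _ => sq_nonneg _)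
    (Finset.mem_univ i)).trans (le_add_of_nonneg_left (sq_nonneg _))

/-- Core functions are dense in `V`, with convergence almost everywhere. -/
lemma exists_isCore_tendsto_ae (hS : S.Admissible) (v : S.V) : ∃ φ : ℕ → E d → ℝ,
    (∀ n, S.IsCore (φ n)) ∧
      Tendsto (fun n => eLpNorm (fun x => φ n x - V.fn v x) 2 S.mu) atTop (𝓝 0) ∧
      (∀ i, Tendsto (fun n => eLpNorm (fun x => partialD i (φ n) x - S.grad v i x) 2 S.mu)
        atTop (𝓝 0)) ∧ ∀ᵐ x ∂S.mu, Tendsto (fun n => φ n x) atTop (𝓝 (V.fn v x)) := by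
  obtain ⟨φ, hφ, h1, h2⟩ := exists_isCore_tendsto hS v
  obtain ⟨ns, hns, hae⟩ := (tendstoInMeasure_of_tendsto_eLpNorm (p := 2) (by simp)
    (fun n => (hφ n).contDiff.continuous.aestronglyMeasurable) (V.memLp_fn v).1
    h1).exists_seq_tendsto_ae
  exact ⟨fun n => φ (ns n), fun n => hφ _, h1.comp hns.tendsto_atTop,
    fun i => (h2 i).comp hns.tendsto_atTop, hae⟩

lemma pairOf_mem_of_tendsto {u : ℕ → E d → ℝ} {G : ℕ → Fin d → E d → ℝ} {u' : E d → ℝ}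
    {G' : Fin d → E d → ℝ} (hu : ∀ n, MemLp (u n) 2 S.mu) (hG : ∀ n i, MemLp (G n i) 2 S.mu)
    (hu' : MemLp u' 2 S.mu) (hG' : ∀ i, MemLp (G' i) 2 S.mu)
    (hmem : ∀ n, pairOf (hu n) (hG n) ∈ S.Vsub)
    (h1 : Tendsto (fun n => eLpNorm (fun x => u n x - u' x) 2 S.mu) atTop (𝓝 0))
    (h2 : ∀ i, Tendsto (fun n => eLpNorm (fun x => G n i x - G' i x) 2 S.mu) atTop (𝓝 0)) :
    pairOf hu' hG' ∈ S.Vsub := by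
  refine isClosed_Vsub.mem_of_tendsto (b := atTop) (f := fun n => pairOf (hu n) (hG n)) ?_
    (Eventually.of_forall hmem)
  refine ((WithLp.prod_continuous_toLp ..).tendsto _).comp (Tendsto.prodMk_nhds ?_ ?_)
  · exact (Lp.tendsto_Lp_iff_tendsto_eLpNorm'' _ _ _ _).2 h1
  · refine ((PiLp.continuous_toLp ..).tendsto _).comp (tendsto_pi_nhds.2 fun i => ?_)
    exact (Lp.tendsto_Lp_iff_tendsto_eLpNorm'' _ _ _ _).2 (h2 i)

lemma exists_V_of_pairOf_mem {u : E d → ℝ} {G : Fin d → E d → ℝ} (hu : MemLp u 2 S.mu)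
    (hG : ∀ i, MemLp (G i) 2 S.mu) (h : pairOf hu hG ∈ S.Vsub) :
    ∃ z : S.V, V.fn z =ᵐ[S.mu] u ∧ ∀ i, S.grad z i =ᵐ[S.mu] G i :=
  ⟨⟨_, h⟩, hu.coeFn_toLp, fun i => (hG i).coeFn_toLp⟩

/-- The chain rule in `V`. -/
lemma exists_V_comp (hS : S.Admissible) (v : S.V) {ψ : ℝ → ℝ} (hψ : ContDiff ℝ ∞ ψ)
    (h0 : ψ 0 = 0) {M : ℝ} (hM : ∀ s, |deriv ψ s| ≤ M) :
    ∃ z : S.V, V.fn z =ᵐ[S.mu] (fun x => ψ (V.fn v x)) ∧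
      ∀ i, S.grad z i =ᵐ[S.mu] fun x => deriv ψ (V.fn v x) * S.grad v i x := by
  obtain ⟨φ, hφ, h1, h2, h3⟩ := exists_isCore_tendsto_ae hS v
  have hM0 : 0 ≤ M := (abs_nonneg _).trans (hM 0)
  have hψd : Differentiable ℝ ψ := hψ.differentiable (by simp)
  have hψ' : Continuous (deriv ψ) := hψ.continuous_deriv (by simp)
  have hlip : ∀ s t, |ψ s - ψ t| ≤ M * |s - t| := fun s t =>
    Convex.norm_image_sub_le_of_norm_deriv_le (𝕜 := ℝ) (s := univ) (fun x _ => hψd x)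
      (fun x _ => hM x) convex_univ (mem_univ t) (mem_univ s)
  have hcore : ∀ n, S.IsCore fun x => ψ (φ n x) := fun n => (hφ n).comp hψ h0
  have hpd : ∀ n i x, partialD i (fun x => ψ (φ n x)) x = deriv ψ (φ n x) * partialD i (φ n) x := by
    intro n i x
    have := ((hψd (φ n x)).hasDerivAt.comp_hasFDerivAt x
      ((hφ n).contDiff.differentiable one_ne_zero x).hasFDerivAt).fderiv
    simp only [partialD]
    rw [show (fun x => ψ (φ n x)) = ψ ∘ φ n from rfl, this]
    simp
  have hm1 : ∀ n, AEStronglyMeasurable (φ n) S.mu := fun n =>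
    (hφ n).contDiff.continuous.aestronglyMeasurable
  have hm2 : ∀ n i, AEStronglyMeasurable (partialD i (φ n)) S.mu := fun n i =>
    (continuous_partialD_of_contDiff (hφ n).contDiff i).aestronglyMeasurable
  have hu' : MemLp (fun x => ψ (V.fn v x)) 2 S.mu := by
    refine ((V.memLp_fn v).const_mul M).mono
      (hψ.continuous.comp_aestronglyMeasurable (V.memLp_fn v).1) (Eventually.of_forall fun x => ?_)
    have := hlip (V.fn v x) 0
    rw [h0, sub_zero, sub_zero] at this
    rwa [norm_mul, Real.norm_of_nonneg hM0]
  have hG' : ∀ i, MemLp (fun x => deriv ψ (V.fn v x) * S.grad v i x) 2 S.mu := fun i => by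
    refine ((memLp_grad v i).const_mul M).mono ((hψ'.comp_aestronglyMeasurable
      (V.memLp_fn v).1).mul (memLp_grad v i).1) (Eventually.of_forall fun x => ?_)
    rw [norm_mul, norm_mul, Real.norm_of_nonneg hM0]
    exact mul_le_mul_of_nonneg_right (hM _) (norm_nonneg _)
  have hun : ∀ n, MemLp (fun x => ψ (φ n x)) 2 S.mu := fun n =>
    hS.memLp_of_continuous (hcore n).contDiff.continuous 2
  have hGn : ∀ n i, MemLp (partialD i fun x => ψ (φ n x)) 2 S.mu := fun n i =>
    hS.memLp_of_continuous (continuous_partialD_of_contDiff (hcore n).contDiff i) 2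
  refine exists_V_of_pairOf_mem hu' hG' (pairOf_mem_of_tendsto hun hGn hu' hG'
    (fun n => (hcore n).pairOf_mem hS _ _) ?_ fun i => ?_)
  · refine tendsto_of_tendsto_of_tendsto_of_le_of_le tendsto_const_nhds
      (h := fun n => ‖M‖ₑ * eLpNorm (fun x => φ n x - V.fn v x) 2 S.mu) ?_ (fun _ => zero_le)
      fun n => ?_
    · simpa using ENNReal.Tendsto.const_mul h1 (Or.inr (by simp : ‖M‖ₑ ≠ ⊤))
    · beta_reduce
      rw [← eLpNorm_const_smul]
      refine eLpNorm_mono fun x => ?_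
      rw [Pi.smul_apply, norm_smul, Real.norm_of_nonneg hM0]
      exact hlip _ _
  -- The gradient error is `ψ'(φₙ)(∂φₙ - ∂v) + (ψ'(φₙ) - ψ'(v)) ∂v`. The first term is controlled by
  -- the bound on `ψ'`, the second by dominated convergence along the subsequence converging almost
  -- everywhere.
  · have ha : Tendsto (fun n => eLpNorm (fun x => (deriv ψ (φ n x) - deriv ψ (V.fn v x)) *
        S.grad v i x) 2 S.mu) atTop (𝓝 0) := by
      refine tendsto_eLpNorm_two_of_dominated (b := fun x => ‖(M + M) * S.grad v i x‖)
        (fun n => ((hψ'.comp_aestronglyMeasurable (hm1 n)).sub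
          (hψ'.comp_aestronglyMeasurable (V.memLp_fn v).1)).mul (memLp_grad v i).1)
        ((memLp_grad v i).const_mul _).norm (fun n => Eventually.of_forall fun x => ?_) ?_
      · rw [abs_mul, norm_mul, Real.norm_of_nonneg (add_nonneg hM0 hM0)]
        exact mul_le_mul_of_nonneg_right ((abs_sub _ _).trans (add_le_add (hM _) (hM _)))
          (abs_nonneg _)
      · filter_upwards [h3] with x hx
        have := (((hψ'.tendsto _).comp hx).sub_const (deriv ψ (V.fn v x))).mul_const (S.grad v i x)
        simpa using this
    refine tendsto_of_tendsto_of_tendsto_of_le_of_le tendsto_const_nhds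
      (h := fun n => ‖M‖ₑ * eLpNorm (fun x => partialD i (φ n) x - S.grad v i x) 2 S.mu +
        eLpNorm (fun x => (deriv ψ (φ n x) - deriv ψ (V.fn v x)) * S.grad v i x) 2 S.mu) ?_
      (fun _ => zero_le) fun n => ?_
    · simpa using (ENNReal.Tendsto.const_mul (h2 i) (Or.inr (by simp : ‖M‖ₑ ≠ ⊤))).add ha
    · have hdec : (fun x => partialD i (fun x => ψ (φ n x)) x - deriv ψ (V.fn v x) * S.grad v i x) =
          (fun x => deriv ψ (φ n x) * (partialD i (φ n) x - S.grad v i x)) +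
            fun x => (deriv ψ (φ n x) - deriv ψ (V.fn v x)) * S.grad v i x := by
        ext x
        simp only [hpd, Pi.add_apply]
        ring
      rw [hdec]
      refine (eLpNorm_add_le ((hψ'.comp_aestronglyMeasurable (hm1 n)).mul
        ((hm2 n i).sub (memLp_grad v i).1)) (((hψ'.comp_aestronglyMeasurable (hm1 n)).sub
          (hψ'.comp_aestronglyMeasurable (V.memLp_fn v).1)).mul (memLp_grad v i).1)
            one_le_two).trans (add_le_add ?_ le_rfl)
      rw [← eLpNorm_const_smul]
      refine eLpNorm_mono fun x => ?_
      rw [Pi.smul_apply, norm_smul, Pi.mul_apply, norm_mul, Real.norm_of_nonneg hM0]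
      exact mul_le_mul_of_nonneg_right (hM _) (norm_nonneg _)

/-- A cutoff outside the range of a bounded function makes the derivative of `ψ` bounded, which
reduces the polynomial nonlinearities to `exists_V_comp`. -/
lemma exists_contDiff_eq_on_Icc {ψ : ℝ → ℝ} (hψ : ContDiff ℝ ∞ ψ) {R : ℝ} (hR : 0 < R) :
    ∃ ψ' : ℝ → ℝ, ContDiff ℝ ∞ ψ' ∧ HasCompactSupport ψ' ∧
      ∀ s, |s| ≤ R → ψ' s = ψ s ∧ deriv ψ' s = deriv ψ s := by
  let χ : ContDiffBump (0:ℝ) := ⟨2 * R, 3 * R, by positivity, by linarith⟩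
  refine ⟨fun s => χ s * ψ s, χ.contDiff.mul hψ, χ.hasCompactSupport.mul_right, fun s hs => ?_⟩
  have : (fun s => χ s * ψ s) =ᶠ[𝓝 s] ψ := by
    filter_upwards [Metric.isOpen_ball.mem_nhds (show s ∈ Metric.ball (0:ℝ) (2 * R) by
      rw [mem_ball_zero_iff, Real.norm_eq_abs]; linarith)] with t ht
    rw [χ.one_of_mem_closedBall (Metric.ball_subset_closedBall ht), one_mul]
  exact ⟨this.eq_of_nhds, this.deriv_eq⟩

/-- The chain rule for bounded elements of `V`. -/
lemma exists_V_comp_of_bounded (hS : S.Admissible) (v : S.V) {R : ℝ}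
    (hv : ∀ᵐ x ∂S.mu, |V.fn v x| ≤ R) {ψ : ℝ → ℝ} (hψ : ContDiff ℝ ∞ ψ) (h0 : ψ 0 = 0) :
    ∃ z : S.V, V.fn z =ᵐ[S.mu] (fun x => ψ (V.fn v x)) ∧
      ∀ i, S.grad z i =ᵐ[S.mu] fun x => deriv ψ (V.fn v x) * S.grad v i x := by
  obtain ⟨ψ', h1, h2, h3⟩ := exists_contDiff_eq_on_Icc hψ (show 0 < max R 1 by positivity)
  obtain ⟨M, hM⟩ := h2.deriv.exists_bound_of_continuous (h1.continuous_deriv (by simp))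
  obtain ⟨z, hz1, hz2⟩ := exists_V_comp hS v h1
    (by rw [(h3 0 (by simp)).1, h0]) (M := M) hM
  have hv' : ∀ᵐ x ∂S.mu, |V.fn v x| ≤ max R 1 := hv.mono fun x hx => hx.trans (le_max_left _ _)
  refine ⟨z, ?_, fun i => ?_⟩
  · filter_upwards [hz1, hv'] with x hx hx'
    rw [hx, (h3 _ hx').1]
  · filter_upwards [hz2 i, hv'] with x hx hx'
    rw [hx, (h3 _ hx').2]

lemma V.fn_add (u v : S.V) : V.fn (u + v) =ᵐ[S.mu] fun x => V.fn u x + V.fn v x :=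
  Lp.coeFn_add ..

lemma V.fn_sub (u v : S.V) : V.fn (u - v) =ᵐ[S.mu] fun x => V.fn u x - V.fn v x :=
  Lp.coeFn_sub ..

lemma V.fn_smul (c : ℝ) (v : S.V) : V.fn (c • v) =ᵐ[S.mu] fun x => c * V.fn v x :=
  Lp.coeFn_smul ..

lemma grad_add (u v : S.V) (i : Fin d) :
    S.grad (u + v) i =ᵐ[S.mu] fun x => S.grad u i x + S.grad v i x :=
  Lp.coeFn_add ..

lemma grad_sub (u v : S.V) (i : Fin d) :
    S.grad (u - v) i =ᵐ[S.mu] fun x => S.grad u i x - S.grad v i x :=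
  Lp.coeFn_sub ..

lemma grad_smul (c : ℝ) (v : S.V) (i : Fin d) :
    S.grad (c • v) i =ᵐ[S.mu] fun x => c * S.grad v i x :=
  Lp.coeFn_smul ..

/-- The product rule for bounded elements of `V`. -/
lemma exists_V_mul_of_bounded (hS : S.Admissible) (u v : S.V) {R R' : ℝ}
    (hu : ∀ᵐ x ∂S.mu, |V.fn u x| ≤ R) (hv : ∀ᵐ x ∂S.mu, |V.fn v x| ≤ R') :
    ∃ z : S.V, V.fn z =ᵐ[S.mu] (fun x => V.fn u x * V.fn v x) ∧
      ∀ i, S.grad z i =ᵐ[S.mu] fun x => V.fn u x * S.grad v i x + V.fn v x * S.grad u i x := by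
  -- Polarisation, `uv = ((u + v)² - (u - v)²)/4`, derives the product rule from the chain rule.
  have hsq : ContDiff ℝ ∞ fun s : ℝ => s ^ 2 := contDiff_id.pow 2
  obtain ⟨a, ha1, ha2⟩ := exists_V_comp_of_bounded hS (u + v) (R := R + R') (by
    filter_upwards [V.fn_add u v, hu, hv] with x h1 h2 h3
    rw [h1]; exact (abs_add_le _ _).trans (add_le_add h2 h3)) hsq (by simp)
  obtain ⟨b, hb1, hb2⟩ := exists_V_comp_of_bounded hS (u - v) (R := R + R') (by
    filter_upwards [V.fn_sub u v, hu, hv] with x h1 h2 h3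
    rw [h1]; exact (abs_sub _ _).trans (add_le_add h2 h3)) hsq (by simp)
  have hd : ∀ s : ℝ, deriv (fun s : ℝ => s ^ 2) s = 2 * s := fun s => by simp
  refine ⟨(1/4 : ℝ) • (a - b), ?_, fun i => ?_⟩
  · filter_upwards [V.fn_smul (1/4) (a - b), V.fn_sub a b, ha1, hb1, V.fn_add u v, V.fn_sub u v]
      with x h1 h2 h3 h4 h5 h6
    rw [h1, h2, h3, h4, h5, h6]; ring
  · filter_upwards [grad_smul (1/4) (a - b) i, grad_sub a b i, ha2 i, hb2 i, V.fn_add u v,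
      V.fn_sub u v, grad_add u v i, grad_sub u v i] with x h1 h2 h3 h4 h5 h6 h7 h8
    rw [h1, h2, h3, h4, h5, h6, h7, h8, hd, hd]; ring

lemma enorm_fderiv_le_sum (φ : E d → ℝ) (x : E d) :
    ‖fderiv ℝ φ x‖ ≤ ‖∑ i, ‖partialD i φ x‖‖ := by
  rw [Real.norm_of_nonneg (Finset.sum_nonneg fun _ _ => norm_nonneg _)]
  refine ContinuousLinearMap.opNorm_le_bound _ (Finset.sum_nonneg fun _ _ => norm_nonneg _)
    fun v => ?_
  have hv : v = ∑ i, v i • EuclideanSpace.single i (1:ℝ) := by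
    ext j
    simp [Finset.sum_apply, Pi.single_apply]
  have h1 : fderiv ℝ φ x v = ∑ i, v i * partialD i φ x := by
    conv_lhs => rw [hv]
    rw [map_sum]
    simp [partialD]
  rw [h1, Finset.sum_mul]
  refine (norm_sum_le _ _).trans (Finset.sum_le_sum fun i _ => ?_)
  rw [norm_mul, mul_comm]
  exact mul_le_mul_of_nonneg_left (PiLp.norm_apply_le v i) (norm_nonneg _)

/-- The Sobolev embedding `V → L^6` in dimension at most three. -/
lemma exists_eLpNorm_six_le (hd1 : 1 ≤ d) (hd3 : d ≤ 3) (hS : S.Admissible) :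
    ∃ C : ℝ, 0 ≤ C ∧ ∀ v : S.V, eLpNorm (V.fn v) 6 S.mu ≤ ENNReal.ofReal (C * ‖v‖) := by
  obtain ⟨Ω, hne, ho, hb, hconv, hmu⟩ := hS.exists_convex
  obtain ⟨C, hC, hsob⟩ := eLpNorm_six_le hd1 hd3 hne ho hb hconv
  rw [← hmu] at hsob
  refine ⟨C.toReal * (1 + d), by positivity, fun v => ?_⟩
  obtain ⟨φ, hφ, h1, h2, h3⟩ := exists_isCore_tendsto_ae hS v
  have hm1 : ∀ n, AEStronglyMeasurable (φ n) S.mu := fun n =>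
    (hφ n).contDiff.continuous.aestronglyMeasurable
  have hm2 : ∀ n i, AEStronglyMeasurable (partialD i (φ n)) S.mu := fun n i =>
    (continuous_partialD_of_contDiff (hφ n).contDiff i).aestronglyMeasurable
  have hle : ∀ n, eLpNorm (φ n) 6 S.mu ≤
      C * ((eLpNorm (fun x => φ n x - V.fn v x) 2 S.mu + eLpNorm (V.fn v) 2 S.mu) +
        ∑ i, (eLpNorm (fun x => partialD i (φ n) x - S.grad v i x) 2 S.mu +
          eLpNorm (S.grad v i) 2 S.mu)) := by
    intro n
    refine (hsob (φ n) (hφ n).contDiff).trans ?_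
    gcongr
    · have := eLpNorm_add_le ((hm1 n).sub (V.memLp_fn v).1) (V.memLp_fn v).1 one_le_two
      rwa [sub_add_cancel] at this
    · refine (eLpNorm_mono (enorm_fderiv_le_sum (φ n))).trans ?_
      have h5 : (fun x => ∑ i, ‖partialD i (φ n) x‖) = ∑ i, fun x => ‖partialD i (φ n) x‖ := by
        ext x; simp
      rw [h5]
      refine (eLpNorm_sum_le (fun i _ => (hm2 n i).norm) one_le_two).trans
        (Finset.sum_le_sum fun i _ => ?_)
      rw [eLpNorm_norm]
      have := eLpNorm_add_le ((hm2 n i).sub (memLp_grad v i).1) (memLp_grad v i).1 one_le_two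
      rwa [sub_add_cancel] at this
  have hlim : Tendsto (fun n => C * ((eLpNorm (fun x => φ n x - V.fn v x) 2 S.mu +
      eLpNorm (V.fn v) 2 S.mu) + ∑ i, (eLpNorm (fun x => partialD i (φ n) x - S.grad v i x) 2 S.mu +
          eLpNorm (S.grad v i) 2 S.mu))) atTop (𝓝 (C * ((0 + eLpNorm (V.fn v) 2 S.mu) +
            ∑ i, (0 + eLpNorm (S.grad v i) 2 S.mu)))) := by
    refine ENNReal.Tendsto.const_mul ((h1.add_const _).add (tendsto_finsetSum _ fun i _ =>
      (h2 i).add_const _)) (Or.inr hC)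
  -- Core functions approximate `v` only in the `W^{1,2}` norm and almost everywhere; Fatou carries
  -- the `L^6` bound to the limit.
  have hfatou := Lp.eLpNorm_lim_le_liminf_eLpNorm (p := 6) hm1 _ h3
  refine hfatou.trans ((liminf_le_liminf (Eventually.of_forall hle)).trans ?_)
  rw [hlim.liminf_eq]
  have e1 : eLpNorm (V.fn v) 2 S.mu ≤ ENNReal.ofReal ‖v‖ := by
    have := norm_inclH_le v
    rw [Lp.norm_def] at this
    rw [← ENNReal.ofReal_toReal (V.memLp_fn v).2.ne]
    exact ENNReal.ofReal_le_ofReal this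
  have e2 : ∀ i, eLpNorm (S.grad v i) 2 S.mu ≤ ENNReal.ofReal ‖v‖ := fun i => by
    have := norm_grad_apply_le v i
    rw [Lp.norm_def] at this
    rw [← ENNReal.ofReal_toReal (memLp_grad v i).2.ne]
    exact ENNReal.ofReal_le_ofReal this
  calc C * ((0 + eLpNorm (V.fn v) 2 S.mu) + ∑ i, (0 + eLpNorm (S.grad v i) 2 S.mu))
      ≤ C * (ENNReal.ofReal ‖v‖ + ∑ _i : Fin d, ENNReal.ofReal ‖v‖) := by
        simp only [zero_add]
        gcongr with i
        exact e2 i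
    _ = _ := by
        rw [Finset.sum_const, Finset.card_univ, Fintype.card_fin, nsmul_eq_mul,
          ENNReal.ofReal_mul (by positivity), ENNReal.ofReal_mul ENNReal.toReal_nonneg,
          ENNReal.ofReal_toReal hC, ENNReal.ofReal_add zero_le_one (by positivity)]
        simp only [ENNReal.ofReal_one, ENNReal.ofReal_natCast]
        ring

end Setting

/-! ### Real-valued `L^p` norms and Hölder inequalities. -/

section norms
variable {α : Type*} [MeasurableSpace α] {μ : Measure α}

/-- The `L^p` seminorm as a real number. -/
def nrm (p : ℝ≥0∞) (μ : Measure α) (f : α → ℝ) : ℝ := (eLpNorm f p μ).toReal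

lemma nrm_nonneg (p : ℝ≥0∞) (μ : Measure α) (f : α → ℝ) : 0 ≤ nrm p μ f := ENNReal.toReal_nonneg

lemma nrm_coe (u : Lp ℝ 2 μ) : nrm 2 μ u = ‖u‖ := (Lp.norm_def u).symm

lemma nrm_congr {p : ℝ≥0∞} {f g : α → ℝ} (h : f =ᵐ[μ] g) : nrm p μ f = nrm p μ g := by
  rw [nrm, eLpNorm_congr_ae h, nrm]

lemma norm_toLp {f : α → ℝ} (hf : MemLp f 2 μ) : ‖hf.toLp f‖ = nrm 2 μ f := by
  rw [← nrm_coe]; exact nrm_congr hf.coeFn_toLp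

lemma nrm_mono {p : ℝ≥0∞} {f g : α → ℝ} (hg : MemLp g p μ) (h : ∀ᵐ x ∂μ, |f x| ≤ |g x|) :
    nrm p μ f ≤ nrm p μ g :=
  ENNReal.toReal_mono hg.2.ne (eLpNorm_mono_ae h)

lemma nrm_const_mul {p : ℝ≥0∞} (c : ℝ) (f : α → ℝ) :
    nrm p μ (fun x => c * f x) = |c| * nrm p μ f := by
  rw [nrm, show (fun x => c * f x) = c • f from rfl, eLpNorm_const_smul, ENNReal.toReal_mul]
  simp [nrm]

lemma abs_integral_mul_le {f g : α → ℝ} (hf : MemLp f 2 μ) (hg : MemLp g 2 μ) :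
    |∫ x, f x * g x ∂μ| ≤ nrm 2 μ f * nrm 2 μ g := by
  have h1 : ∫ x, f x * g x ∂μ = inner ℝ (hf.toLp f) (hg.toLp g) := by
    rw [L2.inner_def]
    refine integral_congr_ae ?_
    filter_upwards [hf.coeFn_toLp, hg.coeFn_toLp] with x h1 h2
    simp [h1, h2, mul_comm]
  rw [h1, ← norm_toLp hf, ← norm_toLp hg]
  exact abs_real_inner_le_norm _ _

lemma nrm_two_sq {f : α → ℝ} (hf : MemLp f 2 μ) : nrm 2 μ f ^ 2 = ∫ x, f x ^ 2 ∂μ := by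
  rw [← norm_toLp hf, ← real_inner_self_eq_norm_sq, L2.inner_def]
  refine integral_congr_ae ?_
  filter_upwards [hf.coeFn_toLp] with x h1
  simp [h1, sq]

lemma holderTriple_six_six_three : ENNReal.HolderTriple 6 6 3 := ⟨by
  rw [← ENNReal.toReal_eq_toReal_iff' (by simp) (by simp), ENNReal.toReal_add (by simp) (by simp)]
  simp only [ENNReal.toReal_inv, ENNReal.toReal_ofNat]; norm_num⟩

lemma holderTriple_three_six_two : ENNReal.HolderTriple 3 6 2 := ⟨by
  rw [← ENNReal.toReal_eq_toReal_iff' (by simp) (by simp), ENNReal.toReal_add (by simp) (by simp)]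
  simp only [ENNReal.toReal_inv, ENNReal.toReal_ofNat]; norm_num⟩

lemma memLp_mul_of_holder {p q r : ℝ≥0∞} (hpqr : ENNReal.HolderTriple p q r) {f g : α → ℝ}
    (hf : MemLp f p μ) (hg : MemLp g q μ) : MemLp (fun x => f x * g x) r μ ∧
      nrm r μ (fun x => f x * g x) ≤ nrm p μ f * nrm q μ g := by
  refine ⟨hg.mul' hf, ?_⟩
  have e1 : eLpNorm (fun x => f x * g x) r μ ≤ eLpNorm f p μ * eLpNorm g q μ :=
    eLpNorm_smul_le_mul_eLpNorm (p := p) (q := q) (r := r) (f := g) (φ := f) hg.1 hf.1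
  have := ENNReal.toReal_mono (ENNReal.mul_ne_top hf.2.ne hg.2.ne) e1
  rwa [ENNReal.toReal_mul] at this

/-- Hölder with `1/2 = 1/6 + 1/6 + 1/6`. It makes a product of three elements of `V` square
integrable. -/
lemma memLp_mul_mul_six {f g h : α → ℝ} (hf : MemLp f 6 μ) (hg : MemLp g 6 μ) (hh : MemLp h 6 μ) :
    MemLp (fun x => f x * g x * h x) 2 μ ∧
      nrm 2 μ (fun x => f x * g x * h x) ≤ nrm 6 μ f * nrm 6 μ g * nrm 6 μ h := by
  obtain ⟨h1, e1⟩ := memLp_mul_of_holder holderTriple_six_six_three hf hg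
  obtain ⟨h2, e2⟩ := memLp_mul_of_holder holderTriple_three_six_two h1 hh
  exact ⟨h2, e2.trans (mul_le_mul_of_nonneg_right e1 (nrm_nonneg _ _ _))⟩

end norms

/-! ### Stampacchia's iteration and smooth truncations. -/

section iteration

/-- Stampacchia's iteration lemma, with exponent two. -/
lemma eq_zero_of_stampacchia {b : ℝ → ℝ} (hb : ∀ k, 0 ≤ b k) (hanti : Antitone b) {Q k₀ D : ℝ}
    (hk₀ : 0 ≤ k₀) (hD : 0 < D) (hQD : 4 * Q * b k₀ ≤ D) (hQ : 0 ≤ Q)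
    (h : ∀ k l, 0 ≤ k → k < l → (l - k) * b l ≤ Q * b k ^ 2) : b (k₀ + D) = 0 := by
  set q : ℕ → ℝ := fun j => (1/2 : ℝ) ^ j with hq
  have hq0 : ∀ j, 0 < q j := fun j => by positivity
  have hq1 : ∀ j, q j ≤ 1 := fun j => pow_le_one₀ (by norm_num) (by norm_num)
  have hqs : ∀ j, q (j + 1) = q j / 2 := fun j => by simp only [hq, pow_succ]; ring
  -- Along the levels `k₀ + D(1 - 2^{-j})` the bound on `b` halves at each step. The gap between
  -- consecutive levels is `D 2^{-j}/2`, and `4 Q b(k₀) ≤ D` is exactly what closes the induction.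
  have key : ∀ j, b (k₀ + D * (1 - q j)) ≤ b k₀ * q j := by
    intro j
    induction j with
    | zero => simp [hq]
    | succ j ih =>
      set B := b (k₀ + D * (1 - q j)) with hB
      have h1 := h (k₀ + D * (1 - q j)) (k₀ + D * (1 - q (j + 1)))
        (add_nonneg hk₀ (mul_nonneg hD.le (sub_nonneg.2 (hq1 j)))) (by
          rw [hqs]; nlinarith [hq0 j])
      have h2 : k₀ + D * (1 - q (j + 1)) - (k₀ + D * (1 - q j)) = D * q j / 2 := by rw [hqs]; ring
      rw [h2, ← hB] at h1
      have h3 : B ^ 2 ≤ (b k₀ * q j) ^ 2 := pow_le_pow_left₀ (hb _) ih 2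
      have h4 : D * q j / 2 * b (k₀ + D * (1 - q (j + 1))) ≤ D * q j / 2 * (b k₀ * q (j + 1)) := by
        calc _ ≤ Q * B ^ 2 := h1
          _ ≤ Q * (b k₀ * q j) ^ 2 := mul_le_mul_of_nonneg_left h3 hQ
          _ = (4 * Q * b k₀) * (b k₀ * q j ^ 2 / 4) := by ring
          _ ≤ D * (b k₀ * q j ^ 2 / 4) := by
            refine mul_le_mul_of_nonneg_right hQD ?_
            have := hb k₀
            positivity
          _ = _ := by rw [hqs]; ring
      exact le_of_mul_le_mul_left h4 (by have := hq0 j; positivity)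
  refine le_antisymm ?_ (hb _)
  have hlim : Tendsto (fun j => b k₀ * q j) atTop (𝓝 (b k₀ * 0)) :=
    (tendsto_pow_atTop_nhds_zero_of_lt_one (by norm_num) (by norm_num)).const_mul _
  rw [mul_zero] at hlim
  refine ge_of_tendsto' hlim fun j => (hanti ?_).trans (key j)
  nlinarith [hq0 j]

/-- A smooth primitive of the smooth transition function. -/
def smoothRamp (s : ℝ) : ℝ := ∫ t in (0:ℝ)..s, Real.smoothTransition t

lemma hasDerivAt_smoothRamp (s : ℝ) : HasDerivAt smoothRamp (Real.smoothTransition s) s :=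
  intervalIntegral.integral_hasDerivAt_right (Real.smoothTransition.continuous.intervalIntegrable _ _)
    (Real.smoothTransition.continuous.stronglyMeasurableAtFilter _ _)
    Real.smoothTransition.continuous.continuousAt

lemma deriv_smoothRamp : deriv smoothRamp = Real.smoothTransition :=
  funext fun s => (hasDerivAt_smoothRamp s).deriv

lemma contDiff_smoothRamp : ContDiff ℝ ∞ smoothRamp :=
  contDiff_infty_iff_deriv.2 ⟨fun s => (hasDerivAt_smoothRamp s).differentiableAt, by
    rw [deriv_smoothRamp]; exact Real.smoothTransition.contDiff⟩

lemma monotone_smoothRamp : Monotone smoothRamp :=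
  monotone_of_deriv_nonneg (fun s => (hasDerivAt_smoothRamp s).differentiableAt) fun s => by
    rw [deriv_smoothRamp]; exact Real.smoothTransition.nonneg s

lemma smoothRamp_of_nonpos {s : ℝ} (hs : s ≤ 0) : smoothRamp s = 0 := by
  rw [smoothRamp, intervalIntegral.integral_symm, neg_eq_zero]
  refine (intervalIntegral.integral_congr fun t ht => ?_).trans (intervalIntegral.integral_zero)
  rw [uIcc_of_le hs] at ht
  exact Real.smoothTransition.zero_of_nonpos ht.2

lemma smoothRamp_nonneg (s : ℝ) : 0 ≤ smoothRamp s := by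
  rcases le_total s 0 with h | h
  · exact (smoothRamp_of_nonpos h).ge
  · rw [← smoothRamp_of_nonpos le_rfl]; exact monotone_smoothRamp h

lemma smoothRamp_le {s : ℝ} (hs : 0 ≤ s) : smoothRamp s ≤ s := by
  have := intervalIntegral.integral_mono_on hs
    (Real.smoothTransition.continuous.intervalIntegrable _ _) (by simp)
    (fun t _ => Real.smoothTransition.le_one t) (μ := volume) (g := fun _ => 1)
  simpa [smoothRamp] using this

lemma smoothRamp_one_pos : 0 < smoothRamp 1 :=
  intervalIntegral.intervalIntegral_pos_of_pos_on
    (Real.smoothTransition.continuous.intervalIntegrable _ _)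
    (fun _ ht => Real.smoothTransition.pos_of_pos ht.1) one_pos

/-- A smooth truncation at the level `k`. -/
lemma exists_smooth_truncation {k l : ℝ} (hk : 0 ≤ k) (hkl : k < l) : ∃ ψ : ℝ → ℝ,
    ContDiff ℝ ∞ ψ ∧ (∀ s, 0 ≤ deriv ψ s ∧ deriv ψ s ≤ 1) ∧ (∀ s ≤ k, ψ s = 0) ∧
      (∀ s, 0 ≤ ψ s) ∧ (∀ s, k ≤ s → ψ s ≤ s) ∧ ∀ s, l ≤ s → smoothRamp 1 * (l - k) ≤ ψ s := by
  have hlk : 0 < l - k := sub_pos.2 hkl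
  have hder : ∀ s, HasDerivAt (fun s => (l - k) * smoothRamp ((s - k) / (l - k)))
      (Real.smoothTransition ((s - k) / (l - k))) s := fun s => by
    have h1 : HasDerivAt (fun s : ℝ => (s - k) / (l - k)) (1 / (l - k)) s :=
      ((hasDerivAt_id s).sub_const k).div_const _
    have h2 := ((hasDerivAt_smoothRamp ((s - k) / (l - k))).comp s h1).const_mul (l - k)
    convert! h2 using 1
    field_simp
  -- Scaling argument and value by the same length keeps the slope in `[0, 1]`. Compared with `max
  -- (s - k) 0`, smoothness costs only the factor `smoothRamp 1` at level `l`.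
  refine ⟨fun s => (l - k) * smoothRamp ((s - k) / (l - k)), contDiff_const.mul
    (contDiff_smoothRamp.comp (by fun_prop)), fun s => ?_, fun s hs => ?_, fun s => ?_,
      fun s hs => ?_, fun s hs => ?_⟩
  · rw [(hder s).deriv]
    exact ⟨Real.smoothTransition.nonneg _, Real.smoothTransition.le_one _⟩
  · beta_reduce
    rw [smoothRamp_of_nonpos (div_nonpos_of_nonpos_of_nonneg (by linarith) hlk.le), mul_zero]
  · exact mul_nonneg hlk.le (smoothRamp_nonneg _)
  · have := mul_le_mul_of_nonneg_left (smoothRamp_le (div_nonneg (sub_nonneg.2 hs) hlk.le)) hlk.le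
    rw [mul_div_cancel₀ _ hlk.ne'] at this
    linarith
  · rw [mul_comm]
    refine mul_le_mul_of_nonneg_left (monotone_smoothRamp ?_) hlk.le
    rw [le_div_iff₀ hlk]; linarith

end iteration

/-! ### Interpolation and Agmon's inequality on `D(A)`. -/

namespace Setting
variable {d : ℕ} {S : Setting d}

lemma inner_H_eq (u v : S.H) : inner ℝ u v = ∫ x, u x * v x ∂S.mu := by
  rw [L2.inner_def]
  exact integral_congr_ae (Eventually.of_forall fun x => by simp [mul_comm])

lemma ofH_apply (u : S.H) (z : S.V) : S.ofH u z = ∫ x, u x * V.fn z x ∂S.mu :=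
  inner_H_eq u (S.inclH z)

lemma A0_apply (w z : S.V) : S.A0 w z = ∑ i, ∫ x, S.grad w i x * S.grad z i x ∂S.mu := by
  have : S.A0 w z = inner ℝ (S.grad w) (S.grad z) := rfl
  rw [this, PiLp.inner_apply]
  exact Finset.sum_congr rfl fun i _ => inner_H_eq _ _

lemma integrable_mul {f g : E d → ℝ} (hf : MemLp f 2 S.mu) (hg : MemLp g 2 S.mu) :
    Integrable (fun x => f x * g x) S.mu := hf.integrable_mul hg

lemma norm_sq_eq_integral (v : S.V) :
    ‖v‖ ^ 2 = ∫ x, V.fn v x ^ 2 ∂S.mu + ∑ i, ∫ x, S.grad v i x ^ 2 ∂S.mu := by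
  rw [norm_sq_eq, ← nrm_coe, nrm_two_sq (Lp.memLp _)]
  congr 1
  exact Finset.sum_congr rfl fun i _ => by rw [← nrm_coe, nrm_two_sq (memLp_grad v i)]

namespace DomA

lemma sum_integral_grad_add (v : S.DomA) (z : S.V) :
    ∑ i, ∫ x, S.grad v.toV i x * S.grad z i x ∂S.mu + ∫ x, v.fn x * V.fn z x ∂S.mu =
      ∫ x, v.Aval x * V.fn z x ∂S.mu := by
  have h := congrArg (fun l : S.V' => l z) v.eq
  have h' : S.A0 v.toV z + S.ofH (S.inclH v.toV) z = S.ofH v.Aval z := h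
  rw [A0_apply, ofH_apply, ofH_apply] at h'
  exact h'

/-- The negative of an element of `D(A)`. -/
def neg (v : S.DomA) : S.DomA where
  toV := -v.toV
  Aval := -v.Aval
  eq := by
    have h1 : S.A (-v.toV) = - S.A v.toV := by simp [A, A0, ofH]; abel
    have h2 : S.ofH (-v.Aval) = - S.ofH v.Aval := by simp [ofH]
    rw [h1, h2, v.eq]

lemma neg_fn (v : S.DomA) : v.neg.fn =ᵐ[S.mu] fun x => - v.fn x := by
  have : S.inclH (-v.toV) = - S.inclH v.toV := map_neg _ _
  change ((S.inclH (-v.toV) : S.H) : E d → ℝ) =ᵐ[S.mu] _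
  rw [this]
  exact Lp.coeFn_neg ..

lemma normV_neg (v : S.DomA) : v.neg.normV = v.normV := norm_neg _

lemma normDA_neg (v : S.DomA) : v.neg.normDA = v.normDA := norm_neg _

lemma normH_le_normV (v : S.DomA) : v.normH ≤ v.normV := norm_inclH_le _

lemma normH_nonneg (v : S.DomA) : 0 ≤ v.normH := norm_nonneg _

lemma normV_nonneg (v : S.DomA) : 0 ≤ v.normV := norm_nonneg _

lemma normDA_nonneg (v : S.DomA) : 0 ≤ v.normDA := norm_nonneg _

/-- Testing `A v` with `v` itself gives `‖v‖_V² = (Av, v)_H`. -/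
lemma normV_sq_le (v : S.DomA) : v.normV ^ 2 ≤ v.normH * v.normDA := by
  have h := v.sum_integral_grad_add v.toV
  have h1 : v.normV ^ 2 = ∫ x, v.Aval x * v.fn x ∂S.mu := by
    rw [normV, norm_sq_eq_integral]
    simp only [← sq] at h
    rw [add_comm]
    refine Eq.trans ?_ h
    congr 1
    exact integral_congr_ae (Eventually.of_forall fun x => sq _)
  rw [h1]
  have h2 := abs_integral_mul_le (Lp.memLp v.Aval) (V.memLp_fn v.toV)
  rw [nrm_coe] at h2
  refine (le_abs_self _).trans (h2.trans (le_of_eq ?_))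
  rw [mul_comm]
  congr 1

lemma normV_le_normDA (v : S.DomA) : v.normV ≤ v.normDA := by
  rcases v.normV_nonneg.eq_or_lt with h | h
  · rw [← h]; exact v.normDA_nonneg
  · refine le_of_mul_le_mul_left ?_ h
    rw [← sq]
    exact v.normV_sq_le.trans (mul_le_mul_of_nonneg_right v.normH_le_normV v.normDA_nonneg)

end DomA

/-- `C` is a constant of the embedding `V → L^6`. -/
def SobolevBound (S : Setting d) (C : ℝ) : Prop :=
  0 ≤ C ∧ ∀ v : S.V, MemLp (V.fn v) 6 S.mu ∧ nrm 6 S.mu (V.fn v) ≤ C * ‖v‖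

lemma exists_sobolevBound (hd1 : 1 ≤ d) (hd3 : d ≤ 3) (hS : S.Admissible) :
    ∃ C, S.SobolevBound C := by
  obtain ⟨C, hC, h⟩ := exists_eLpNorm_six_le hd1 hd3 hS
  exact ⟨C, hC, fun v => ⟨⟨(V.memLp_fn v).1, (h v).trans_lt ENNReal.ofReal_lt_top⟩,
    ENNReal.toReal_le_of_le_ofReal (by positivity) (h v)⟩⟩

lemma SobolevBound.mul_mul {C : ℝ} (hC : S.SobolevBound C) (a b c : S.V) :
    MemLp (fun x => V.fn a x * V.fn b x * V.fn c x) 2 S.mu ∧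
      nrm 2 S.mu (fun x => V.fn a x * V.fn b x * V.fn c x) ≤ C ^ 3 * (‖a‖ * ‖b‖ * ‖c‖) := by
  obtain ⟨h1, h2⟩ := memLp_mul_mul_six (hC.2 a).1 (hC.2 b).1 (hC.2 c).1
  have hC0 := hC.1
  refine ⟨h1, h2.trans ?_⟩
  calc _ ≤ (C * ‖a‖) * (C * ‖b‖) * (C * ‖c‖) := by
        exact mul_le_mul (mul_le_mul (hC.2 a).2 (hC.2 b).2 (nrm_nonneg _ _ _) (by positivity))
          (hC.2 c).2 (nrm_nonneg _ _ _) (by positivity)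
    _ = _ := by ring

/-- The `L^6` norm of the indicator function of `{v > k}`. -/
def levelNrm (S : Setting d) (v : E d → ℝ) (k : ℝ) : ℝ :=
  nrm 6 S.mu ({x | k < v x}.indicator fun _ => 1)

section level
variable {C : ℝ}

lemma memLp_indicator_level (hS : S.Admissible) {v : E d → ℝ} (hv : AEStronglyMeasurable v S.mu)
    (k : ℝ) : MemLp ({x | k < v x}.indicator fun _ => (1:ℝ)) 6 S.mu := by
  have := hS.isFiniteMeasure
  have hm : NullMeasurableSet {x | k < v x} S.mu := nullMeasurableSet_lt aemeasurable_const hv.aemeasurable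
  refine MemLp.of_bound (aestronglyMeasurable_const.indicator₀ hm) 1 (Eventually.of_forall fun x => ?_)
  by_cases h : x ∈ {x | k < v x} <;> simp [h]

lemma antitone_levelNrm (hS : S.Admissible) {v : E d → ℝ} (hv : AEStronglyMeasurable v S.mu) :
    Antitone (S.levelNrm v) := by
  intro k l hkl
  refine nrm_mono (memLp_indicator_level hS hv k) (Eventually.of_forall fun x => ?_)
  by_cases h : x ∈ {x | l < v x}
  · have h' : x ∈ {x | k < v x} := lt_of_le_of_lt hkl h
    simp only [indicator_of_mem h, indicator_of_mem h', le_refl]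
  · simp only [indicator_of_notMem h, abs_zero, abs_nonneg]

lemma ae_le_of_levelNrm_eq_zero (hS : S.Admissible) {v : E d → ℝ}
    (hv : AEStronglyMeasurable v S.mu) {k : ℝ} (h : S.levelNrm v k = 0) : ∀ᵐ x ∂S.mu, v x ≤ k := by
  have hm := memLp_indicator_level hS hv k
  have h0 : eLpNorm ({x | k < v x}.indicator fun _ => (1:ℝ)) 6 S.mu = 0 :=
    ((ENNReal.toReal_eq_zero_iff _).1 h).resolve_right hm.2.ne
  have := (eLpNorm_eq_zero_iff hm.1 (by simp)).1 h0
  filter_upwards [this] with x hx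
  by_contra hlt
  rw [not_le] at hlt
  have hx' : x ∈ {x | k < v x} := hlt
  rw [indicator_of_mem hx'] at hx
  simp at hx

/-- Chebyshev's inequality in `L^6` followed by the Sobolev embedding; it supplies the starting
level of the iteration. -/
lemma levelNrm_mul_le (hC : S.SobolevBound C) (v : S.V) {k : ℝ} (hk : 0 ≤ k) :
    k * S.levelNrm (V.fn v) k ≤ C * ‖v‖ := by
  refine le_trans ?_ (hC.2 v).2
  have h1 := nrm_const_mul (p := 6) (μ := S.mu) k ({x | k < V.fn v x}.indicator fun _ => 1)
  rw [abs_of_nonneg hk] at h1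
  rw [levelNrm, ← h1]
  refine nrm_mono (hC.2 v).1 (Eventually.of_forall fun x => ?_)
  by_cases h : x ∈ {x | k < V.fn v x}
  · have h' : k < V.fn v x := h
    rw [indicator_of_mem h, mul_one, abs_of_nonneg hk]
    exact h'.le.trans (le_abs_self _)
  · rw [indicator_of_notMem h, mul_zero, abs_zero]
    exact abs_nonneg _

/-- Let `w = ψ(v)` be the truncation at `k` and `B` the level norm at `k`. Since `ψ'² ≤ ψ'` and `ψ²
≤ vψ`, testing with `w` gives `‖w‖_V² ≤ (Av, w)`. As `w` vanishes off `{v > k}`, Hölder gives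
`‖w‖_{L²} ≤ ‖w‖_{L^6} B²`, hence `‖w‖_V ≤ C ‖Av‖ B²`. On `{v > l}` the function `w` is at least a
multiple of `l - k`. -/
lemma levelNrm_step (hS : S.Admissible) (hC : S.SobolevBound C) (v : S.DomA) {k l : ℝ}
    (hk : 0 ≤ k) (hkl : k < l) :
    smoothRamp 1 * ((l - k) * S.levelNrm v.fn l) ≤ C ^ 2 * v.normDA * S.levelNrm v.fn k ^ 2 := by
  obtain ⟨ψ, hψ, hψ', hψk, hψ0, hψs, hψl⟩ := exists_smooth_truncation hk hkl
  obtain ⟨w, hw, hwg⟩ := exists_V_comp hS v.toV hψ (hψk 0 hk) (M := 1) fun s => by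
    rw [abs_of_nonneg (hψ' s).1]; exact (hψ' s).2
  have hvm : AEStronglyMeasurable v.fn S.mu := (V.memLp_fn v.toV).1
  set B := S.levelNrm v.fn k with hB
  have hB0 : 0 ≤ B := nrm_nonneg _ _ _
  have hC0 := hC.1
  have hi := memLp_indicator_level hS hvm k
  have hw1 : V.fn w =ᵐ[S.mu] fun x => V.fn w x * {x | k < v.fn x}.indicator (fun _ => (1:ℝ)) x *
      {x | k < v.fn x}.indicator (fun _ => (1:ℝ)) x := by
    filter_upwards [hw] with x hx
    by_cases h : x ∈ {x | k < v.fn x}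
    · simp only [indicator_of_mem h, mul_one]
    · simp only [indicator_of_notMem h, mul_zero]
      rw [hx]
      exact hψk _ (not_lt.1 h)
  have hw2 : nrm 2 S.mu (V.fn w) ≤ C * ‖w‖ * B ^ 2 := by
    rw [nrm_congr hw1]
    refine (memLp_mul_mul_six (hC.2 w).1 hi hi).2.trans ?_
    rw [sq, ← mul_assoc]
    have := (hC.2 w).2
    exact mul_le_mul_of_nonneg_right (mul_le_mul_of_nonneg_right this hB0) hB0
  have hen : ‖w‖ ^ 2 ≤ v.normDA * (C * ‖w‖ * B ^ 2) := by
    have h1 : ‖w‖ ^ 2 ≤ ∫ x, v.Aval x * V.fn w x ∂S.mu := by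
      rw [norm_sq_eq_integral, ← v.sum_integral_grad_add w, add_comm]
      refine add_le_add (Finset.sum_le_sum fun i _ => ?_) ?_
      · refine integral_mono_ae (memLp_grad w i).integrable_sq
          (integrable_mul (memLp_grad _ i) (memLp_grad w i)) ?_
        filter_upwards [hwg i] with x hx
        simp only [hx]
        have h3 := hψ' (V.fn v.toV x)
        nlinarith [mul_nonneg (mul_nonneg h3.1 (sub_nonneg.2 h3.2)) (sq_nonneg (S.grad v.toV i x))]
      · refine integral_mono_ae (V.memLp_fn w).integrable_sq
          (integrable_mul (V.memLp_fn v.toV) (V.memLp_fn w)) ?_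
        filter_upwards [hw] with x hx
        simp only [hx]
        change ψ (v.fn x) ^ 2 ≤ v.fn x * ψ (v.fn x)
        rcases le_total (v.fn x) k with h | h
        · simp [hψk _ h]
        · rw [sq]
          exact mul_le_mul_of_nonneg_right (hψs _ h) (hψ0 _)
    refine h1.trans ((le_abs_self _).trans ((abs_integral_mul_le (Lp.memLp v.Aval)
      (V.memLp_fn w)).trans ?_))
    rw [nrm_coe]
    exact mul_le_mul_of_nonneg_left hw2 v.normDA_nonneg
  have hw3 : ‖w‖ ≤ v.normDA * C * B ^ 2 := by
    rcases (norm_nonneg w).eq_or_lt with h | h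
    · rw [← h]
      have := v.normDA_nonneg
      positivity
    · refine le_of_mul_le_mul_left ?_ h
      calc ‖w‖ * ‖w‖ = ‖w‖ ^ 2 := (sq _).symm
        _ ≤ _ := hen
        _ = _ := by ring
  have hl : smoothRamp 1 * ((l - k) * S.levelNrm v.fn l) ≤ nrm 6 S.mu (V.fn w) := by
    have hpos : 0 ≤ smoothRamp 1 * (l - k) := mul_nonneg smoothRamp_one_pos.le (sub_nonneg.2 hkl.le)
    have h1 := nrm_const_mul (p := 6) (μ := S.mu) (smoothRamp 1 * (l - k))
      ({x | l < v.fn x}.indicator fun _ => 1)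
    rw [abs_of_nonneg hpos] at h1
    rw [levelNrm, ← mul_assoc, ← h1]
    refine nrm_mono (hC.2 w).1 ?_
    filter_upwards [hw] with x hx
    by_cases h : x ∈ {x | l < v.fn x}
    · have h' : l < v.fn x := h
      rw [indicator_of_mem h, mul_one, abs_of_nonneg hpos, hx]
      exact (hψl _ h'.le).trans (le_abs_self _)
    · rw [indicator_of_notMem h, mul_zero, abs_zero]
      exact abs_nonneg _
  calc _ ≤ nrm 6 S.mu (V.fn w) := hl
    _ ≤ C * ‖w‖ := (hC.2 w).2
    _ ≤ C * (v.normDA * C * B ^ 2) := mul_le_mul_of_nonneg_left hw3 hC0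
    _ = _ := by ring

end level

lemma DomA.fn_ae_eq_zero {v : S.DomA} (h : v.normV = 0) : v.fn =ᵐ[S.mu] 0 := by
  have h1 : v.toV = 0 := norm_eq_zero.1 h
  have h2 : S.inclH v.toV = 0 := by rw [h1, map_zero]
  change ((S.inclH v.toV : S.H) : E d → ℝ) =ᵐ[S.mu] _
  rw [h2]
  exact Lp.coeFn_zero ..

/-- The iteration starts at `k₀ = √(‖v‖_V ‖Av‖)`. There Chebyshev bounds `4 Q b(k₀)` by `4 C³ ‖v‖_V
‖Av‖ / (c k₀)`, a constant times `k₀`, so a jump `D` proportional to `k₀` is enough. -/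
lemma exists_fn_le (hS : S.Admissible) {C : ℝ} (hC : S.SobolevBound C) :
    ∃ K : ℝ, 0 ≤ K ∧ ∀ v : S.DomA, ∀ᵐ x ∂S.mu, v.fn x ≤ K * √(v.normV * v.normDA) := by
  have hc := smoothRamp_one_pos
  set c := smoothRamp 1 with hcdef
  have hC0 := hC.1
  refine ⟨2 + 4 * C ^ 3 / c, by positivity, fun v => ?_⟩
  rcases v.normV_nonneg.eq_or_lt with hV | hV
  · filter_upwards [DomA.fn_ae_eq_zero hV.symm] with x hx
    rw [hx, ← hV]; simp
  have hN : 0 < v.normDA := hV.trans_le v.normV_le_normDA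
  set k₀ := √(v.normV * v.normDA) with hk₀
  have hk₀pos : 0 < k₀ := Real.sqrt_pos.2 (mul_pos hV hN)
  have hk₀sq : k₀ * k₀ = v.normV * v.normDA := Real.mul_self_sqrt (mul_pos hV hN).le
  have hvm : AEStronglyMeasurable v.fn S.mu := (V.memLp_fn v.toV).1
  have hb0 : k₀ * S.levelNrm v.fn k₀ ≤ C * v.normV := levelNrm_mul_le hC v.toV hk₀pos.le
  have hzero := eq_zero_of_stampacchia (b := S.levelNrm v.fn) (fun k => nrm_nonneg _ _ _)
    (antitone_levelNrm hS hvm) (Q := C ^ 2 * v.normDA / c) (k₀ := k₀)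
    (D := (1 + 4 * C ^ 3 / c) * k₀) hk₀pos.le (by positivity) ?_ (by positivity) ?_
  · refine (ae_le_of_levelNrm_eq_zero hS hvm hzero).mono fun x hx => hx.trans (le_of_eq ?_)
    ring
  · refine le_of_mul_le_mul_left ?_ hk₀pos
    calc k₀ * (4 * (C ^ 2 * v.normDA / c) * S.levelNrm v.fn k₀)
        = (4 * (C ^ 2 * v.normDA / c)) * (k₀ * S.levelNrm v.fn k₀) := by ring
      _ ≤ (4 * (C ^ 2 * v.normDA / c)) * (C * v.normV) := by gcongr
      _ = (4 * C ^ 3 / c) * (k₀ * k₀) := by rw [hk₀sq]; ring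
      _ ≤ (1 + 4 * C ^ 3 / c) * (k₀ * k₀) := by gcongr; linarith
      _ = _ := by ring
  · intro k l hk hkl
    have := levelNrm_step hS hC v hk hkl
    rw [div_mul_eq_mul_div, le_div_iff₀ hc]
    linarith

/-- Agmon's inequality on `D(A)`. -/
lemma exists_abs_fn_le (hS : S.Admissible) {C : ℝ} (hC : S.SobolevBound C) :
    ∃ K : ℝ, 0 ≤ K ∧ ∀ v : S.DomA, ∀ᵐ x ∂S.mu, |v.fn x| ≤ K * √(v.normV * v.normDA) := by
  obtain ⟨K, hK, h⟩ := exists_fn_le hS hC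
  refine ⟨K, hK, fun v => ?_⟩
  have h2 := h v.neg
  rw [DomA.normV_neg, DomA.normDA_neg] at h2
  filter_upwards [h v, h2, v.neg_fn] with x h1 h2 h3
  rw [h3] at h2
  exact abs_le.2 ⟨by linarith, h1⟩

end Setting

/-! ### Weighted gradient estimate and integration by parts against `A₀ v`. -/

namespace Setting
variable {d : ℕ} {S : Setting d}

/-- The weighted energy estimate `‖e ∇w‖² ≤ K ‖w‖_V ‖w‖_{D(A)} ‖e‖_V²`. -/
lemma exists_integral_sq_mul_grad_sq_le (hS : S.Admissible) {C : ℝ} (hC : S.SobolevBound C) :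
    ∃ K : ℝ, 0 ≤ K ∧ ∀ (w : S.DomA) (e : S.V) (R : ℝ), (∀ᵐ x ∂S.mu, |V.fn e x| ≤ R) →
      (∀ i, MemLp (fun x => V.fn e x * S.grad w.toV i x) 2 S.mu) ∧
      ∑ i, ∫ x, (V.fn e x * S.grad w.toV i x) ^ 2 ∂S.mu ≤
        K * (w.normV * w.normDA) * ‖e‖ ^ 2 := by
  obtain ⟨K, hK, hag⟩ := exists_abs_fn_le hS hC
  have hC0 := hC.1
  refine ⟨2 * C ^ 3 + 4 * K ^ 2, by positivity, fun w e R he => ?_⟩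
  set M := K * √(w.normV * w.normDA) with hM
  have hVD : 0 ≤ w.normV * w.normDA := mul_nonneg w.normV_nonneg w.normDA_nonneg
  have hMsq : M ^ 2 = K ^ 2 * (w.normV * w.normDA) := by rw [hM, mul_pow, Real.sq_sqrt hVD]
  have hw : ∀ᵐ x ∂S.mu, |V.fn w.toV x| ≤ M := hag w
  have hem : AEStronglyMeasurable (V.fn e) S.mu := (V.memLp_fn e).1
  have hmem : ∀ i, MemLp (fun x => V.fn e x * S.grad w.toV i x) 2 S.mu := fun i => by
    refine ((memLp_grad w.toV i).const_mul R).mono (hem.mul (memLp_grad w.toV i).1) ?_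
    filter_upwards [he] with x hx
    rw [norm_mul, norm_mul]
    exact mul_le_mul_of_nonneg_right (hx.trans (le_abs_self _)) (norm_nonneg _)
  refine ⟨hmem, ?_⟩
  -- The test function is `z = e² w`. It lies in `V` because `e` is bounded by hypothesis and `w` by
  -- Agmon's inequality.
  obtain ⟨e2, he2, hge2⟩ := exists_V_mul_of_bounded hS e e he he
  have he2b : ∀ᵐ x ∂S.mu, |V.fn e2 x| ≤ R * R := by
    filter_upwards [he2, he] with x h1 h2
    rw [h1, abs_mul]
    exact mul_le_mul h2 h2 (abs_nonneg _) ((abs_nonneg _).trans h2)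
  obtain ⟨z, hz, hgz⟩ := exists_V_mul_of_bounded hS e2 w.toV he2b hw
  have heq := w.sum_integral_grad_add z
  -- Young's inequality for the cross term: `a²b² + 2abmq ≥ a²b²/2 - 2m²q²`, with Agmon's bound for
  -- `m = w`.
  have hlow : ∀ i, 1/2 * ∫ x, (V.fn e x * S.grad w.toV i x) ^ 2 ∂S.mu -
      2 * M ^ 2 * ∫ x, S.grad e i x ^ 2 ∂S.mu ≤ ∫ x, S.grad w.toV i x * S.grad z i x ∂S.mu := by
    intro i
    have i1 : Integrable (fun x => 1/2 * (V.fn e x * S.grad w.toV i x) ^ 2) S.mu :=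
      (hmem i).integrable_sq.const_mul _
    have i2 : Integrable (fun x => 2 * M ^ 2 * S.grad e i x ^ 2) S.mu :=
      (memLp_grad e i).integrable_sq.const_mul _
    rw [← integral_const_mul, ← integral_const_mul, ← integral_sub i1 i2]
    refine integral_mono_ae (i1.sub i2) (integrable_mul (memLp_grad _ i) (memLp_grad z i)) ?_
    filter_upwards [hgz i, hge2 i, he2, hw] with x h1 h2 h3 h4
    simp only [h1, h2, h3]
    set a := V.fn e x
    set b := S.grad w.toV i x
    set q := S.grad e i x
    set m := V.fn w.toV x
    have h5 : m ^ 2 ≤ M ^ 2 := sq_le_sq' (abs_le.1 h4).1 (abs_le.1 h4).2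
    have h6 : m ^ 2 * q ^ 2 ≤ M ^ 2 * q ^ 2 := mul_le_mul_of_nonneg_right h5 (sq_nonneg q)
    nlinarith [sq_nonneg (a * b + 2 * m * q)]
  have hup : ∫ x, w.Aval x * V.fn z x ∂S.mu ≤ C ^ 3 * (w.normV * w.normDA) * ‖e‖ ^ 2 := by
    obtain ⟨ht, ht'⟩ := hC.mul_mul e e w.toV
    have h1 : ∫ x, w.Aval x * V.fn z x ∂S.mu =
        ∫ x, w.Aval x * (V.fn e x * V.fn e x * V.fn w.toV x) ∂S.mu := by
      refine integral_congr_ae ?_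
      filter_upwards [hz, he2] with x h1 h2
      rw [h1, h2]
    rw [h1]
    refine (le_abs_self _).trans ((abs_integral_mul_le (Lp.memLp w.Aval) ht).trans ?_)
    rw [nrm_coe]
    calc w.normDA * nrm 2 S.mu (fun x => V.fn e x * V.fn e x * V.fn w.toV x)
        ≤ w.normDA * (C ^ 3 * (‖e‖ * ‖e‖ * ‖w.toV‖)) :=
          mul_le_mul_of_nonneg_left ht' w.normDA_nonneg
      _ = _ := by rw [DomA.normV]; ring
  -- The zero order part of `A` contributes `∫ e² w²`, which has the favourable sign and is dropped.
  have hnn : 0 ≤ ∫ x, w.fn x * V.fn z x ∂S.mu := by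
    refine integral_nonneg_of_ae ?_
    filter_upwards [hz, he2] with x h1 h2
    rw [h1, h2]
    change (0:ℝ) ≤ V.fn w.toV x * (V.fn e x * V.fn e x * V.fn w.toV x)
    nlinarith [sq_nonneg (V.fn w.toV x * V.fn e x)]
  have hge : ∑ i, ∫ x, S.grad e i x ^ 2 ∂S.mu ≤ ‖e‖ ^ 2 := by
    rw [norm_sq_eq_integral]
    exact le_add_of_nonneg_left (integral_nonneg fun x => sq_nonneg _)
  have hsum := Finset.sum_le_sum fun i (_ : i ∈ Finset.univ) => hlow i
  rw [Finset.sum_sub_distrib, ← Finset.mul_sum, ← Finset.mul_sum] at hsum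
  have hge' := mul_le_mul_of_nonneg_left hge (show 0 ≤ 2 * M ^ 2 by positivity)
  rw [hMsq] at hge' hsum
  nlinarith

lemma DomA.memLp_fn (v : S.DomA) : MemLp v.fn 2 S.mu := V.memLp_fn v.toV

/-- Integration by parts for nonlinear functions of an element of `D(A)`. -/
lemma pairA0_comp_eq (hS : S.Admissible) (v : S.DomA) {R : ℝ} (hv : ∀ᵐ x ∂S.mu, |v.fn x| ≤ R)
    {ψ : ℝ → ℝ} (hψ : ContDiff ℝ ∞ ψ) (h0 : ψ 0 = 0) :
    S.pairA0 (fun x => ψ (v.fn x)) v =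
      ∑ i, ∫ x, deriv ψ (v.fn x) * S.grad v.toV i x ^ 2 ∂S.mu := by
  obtain ⟨z, hz, hgz⟩ := exists_V_comp_of_bounded hS v.toV hv hψ h0
  have heq := v.sum_integral_grad_add z
  have h1 : S.pairA0 (fun x => ψ (v.fn x)) v =
      ∫ x, v.Aval x * V.fn z x ∂S.mu - ∫ x, v.fn x * V.fn z x ∂S.mu := by
    rw [← integral_sub (integrable_mul (Lp.memLp v.Aval) (V.memLp_fn z))
      (integrable_mul v.memLp_fn (V.memLp_fn z)), pairA0]
    refine integral_congr_ae ?_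
    filter_upwards [hz] with x hx
    rw [hx]
    change ψ (v.fn x) * _ = v.Aval x * ψ (v.fn x) - v.fn x * ψ (v.fn x)
    ring
  rw [h1, ← heq, add_sub_cancel_right]
  refine Finset.sum_congr rfl fun i _ => integral_congr_ae ?_
  filter_upwards [hgz i] with x hx
  rw [hx]
  change _ = deriv ψ (V.fn v.toV x) * _
  ring

/-- The pairing of a monotone function of `v` with `A₀ v` is nonnegative. -/
lemma pairA0_comp_nonneg (hS : S.Admissible) (v : S.DomA) {R : ℝ} (hv : ∀ᵐ x ∂S.mu, |v.fn x| ≤ R)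
    {ψ : ℝ → ℝ} (hψ : ContDiff ℝ ∞ ψ) (h0 : ψ 0 = 0) (hmono : ∀ s, 0 ≤ deriv ψ s) :
    0 ≤ S.pairA0 (fun x => ψ (v.fn x)) v := by
  rw [pairA0_comp_eq hS v hv hψ h0]
  exact Finset.sum_nonneg fun i _ => integral_nonneg fun x => mul_nonneg (hmono _) (sq_nonneg _)

lemma memLp_Aval_sub (v : S.DomA) : MemLp (fun x => v.Aval x - v.fn x) 2 S.mu :=
  (Lp.memLp v.Aval).sub (V.memLp_fn v.toV)

lemma nrm_Aval_sub_le (v : S.DomA) : nrm 2 S.mu (fun x => v.Aval x - v.fn x) ≤ 2 * v.normDA := by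
  have h1 : (fun x => v.Aval x - v.fn x) =ᵐ[S.mu] (v.Aval - S.inclH v.toV : S.H) :=
    (Lp.coeFn_sub v.Aval (S.inclH v.toV)).symm
  rw [nrm_congr h1, nrm_coe]
  have h2 : ‖S.inclH v.toV‖ ≤ v.normDA := v.normH_le_normV.trans v.normV_le_normDA
  have h3 : ‖v.Aval‖ = v.normDA := rfl
  linarith [norm_sub_le v.Aval (S.inclH v.toV)]

lemma abs_pairA0_le {w : E d → ℝ} (hw : MemLp w 2 S.mu) (v : S.DomA) :
    |S.pairA0 w v| ≤ nrm 2 S.mu w * (2 * v.normDA) :=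
  (abs_integral_mul_le hw (memLp_Aval_sub v)).trans
    (mul_le_mul_of_nonneg_left (nrm_Aval_sub_le v) (nrm_nonneg _ _ _))

lemma pairA0_add {w₁ w₂ : E d → ℝ} (h₁ : MemLp w₁ 2 S.mu) (h₂ : MemLp w₂ 2 S.mu) (v : S.DomA) :
    S.pairA0 (fun x => w₁ x + w₂ x) v = S.pairA0 w₁ v + S.pairA0 w₂ v := by
  rw [pairA0, pairA0, pairA0, ← integral_add (integrable_mul h₁ (memLp_Aval_sub v))
    (integrable_mul h₂ (memLp_Aval_sub v))]
  simp only [add_mul]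

lemma pairA0_const_mul (c : ℝ) (w : E d → ℝ) (v : S.DomA) :
    S.pairA0 (fun x => c * w x) v = c * S.pairA0 w v := by
  rw [pairA0, pairA0, ← integral_const_mul]
  simp only [mul_assoc]

lemma represents_of_memLp {w : E d → ℝ} (hw : MemLp w 2 S.mu) :
    S.Represents w (S.ofH (hw.toLp w)) := by
  intro z
  refine ⟨integrable_mul hw (V.memLp_fn z), ?_⟩
  rw [ofH_apply]
  refine integral_congr_ae ?_
  filter_upwards [hw.coeFn_toLp] with x hx
  rw [hx]

lemma norm_le_of_represents {w : E d → ℝ} {l : S.V'} (hl : S.Represents w l) {M : ℝ} (hM : 0 ≤ M)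
    (h : ∀ z : S.V, |∫ x, w x * V.fn z x ∂S.mu| ≤ M * ‖z‖) : ‖l‖ ≤ M := by
  refine l.opNorm_le_bound hM fun z => ?_
  rw [← (hl z).2]
  exact h z

lemma norm_A0_le (u : S.V) : ‖S.A0 u‖ ≤ √(∑ i, ∫ x, S.grad u i x ^ 2 ∂S.mu) := by
  have h1 : ‖S.grad u‖ ^ 2 = ∑ i, ∫ x, S.grad u i x ^ 2 ∂S.mu := by
    rw [PiLp.norm_sq_eq_of_L2]
    exact Finset.sum_congr rfl fun i _ => by rw [← nrm_coe, nrm_two_sq (memLp_grad u i)]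
  rw [← h1, Real.sqrt_sq (norm_nonneg _)]
  refine ContinuousLinearMap.opNorm_le_bound _ (norm_nonneg _) fun z => ?_
  have h2 : ‖S.grad z‖ ≤ ‖z‖ := by
    refine le_of_sq_le_sq ?_ (norm_nonneg _)
    rw [norm_sq_eq, PiLp.norm_sq_eq_of_L2]
    exact le_add_of_nonneg_left (sq_nonneg _)
  exact (norm_inner_le_norm (S.grad u) (S.grad z)).trans
    (mul_le_mul_of_nonneg_left h2 (norm_nonneg _))

end Setting

/-! ### Growth and Lipschitz estimates for the double-well nonlinearity. -/

namespace Setting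
variable {d : ℕ} {S : Setting d}

lemma memLp_of_ae_bounded (hS : S.Admissible) {w : E d → ℝ} (hw : AEStronglyMeasurable w S.mu)
    {R : ℝ} (h : ∀ᵐ x ∂S.mu, |w x| ≤ R) (p : ℝ≥0∞) : MemLp w p S.mu := by
  have := hS.isFiniteMeasure
  exact MemLp.of_bound hw R h

lemma memLp_comp_of_ae_bounded (hS : S.Admissible) {w : E d → ℝ}
    (hw : AEStronglyMeasurable w S.mu) {R : ℝ} (h : ∀ᵐ x ∂S.mu, |w x| ≤ R) {ψ : ℝ → ℝ}
    (hψ : Continuous ψ) (p : ℝ≥0∞) : MemLp (fun x => ψ (w x)) p S.mu := by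
  obtain ⟨M, hM⟩ := (isCompact_Icc (a := -R) (b := R)).exists_bound_of_continuousOn hψ.continuousOn
  refine memLp_of_ae_bounded hS (hψ.comp_aestronglyMeasurable hw) (R := M) ?_ p
  filter_upwards [h] with x hx using hM _ (abs_le.1 hx)

lemma exists_ae_abs_le {α : Type*} [MeasurableSpace α] {μ : Measure α} {a : α → ℝ}
    (ha : MemLp a ∞ μ) : ∃ A : ℝ, 0 ≤ A ∧ ∀ᵐ x ∂μ, |a x| ≤ A := by
  refine ⟨(eLpNorm a ∞ μ).toReal, ENNReal.toReal_nonneg, ?_⟩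
  have h := ae_le_eLpNormEssSup (f := a) (μ := μ)
  rw [← eLpNorm_exponent_top] at h
  filter_upwards [h] with x hx
  have := ENNReal.toReal_mono ha.2.ne hx
  simpa using this

lemma contDiff_cube : ContDiff ℝ ∞ fun s : ℝ => s ^ 3 := contDiff_id.pow 3

lemma contDiff_doubleWellNL (τ : ℝ) : ContDiff ℝ ∞ (doubleWellNL τ) :=
  contDiff_const.mul (contDiff_cube.sub contDiff_id)

lemma deriv_doubleWellNL (τ s : ℝ) : deriv (doubleWellNL τ) s = 4 * τ * (3 * s ^ 2 - 1) := by
  have h1 : HasDerivAt (doubleWellNL τ) (4 * τ * (3 * s ^ 2 - 1)) s := by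
    have := (((hasDerivAt_id s).pow 3).sub (hasDerivAt_id s)).const_mul (4 * τ)
    convert! this using 1
    simp
  exact h1.deriv

lemma hasDerivAt_doubleWell (τ s : ℝ) : HasDerivAt (doubleWell τ) (doubleWellNL τ s) s := by
  have := ((((hasDerivAt_id s).pow 2).sub_const 1).pow 2).const_mul τ
  convert! this using 1
  simp [doubleWellNL]
  ring

lemma pairA0_cube_nonneg (hS : S.Admissible) (v : S.DomA) {R : ℝ}
    (hv : ∀ᵐ x ∂S.mu, |v.fn x| ≤ R) : 0 ≤ S.pairA0 (fun x => v.fn x ^ 3) v :=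
  pairA0_comp_nonneg hS v hv (ψ := fun s => s ^ 3) contDiff_cube (by simp) fun s => by
    simp; positivity

lemma nrm_fn (v : S.DomA) : nrm 2 S.mu v.fn = v.normH := nrm_coe _

lemma sq_le_of_le_mul_one_add {N B V h : ℝ} (hN0 : 0 ≤ N) (hN : N ≤ B * (V * (1 + h * V))) :
    N ^ 2 ≤ 2 * B ^ 2 * V ^ 2 * (1 + h ^ 2 * V ^ 2) := by
  have h1 : N ^ 2 ≤ (B * (V * (1 + h * V))) ^ 2 := pow_le_pow_left₀ hN0 hN 2
  have h2 : 0 ≤ (B * V) ^ 2 * (1 - h * V) ^ 2 := by positivity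
  linarith

lemma memLp_doubleWellNL (hS : S.Admissible) {C : ℝ} (hC : S.SobolevBound C) (τ : ℝ)
    (v : S.DomA) : MemLp (fun x => doubleWellNL τ (v.fn x)) 2 S.mu := by
  obtain ⟨K, hK, hag⟩ := exists_abs_fn_le hS hC
  exact memLp_comp_of_ae_bounded hS v.memLp_fn.1 (hag v) (contDiff_doubleWellNL τ).continuous 2

lemma norm_fn_le (z : S.V) : nrm 2 S.mu (V.fn z) ≤ ‖z‖ :=
  (nrm_coe (S.inclH z)).trans_le (norm_inclH_le z)

/-- Writing `v³ z` as `v · (v v z)` puts one factor in `H` and the other three in `V` through the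
`L^6` embedding. This produces the factor `‖v‖_H ‖v‖_V²`. -/
lemma abs_integral_doubleWellNL_le {C : ℝ} (hC : S.SobolevBound C) {τ : ℝ} (hτ : 0 < τ)
    (v : S.DomA) (z : S.V) : |∫ x, doubleWellNL τ (v.fn x) * V.fn z x ∂S.mu| ≤
      4 * τ * (C ^ 3 + 1) * (v.normV * (1 + v.normH * v.normV)) * ‖z‖ := by
  have hC0 := hC.1
  have hH := v.normH_nonneg
  have hV := v.normV_nonneg
  obtain ⟨ht, ht'⟩ := hC.mul_mul v.toV v.toV z
  have h1 : ∫ x, doubleWellNL τ (v.fn x) * V.fn z x ∂S.mu =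
      4 * τ * (∫ x, v.fn x * (V.fn v.toV x * V.fn v.toV x * V.fn z x) ∂S.mu -
        ∫ x, v.fn x * V.fn z x ∂S.mu) := by
    rw [← integral_sub (integrable_mul v.memLp_fn ht)
      (integrable_mul v.memLp_fn (V.memLp_fn z)), ← integral_const_mul]
    refine integral_congr_ae (Eventually.of_forall fun x => ?_)
    change 4 * τ * (v.fn x ^ 3 - v.fn x) * V.fn z x =
      4 * τ * (v.fn x * (v.fn x * v.fn x * V.fn z x) - v.fn x * V.fn z x)
    ring
  have h2 := abs_integral_mul_le v.memLp_fn ht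
  have h3 := abs_integral_mul_le v.memLp_fn (V.memLp_fn z)
  rw [nrm_fn] at h2 h3
  have h4 := h2.trans (mul_le_mul_of_nonneg_left ht' hH)
  have h5 := h3.trans (mul_le_mul v.normH_le_normV (norm_fn_le z) (nrm_nonneg _ _ _) hV)
  have hz0 := norm_nonneg z
  have h6 : 0 ≤ C ^ 3 * (v.normV * ‖z‖) + v.normH * v.normV * v.normV * ‖z‖ := by positivity
  have h7 : v.normH * (C ^ 3 * (‖v.toV‖ * ‖v.toV‖ * ‖z‖)) =
    v.normH * (C ^ 3 * (v.normV * v.normV * ‖z‖)) := rfl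
  rw [h7] at h4
  have h8 := (abs_sub (∫ x, v.fn x * (V.fn v.toV x * V.fn v.toV x * V.fn z x) ∂S.mu)
    (∫ x, v.fn x * V.fn z x ∂S.mu)).trans (add_le_add h4 h5)
  rw [h1, abs_mul, abs_of_pos (by positivity : 0 < 4 * τ), mul_assoc (4 * τ), mul_assoc (4 * τ)]
  refine mul_le_mul_of_nonneg_left (h8.trans ?_) (by positivity)
  linarith

/-- The cube is monotone, so its pairing with `A₀ v` is nonnegative and drops out. Only the linear
part `-4τ v` is estimated, with `‖A₀ v‖_H ≤ 2 ‖Av‖_H`. -/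
lemma neg_pairA0_doubleWellNL_le (hS : S.Admissible) {C : ℝ} (hC : S.SobolevBound C) {τ : ℝ}
    (hτ : 0 < τ) (v : S.DomA) :
    -(S.pairA0 (fun x => doubleWellNL τ (v.fn x)) v) ≤ 8 * τ * v.normDA * v.normV := by
  obtain ⟨K, hK, hag⟩ := exists_abs_fn_le hS hC
  have hcube : MemLp (fun x => v.fn x ^ 3) 2 S.mu :=
    memLp_comp_of_ae_bounded hS v.memLp_fn.1 (hag v) contDiff_cube.continuous 2
  have hneg : MemLp (fun x => -1 * v.fn x) 2 S.mu := v.memLp_fn.const_mul (-1)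
  have h1 : S.pairA0 (fun x => doubleWellNL τ (v.fn x)) v =
      4 * τ * (S.pairA0 (fun x => v.fn x ^ 3) v - S.pairA0 v.fn v) := by
    have e : (fun x => doubleWellNL τ (v.fn x)) =
        fun x => 4 * τ * (v.fn x ^ 3 + -1 * v.fn x) := by
      ext x; rw [doubleWellNL]; ring
    rw [e, pairA0_const_mul, pairA0_add hcube hneg, pairA0_const_mul]
    ring
  have h2 := pairA0_cube_nonneg hS v (hag v)
  have h3 := abs_pairA0_le v.memLp_fn v
  rw [nrm_fn] at h3
  have hD := v.normDA_nonneg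
  have h4 : v.normH * (2 * v.normDA) ≤ v.normV * (2 * v.normDA) :=
    mul_le_mul_of_nonneg_right v.normH_le_normV (by positivity)
  have h5 : S.pairA0 v.fn v - S.pairA0 (fun x => v.fn x ^ 3) v ≤ v.normV * (2 * v.normDA) := by
    linarith [le_abs_self (S.pairA0 v.fn v)]
  have h6 := mul_le_mul_of_nonneg_left h5 (by positivity : 0 ≤ 4 * τ)
  rw [h1]
  linarith

lemma growthF_doubleWell (hS : S.Admissible) {C : ℝ} (hC : S.SobolevBound C) {τ : ℝ}
    (hτ : 0 < τ) : S.GrowthF (doubleWell τ) (doubleWellNL τ) := by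
  have hC0 := hC.1
  have := hS.isFiniteMeasure
  obtain ⟨K, hK, hag⟩ := exists_abs_fn_le hS hC
  refine ⟨hasDerivAt_doubleWell τ, fun s => mul_nonneg hτ.le (sq_nonneg _), fun z _ => ?_, ?_⟩
  · have hc : Continuous (doubleWell τ) :=
      continuous_iff_continuousAt.2 fun s => (hasDerivAt_doubleWell τ s).continuousAt
    exact (memLp_comp_of_ae_bounded hS z.memLp_fn.1 (hag z) hc 1).integrable le_rfl
  set B := 4 * τ * (C ^ 3 + 1) with hB
  have hB0 : 0 ≤ B := by positivity
  refine ⟨2 * B ^ 2 + 8 * τ, by positivity, fun v =>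
    ⟨⟨_, represents_of_memLp (memLp_doubleWellNL hS hC τ v), ?_⟩,
      memLp_doubleWellNL hS hC τ v, ?_⟩⟩
  · have hH := v.normH_nonneg
    have hV := v.normV_nonneg
    have hl := norm_le_of_represents (represents_of_memLp (memLp_doubleWellNL hS hC τ v))
      (M := B * (v.normV * (1 + v.normH * v.normV))) (by positivity)
      (abs_integral_doubleWellNL_le hC hτ v)
    have h1 := sq_le_of_le_mul_one_add (ContinuousLinearMap.opNorm_nonneg _) hl
    have h2 : 0 ≤ 8 * τ * v.normV ^ 2 * (1 + v.normH ^ 2 * v.normV ^ 2) := by positivity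
    linarith
  · have h1 := neg_pairA0_doubleWellNL_le hS hC hτ v
    have hV := v.normV_nonneg
    have hD := v.normDA_nonneg
    have h2 : 0 ≤ 2 * B ^ 2 * v.normDA * v.normV := by positivity
    linarith

/-- Here `P` and `Q` stand for partial derivatives of `v` and `w`. Up to the factor `4τ`, the
difference equals `(3p² - 1)(P - Q) + 3(p + q)(p - q)Q`, so gradients occur only as `∇(v - w)` and
`(v - w)∇w`. -/
lemma sq_cubic_dif_le {τ p q P Q m n : ℝ} (hp : |p| ≤ m) (hq : |q| ≤ n) :
    (4 * τ * (3 * p ^ 2 - 1) * P - 4 * τ * (3 * q ^ 2 - 1) * Q) ^ 2 ≤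
      2 * (4 * τ) ^ 2 * ((3 * m ^ 2 + 1) ^ 2 * (P - Q) ^ 2 +
        9 * (m + n) ^ 2 * ((p - q) * Q) ^ 2) := by
  have h8 : 4 * τ * (3 * p ^ 2 - 1) * P - 4 * τ * (3 * q ^ 2 - 1) * Q =
      4 * τ * ((3 * p ^ 2 - 1) * (P - Q) + 3 * (p + q) * ((p - q) * Q)) := by ring
  have h9 : (3 * p ^ 2 - 1) ^ 2 ≤ (3 * m ^ 2 + 1) ^ 2 := by
    have : p ^ 2 ≤ m ^ 2 := sq_le_sq' (abs_le.1 hp).1 (abs_le.1 hp).2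
    exact sq_le_sq' (by linarith [sq_nonneg p, sq_nonneg m]) (by linarith)
  have h10 : (p + q) ^ 2 ≤ (m + n) ^ 2 := by
    have := abs_le.1 ((abs_add_le p q).trans (add_le_add hp hq))
    exact sq_le_sq' this.1 this.2
  have h11 := mul_le_mul_of_nonneg_right h9 (sq_nonneg (P - Q))
  have h12 := mul_le_mul_of_nonneg_right h10 (sq_nonneg ((p - q) * Q))
  have h13 : ((3 * p ^ 2 - 1) * (P - Q) + 3 * (p + q) * ((p - q) * Q)) ^ 2 ≤
      2 * ((3 * m ^ 2 + 1) ^ 2 * (P - Q) ^ 2 + 9 * (m + n) ^ 2 * ((p - q) * Q) ^ 2) := by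
    linarith [sq_nonneg ((3 * p ^ 2 - 1) * (P - Q) - 3 * (p + q) * ((p - q) * Q))]
  have h14 := mul_le_mul_of_nonneg_left h13 (sq_nonneg (4 * τ))
  rw [h8, mul_pow]
  linarith

/-- Every factor is at most quadratic in `√(ab)`, where `a` and `b` stand for the joint norms in `V`
and `D(A)`, and both `1` and `ab` are at most `(1 + a)(1 + b)`. This gives the product form of the
required bound. -/
lemma cubic_dif_bound {K K' a b m n r g s N : ℝ} (hK' : 0 ≤ K') (ha : 0 ≤ a)
    (hb : 0 ≤ b) (hm2 : m ^ 2 ≤ K ^ 2 * (a * b)) (hn2 : n ^ 2 ≤ K ^ 2 * (a * b))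
    (hr : 0 ≤ r) (hra : r ≤ a * b) (hg : g ≤ N ^ 2) (hs : s ≤ K' * r * N ^ 2) :
    (3 * m ^ 2 + 1) ^ 2 * g + 9 * (m + n) ^ 2 * s ≤
      ((3 * K ^ 2 + 1) ^ 2 + 36 * K ^ 2 * K') * ((1 + a) * (1 + b) * N) ^ 2 := by
  have hab : 0 ≤ a * b := mul_nonneg ha hb
  have hX : (1 + a) * (1 + b) = 1 + a + b + a * b := by ring
  set X := (1 + a) * (1 + b)
  have hab1 : a * b ≤ X := by linarith
  have hab2 : 1 ≤ X := by linarith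
  have hKX : K ^ 2 * (a * b) ≤ K ^ 2 * X := mul_le_mul_of_nonneg_left hab1 (sq_nonneg _)
  have g1 : (3 * m ^ 2 + 1) ^ 2 ≤ (3 * K ^ 2 + 1) ^ 2 * X ^ 2 := by
    rw [← mul_pow]
    exact pow_le_pow_left₀ (by positivity) (by linarith) 2
  have s1 : (m + n) ^ 2 ≤ 4 * (K ^ 2 * X) := by linarith [sq_nonneg (m - n)]
  have s2 : K' * r ≤ K' * X := mul_le_mul_of_nonneg_left (hra.trans hab1) hK'
  have s3 := mul_le_mul s1 s2 (mul_nonneg hK' hr) (by positivity)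
  have e1 := mul_le_mul_of_nonneg_left hg (sq_nonneg (3 * m ^ 2 + 1))
  have e2 := mul_le_mul_of_nonneg_right g1 (sq_nonneg N)
  have e3 := mul_le_mul_of_nonneg_left hs (by positivity : 0 ≤ 9 * (m + n) ^ 2)
  have e4 := mul_le_mul_of_nonneg_right s3 (sq_nonneg N)
  linarith

lemma normV_mul_normDA_le_left (v w : S.DomA) : v.normV * v.normDA ≤
    √(v.normV ^ 2 + w.normV ^ 2) * √(v.normDA ^ 2 + w.normDA ^ 2) :=
  mul_le_mul (Real.le_sqrt_of_sq_le (le_add_of_nonneg_right (sq_nonneg _)))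
    (Real.le_sqrt_of_sq_le (by linarith [sq_nonneg w.normDA])) v.normDA_nonneg (Real.sqrt_nonneg _)

lemma normV_mul_normDA_le_right (v w : S.DomA) : w.normV * w.normDA ≤
    √(v.normV ^ 2 + w.normV ^ 2) * √(v.normDA ^ 2 + w.normDA ^ 2) := by
  rw [add_comm (v.normV ^ 2), add_comm (v.normDA ^ 2)]
  exact normV_mul_normDA_le_left w v

lemma sum_integral_grad_le (e : S.V) : ∑ i, ∫ x, S.grad e i x ^ 2 ∂S.mu ≤ ‖e‖ ^ 2 := by
  have h : 0 ≤ ∫ x, V.fn e x ^ 2 ∂S.mu := integral_nonneg fun x => sq_nonneg (V.fn e x)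
  have h' := norm_sq_eq_integral e
  linarith

lemma integral_grad_doubleWellNL_sub_le {τ : ℝ} {v w : S.DomA} {zv zw : S.V} {m n : ℝ}
    (hv : ∀ᵐ x ∂S.mu, |v.fn x| ≤ m) (hw : ∀ᵐ x ∂S.mu, |w.fn x| ≤ n) (i : Fin d)
    (hgv : S.grad zv i =ᵐ[S.mu] fun x => deriv (doubleWellNL τ) (v.fn x) * S.grad v.toV i x)
    (hgw : S.grad zw i =ᵐ[S.mu] fun x => deriv (doubleWellNL τ) (w.fn x) * S.grad w.toV i x)
    (hm : MemLp (fun x => V.fn (v.toV - w.toV) x * S.grad w.toV i x) 2 S.mu) :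
    ∫ x, S.grad (zv - zw) i x ^ 2 ∂S.mu ≤ 2 * (4 * τ) ^ 2 *
      ((3 * m ^ 2 + 1) ^ 2 * ∫ x, S.grad (v.toV - w.toV) i x ^ 2 ∂S.mu +
        9 * (m + n) ^ 2 * ∫ x, (V.fn (v.toV - w.toV) x * S.grad w.toV i x) ^ 2 ∂S.mu) := by
  have i1 : Integrable (fun x => (3 * m ^ 2 + 1) ^ 2 * S.grad (v.toV - w.toV) i x ^ 2) S.mu :=
    (memLp_grad _ i).integrable_sq.const_mul _
  have i2 : Integrable (fun x => 9 * (m + n) ^ 2 *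
    (V.fn (v.toV - w.toV) x * S.grad w.toV i x) ^ 2) S.mu := hm.integrable_sq.const_mul _
  rw [← integral_const_mul, ← integral_const_mul, ← integral_add i1 i2, ← integral_const_mul]
  refine integral_mono_ae (memLp_grad _ i).integrable_sq ((i1.add i2).const_mul _) ?_
  filter_upwards [grad_sub zv zw i, hgv, hgw, grad_sub v.toV w.toV i, V.fn_sub v.toV w.toV,
    hv, hw] with x h1 h2 h3 h4 h5 h6 h7
  simp only [h1, h2, h3, deriv_doubleWellNL, h4, h5]
  exact sq_cubic_dif_le h6 h7

/-- The term `(v - w)∇w` is handled by the weighted estimate with weight `e = v - w`, bounded by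
Agmon's inequality. Since `f(0) = 0`, the chain rule stays within `V` also under Dirichlet
conditions. -/
lemma difF_doubleWell (hS : S.Admissible) {C : ℝ} (hC : S.SobolevBound C) (τ : ℝ) :
    S.DifF (doubleWellNL τ) := by
  obtain ⟨K, hK, hag⟩ := exists_abs_fn_le hS hC
  obtain ⟨K', hK', hcac⟩ := exists_integral_sq_mul_grad_sq_le hS hC
  set B := (3 * K ^ 2 + 1) ^ 2 + 36 * K ^ 2 * K' with hB
  have hB0 : 0 ≤ B := by positivity
  refine ⟨√(2 * (4 * τ) ^ 2 * B), Real.sqrt_nonneg _, fun v w _ _ => ?_⟩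
  have h0 : doubleWellNL τ 0 = 0 := by simp [doubleWellNL]
  obtain ⟨zv, hzv, hgv⟩ := exists_V_comp_of_bounded hS v.toV (hag v) (contDiff_doubleWellNL τ) h0
  obtain ⟨zw, hzw, hgw⟩ := exists_V_comp_of_bounded hS w.toV (hag w) (contDiff_doubleWellNL τ) h0
  refine ⟨zv - zw, ?_, ?_⟩
  · filter_upwards [V.fn_sub zv zw, hzv, hzw] with x h1 h2 h3
    rw [h1, h2, h3]; rfl
  have hMsq : ∀ u : S.DomA, (K * √(u.normV * u.normDA)) ^ 2 = K ^ 2 * (u.normV * u.normDA) :=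
    fun u => by rw [mul_pow, Real.sq_sqrt (mul_nonneg u.normV_nonneg u.normDA_nonneg)]
  have heb : ∀ᵐ x ∂S.mu, |V.fn (v.toV - w.toV) x| ≤
      K * √(v.normV * v.normDA) + K * √(w.normV * w.normDA) := by
    filter_upwards [V.fn_sub v.toV w.toV, hag v, hag w] with x h1 h2 h3
    rw [h1]
    exact (abs_sub _ _).trans (add_le_add h2 h3)
  obtain ⟨hm, hcac'⟩ := hcac w (v.toV - w.toV) _ heb
  have hsum : ∑ i, ∫ x, S.grad (zv - zw) i x ^ 2 ∂S.mu ≤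
      2 * (4 * τ) ^ 2 * B * difBound v w ^ 2 := by
    refine (Finset.sum_le_sum fun i _ =>
      integral_grad_doubleWellNL_sub_le (hag v) (hag w) i (hgv i) (hgw i) (hm i)).trans ?_
    rw [← Finset.mul_sum, Finset.sum_add_distrib, ← Finset.mul_sum, ← Finset.mul_sum,
      mul_assoc (2 * (4 * τ) ^ 2)]
    refine mul_le_mul_of_nonneg_left ?_ (by positivity)
    refine cubic_dif_bound (r := w.normV * w.normDA) hK' (Real.sqrt_nonneg _) (Real.sqrt_nonneg _)
      ?_ ?_ (mul_nonneg w.normV_nonneg w.normDA_nonneg)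
      (normV_mul_normDA_le_right v w) (sum_integral_grad_le _) hcac'
    · rw [hMsq]
      exact mul_le_mul_of_nonneg_left (normV_mul_normDA_le_left v w) (sq_nonneg _)
    · rw [hMsq]
      exact mul_le_mul_of_nonneg_left (normV_mul_normDA_le_right v w) (sq_nonneg _)
  have hd : 0 ≤ difBound v w := by unfold difBound; positivity
  refine (norm_A0_le _).trans ((Real.sqrt_le_sqrt hsum).trans (le_of_eq ?_))
  rw [Real.sqrt_mul (by positivity), Real.sqrt_sq hd]

end Setting

/-! ### The nonlinearity `g`: pointwise inequalities, growth and Lipschitz estimates. -/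

section gBar

variable {d : ℕ} {a₀ a₁ a₂ : E d → ℝ}

lemma gBar_zero (x : E d) : gBar a₁ a₂ x 0 = 0 := by simp [gBar]

lemma gClass_sub (x : E d) (s t : ℝ) :
    gClass a₀ a₁ a₂ x s - gClass a₀ a₁ a₂ x t = gBar a₁ a₂ x s - gBar a₁ a₂ x t := by
  simp only [gClass, gBar]; ring

lemma gClass_eq (x : E d) (s : ℝ) : gClass a₀ a₁ a₂ x s = a₀ x + gBar a₁ a₂ x s := by
  simp only [gClass, gBar]; ring

lemma gBar_sub (x : E d) (s t : ℝ) : gBar a₁ a₂ x s - gBar a₁ a₂ x t =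
    (a₁ x - a₂ x) * (s - t) + a₂ x * (s * |s| - t * |t|) := by
  simp only [gBar]; ring

lemma abs_mul_abs_sub_le (s t : ℝ) : |(s * |s|) - (t * |t|)| ≤ (|s| + |t|) * |s - t| := by
  have h : s * |s| - t * |t| = s * (|s| - |t|) + (s - t) * |t| := by ring
  have h1 := mul_le_mul_of_nonneg_left (abs_abs_sub_abs_le s t) (abs_nonneg s)
  have h2 := abs_add_le (s * (|s| - |t|)) ((s - t) * |t|)
  rw [h]
  rw [abs_mul, abs_mul, abs_abs] at h2
  linarith

/-- Twice the product equals `(|s| + |t|)((s - t)² + (|s| - |t|)²)`; this is the monotonicity of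
`s|s|`. -/
lemma mul_abs_sub_mul_nonneg (s t : ℝ) : 0 ≤ (s * |s| - t * |t|) * (s - t) := by
  have h : 2 * ((s * |s| - t * |t|) * (s - t)) =
      (|s| + |t|) * (s - t) ^ 2 + (|s| - |t|) * (s ^ 2 - t ^ 2) := by ring
  have h1 : (|s| - |t|) * (s ^ 2 - t ^ 2) = (|s| + |t|) * (|s| - |t|) ^ 2 := by
    rw [← sq_abs s, ← sq_abs t]; ring
  have h2 : 0 ≤ (|s| + |t|) * (s - t) ^ 2 + (|s| + |t|) * (|s| - |t|) ^ 2 := by positivity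
  linarith

lemma abs_gBar_sub_le {A₁ A₂ : ℝ} {x : E d} (h₁ : |a₁ x| ≤ A₁) (h₂ : |a₂ x| ≤ A₂) (s t : ℝ) :
    |gBar a₁ a₂ x s - gBar a₁ a₂ x t| ≤ (A₁ + A₂) * ((1 + |s| + |t|) * |s - t|) := by
  rw [gBar_sub]
  have h3 := abs_add_le ((a₁ x - a₂ x) * (s - t)) (a₂ x * (s * |s| - t * |t|))
  rw [abs_mul, abs_mul] at h3
  have h4 := mul_le_mul_of_nonneg_right ((abs_sub (a₁ x) (a₂ x)).trans (add_le_add h₁ h₂))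
    (abs_nonneg (s - t))
  have h5 := mul_le_mul h₂ (abs_mul_abs_sub_le s t) (abs_nonneg _) ((abs_nonneg _).trans h₂)
  have h6 : 0 ≤ A₁ * ((|s| + |t|) * |s - t|) := mul_nonneg ((abs_nonneg _).trans h₁) (by positivity)
  linarith

/-- The terms with `a₁ s` and `a₂ s|s|` are monotone by the signs of the coefficients, so only `-a₂
s` contributes. -/
lemma neg_gBar_sub_mul_le {A₂ : ℝ} {x : E d} (h₁ : 0 ≤ a₁ x) (h₂ : 0 ≤ a₂ x) (h₂' : |a₂ x| ≤ A₂)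
    (s t : ℝ) : -((gBar a₁ a₂ x s - gBar a₁ a₂ x t) * (s - t)) ≤ A₂ * (s - t) ^ 2 := by
  rw [gBar_sub]
  have h3 := mul_nonneg h₂ (mul_abs_sub_mul_nonneg s t)
  have h4 := mul_nonneg h₁ (sq_nonneg (s - t))
  have h5 := mul_le_mul_of_nonneg_right ((le_abs_self _).trans h₂') (sq_nonneg (s - t))
  linarith

end gBar

namespace Setting
variable {d : ℕ} {S : Setting d} {a₀ a₁ a₂ : E d → ℝ}

/-- Triple Hölder with the constant function one as third factor, available because the domain has
finite measure. -/
lemma SobolevBound.exists_mul (hS : S.Admissible) {C : ℝ} (hC : S.SobolevBound C) :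
    ∃ C₂ : ℝ, 0 ≤ C₂ ∧ ∀ a b : S.V, MemLp (fun x => V.fn a x * V.fn b x) 2 S.mu ∧
      nrm 2 S.mu (fun x => V.fn a x * V.fn b x) ≤ C₂ * (‖a‖ * ‖b‖) := by
  have := hS.isFiniteMeasure
  have hC0 := hC.1
  have h1 : MemLp (fun _ : E d => (1 : ℝ)) 6 S.mu := memLp_const 1
  have h0 := nrm_nonneg 6 S.mu fun _ => 1
  refine ⟨C ^ 2 * nrm 6 S.mu fun _ => 1, by positivity, fun a b => ?_⟩
  obtain ⟨h2, h3⟩ := memLp_mul_mul_six (hC.2 a).1 (hC.2 b).1 h1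
  simp only [mul_one] at h2 h3
  refine ⟨h2, h3.trans ?_⟩
  have h4 := mul_le_mul_of_nonneg_right (mul_le_mul (hC.2 a).2 (hC.2 b).2 (nrm_nonneg _ _ _)
    (by positivity)) h0
  linarith

lemma integral_abs_mul_le {α : Type*} [MeasurableSpace α] {μ : Measure α} {f g : α → ℝ}
    (hf : MemLp f 2 μ) (hg : MemLp g 2 μ) :
    ∫ x, |f x| * |g x| ∂μ ≤ nrm 2 μ f * nrm 2 μ g := by
  refine (le_abs_self _).trans ((abs_integral_mul_le hf.abs hg.abs).trans ?_)
  exact mul_le_mul (nrm_mono hf (by simp)) (nrm_mono hg (by simp)) (nrm_nonneg _ _ _)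
    (nrm_nonneg _ _ _)

lemma memLp_gBar (hS : S.Admissible) (ha₁ : MemLp a₁ ∞ S.mu) (ha₂ : MemLp a₂ ∞ S.mu)
    {w : E d → ℝ} (hw : AEStronglyMeasurable w S.mu) {R : ℝ} (hR : ∀ᵐ x ∂S.mu, |w x| ≤ R) :
    MemLp (fun x => gBar a₁ a₂ x (w x)) 2 S.mu := by
  have h1 : AEStronglyMeasurable (fun x => gBar a₁ a₂ x (w x)) S.mu :=
    (ha₁.1.mul hw).add ((ha₂.1.mul hw).mul (hw.norm.sub aestronglyMeasurable_const))
  obtain ⟨A₁, hA₁, h2⟩ := exists_ae_abs_le ha₁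
  obtain ⟨A₂, hA₂, h3⟩ := exists_ae_abs_le ha₂
  refine memLp_of_ae_bounded hS h1 (R := (A₁ + A₂) * ((1 + R) * R)) ?_ 2
  filter_upwards [h2, h3, hR] with x h4 h5 h6
  have h7 := abs_gBar_sub_le h4 h5 (w x) 0
  rw [gBar_zero, sub_zero, sub_zero, abs_zero, add_zero] at h7
  have h8 := abs_nonneg (w x)
  refine h7.trans (mul_le_mul_of_nonneg_left ?_ (by positivity))
  exact mul_le_mul (by linarith) h6 h8 (by linarith)

/-- Local Lipschitz continuity leaves `∫ (1 + |p| + |q|) |e| |z|`. With `e z` in `L²`, only the `L²`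
norms of `p` and `q` are needed; the case `q = 0` yields the growth bound. -/
lemma abs_integral_gBar_sub_le {A₁ A₂ C₂ : ℝ} (hA₁ : 0 ≤ A₁) (hA₂ : 0 ≤ A₂)
    (h₁ : ∀ᵐ x ∂S.mu, |a₁ x| ≤ A₁) (h₂ : ∀ᵐ x ∂S.mu, |a₂ x| ≤ A₂) (hC₂ : 0 ≤ C₂)
    (hm : ∀ a b : S.V, MemLp (fun x => V.fn a x * V.fn b x) 2 S.mu ∧
      nrm 2 S.mu (fun x => V.fn a x * V.fn b x) ≤ C₂ * (‖a‖ * ‖b‖))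
    {p q : E d → ℝ} (hp : MemLp p 2 S.mu) (hq : MemLp q 2 S.mu) {e : S.V}
    (he : V.fn e =ᵐ[S.mu] fun x => p x - q x) (z : S.V) :
    |∫ x, (gBar a₁ a₂ x (p x) - gBar a₁ a₂ x (q x)) * V.fn z x ∂S.mu| ≤
      (A₁ + A₂) * (1 + C₂) * (1 + nrm 2 S.mu p + nrm 2 S.mu q) * ‖e‖ * ‖z‖ := by
  obtain ⟨hez, hez'⟩ := hm e z
  have i1 : Integrable (fun x => |V.fn e x| * |V.fn z x|) S.mu :=
    integrable_mul (V.memLp_fn e).abs (V.memLp_fn z).abs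
  have i2 : Integrable (fun x => |p x| * |V.fn e x * V.fn z x|) S.mu :=
    integrable_mul hp.abs hez.abs
  have i3 : Integrable (fun x => |q x| * |V.fn e x * V.fn z x|) S.mu :=
    integrable_mul hq.abs hez.abs
  have b1 := (integral_abs_mul_le (V.memLp_fn e) (V.memLp_fn z)).trans
    (mul_le_mul (norm_fn_le e) (norm_fn_le z) (nrm_nonneg _ _ _) (norm_nonneg _))
  have b2 := (integral_abs_mul_le hp hez).trans
    (mul_le_mul_of_nonneg_left hez' (nrm_nonneg _ _ _))
  have b3 := (integral_abs_mul_le hq hez).trans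
    (mul_le_mul_of_nonneg_left hez' (nrm_nonneg _ _ _))
  have i4 : Integrable (fun x => |V.fn e x| * |V.fn z x| + |p x| * |V.fn e x * V.fn z x| +
    |q x| * |V.fn e x * V.fn z x|) S.mu := (i1.add i2).add i3
  have key : |∫ x, (gBar a₁ a₂ x (p x) - gBar a₁ a₂ x (q x)) * V.fn z x ∂S.mu| ≤
      ∫ x, (A₁ + A₂) * (|V.fn e x| * |V.fn z x| + |p x| * |V.fn e x * V.fn z x| +
        |q x| * |V.fn e x * V.fn z x|) ∂S.mu := by
    rw [← Real.norm_eq_abs]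
    refine norm_integral_le_of_norm_le (i4.const_mul _) ?_
    filter_upwards [h₁, h₂, he] with x h4 h5 h6
    rw [Real.norm_eq_abs, abs_mul, abs_mul, h6]
    have := mul_le_mul_of_nonneg_right (abs_gBar_sub_le h4 h5 (p x) (q x)) (abs_nonneg (V.fn z x))
    linarith
  have i12 : Integrable (fun x => |V.fn e x| * |V.fn z x| + |p x| * |V.fn e x * V.fn z x|) S.mu :=
    i1.add i2
  rw [integral_const_mul, integral_add i12 i3, integral_add i1 i2] at key
  have hA := add_nonneg hA₁ hA₂
  refine key.trans ?_
  have hp0 := nrm_nonneg 2 S.mu p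
  have hq0 := nrm_nonneg 2 S.mu q
  have he0 := norm_nonneg e
  have hz0 := norm_nonneg z
  have h9 := mul_le_mul_of_nonneg_left (add_le_add (add_le_add b1 b2) b3) hA
  have h10 : 0 ≤ (A₁ + A₂) * (C₂ * (‖e‖ * ‖z‖) +
    (nrm 2 S.mu p + nrm 2 S.mu q) * (‖e‖ * ‖z‖)) := by positivity
  refine h9.trans ?_
  linarith

lemma neg_integral_gBar_sub_mul_le {A₂ : ℝ} (h₁ : ∀ᵐ x ∂S.mu, 0 < a₁ x)
    (h₂ : ∀ᵐ x ∂S.mu, 0 < a₂ x) (h₂' : ∀ᵐ x ∂S.mu, |a₂ x| ≤ A₂) (z : S.DomA) {p q : E d → ℝ}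
    (hpq : MemLp (fun x => gBar a₁ a₂ x (p x) - gBar a₁ a₂ x (q x)) 2 S.mu)
    (hz : ∀ x, p x - q x = z.fn x) :
    -(∫ x, (gBar a₁ a₂ x (p x) - gBar a₁ a₂ x (q x)) * z.fn x ∂S.mu) ≤ A₂ * z.normH ^ 2 := by
  rw [← nrm_fn, nrm_two_sq z.memLp_fn, ← integral_const_mul, ← integral_neg]
  refine integral_mono_ae (integrable_mul hpq z.memLp_fn).neg
    (z.memLp_fn.integrable_sq.const_mul _) ?_
  filter_upwards [h₁, h₂, h₂'] with x h3 h4 h5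
  have := neg_gBar_sub_mul_le h3.le h4.le h5 (p x) (q x)
  rwa [hz] at this

lemma DomA.normH_le_normDA (v : S.DomA) : v.normH ≤ v.normDA :=
  v.normH_le_normV.trans v.normV_le_normDA

/-- Since `h ≤ V` gives `h⁴ ≤ h² V²`, one gets `(1 + h)² ≤ 4(1 + h² V²)`: the growth of `g` fits the
weight shaped for the cubic `f`. -/
lemma sq_le_of_le_one_add_mul {N B V h : ℝ} (hh : 0 ≤ h) (hhV : h ≤ V) (hN0 : 0 ≤ N)
    (hN : N ≤ B * (1 + h) * V) : N ^ 2 ≤ 4 * B ^ 2 * V ^ 2 * (1 + h ^ 2 * V ^ 2) := by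
  have h1 : N ^ 2 ≤ (B * (1 + h) * V) ^ 2 := pow_le_pow_left₀ hN0 hN 2
  have h2 : h ^ 2 ≤ V ^ 2 := pow_le_pow_left₀ hh hhV 2
  have h3 : (1 + h) ^ 2 ≤ 4 * (1 + h ^ 2 * V ^ 2) := by
    have h4 := mul_le_mul_of_nonneg_left h2 (sq_nonneg h)
    linarith [sq_nonneg (1 - h), sq_nonneg (1 - h ^ 2), sq_nonneg (h ^ 2)]
  have h5 := mul_le_mul_of_nonneg_left h3 (sq_nonneg (B * V))
  linarith

lemma growthG_gBar (hS : S.Admissible) {C : ℝ} (hC : S.SobolevBound C)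
    (ha₁ : MemLp a₁ ∞ S.mu) (ha₂ : MemLp a₂ ∞ S.mu) (h₁ : ∀ᵐ x ∂S.mu, 0 < a₁ x)
    (h₂ : ∀ᵐ x ∂S.mu, 0 < a₂ x) : S.GrowthG (gBar a₁ a₂) := by
  obtain ⟨K, hK, hag⟩ := exists_abs_fn_le hS hC
  obtain ⟨A₁, hA₁, hb₁⟩ := exists_ae_abs_le ha₁
  obtain ⟨A₂, hA₂, hb₂⟩ := exists_ae_abs_le ha₂
  obtain ⟨C₂, hC₂, hm⟩ := hC.exists_mul hS
  refine ⟨4 * ((A₁ + A₂) * (1 + C₂)) ^ 2 + A₂, by positivity, fun v => ?_⟩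
  have hg := memLp_gBar hS ha₁ ha₂ v.memLp_fn.1 (hag v)
  have hH := v.normH_nonneg
  have hV := v.normV_nonneg
  have hD := v.normDA_nonneg
  have hr := represents_of_memLp hg
  refine ⟨_, hr, ?_, ?_⟩
  · have hl := norm_le_of_represents hr
      (M := (A₁ + A₂) * (1 + C₂) * (1 + v.normH) * v.normV) (by positivity) fun z => by
        have h3 := abs_integral_gBar_sub_le hA₁ hA₂ hb₁ hb₂ hC₂ hm v.memLp_fn
          (MemLp.zero' (p := 2) (μ := S.mu)) (e := v.toV) (by simp [DomA.fn]) z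
        have h4 : nrm 2 S.mu (fun _ : E d => (0 : ℝ)) = 0 := by simp [nrm]
        simp only [gBar_zero, sub_zero, h4, nrm_fn, add_zero] at h3
        exact h3
    have h1 := sq_le_of_le_one_add_mul hH v.normH_le_normV (ContinuousLinearMap.opNorm_nonneg _) hl
    have h2 : 0 ≤ A₂ * v.normV ^ 2 * (1 + v.normH ^ 2 * v.normV ^ 2) := by positivity
    linarith
  · have h3 := neg_integral_gBar_sub_mul_le h₁ h₂ hb₂ v (p := v.fn) (q := fun _ => 0)
      (by simpa only [gBar_zero, sub_zero] using hg) (by simp)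
    simp only [gBar_zero, sub_zero] at h3
    rw [← (hr v.toV).2]
    refine h3.trans ?_
    have h4 : v.normH ^ 2 ≤ v.normDA * v.normV := by
      rw [sq]; exact mul_le_mul v.normH_le_normDA v.normH_le_normV hH hD
    have h5 := mul_le_mul_of_nonneg_left h4 hA₂
    have h6 : 0 ≤ 4 * ((A₁ + A₂) * (1 + C₂)) ^ 2 * v.normDA * v.normV := by positivity
    linarith

lemma difG_gBar (hS : S.Admissible) {C : ℝ} (hC : S.SobolevBound C)
    (ha₁ : MemLp a₁ ∞ S.mu) (ha₂ : MemLp a₂ ∞ S.mu) : S.DifG (gBar a₁ a₂) := by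
  obtain ⟨K, hK, hag⟩ := exists_abs_fn_le hS hC
  obtain ⟨A₁, hA₁, hb₁⟩ := exists_ae_abs_le ha₁
  obtain ⟨A₂, hA₂, hb₂⟩ := exists_ae_abs_le ha₂
  obtain ⟨C₂, hC₂, hm⟩ := hC.exists_mul hS
  refine ⟨2 * ((A₁ + A₂) * (1 + C₂)), by positivity, fun v w _ _ => ?_⟩
  have hg := (memLp_gBar hS ha₁ ha₂ v.memLp_fn.1 (hag v)).sub
    (memLp_gBar hS ha₁ ha₂ w.memLp_fn.1 (hag w))
  have hr := represents_of_memLp hg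
  refine ⟨_, hr, (norm_le_of_represents hr
    (M := (A₁ + A₂) * (1 + C₂) * (1 + v.normH + w.normH) * ‖v.toV - w.toV‖) ?_ fun z => ?_).trans ?_⟩
  · have := v.normH_nonneg
    have := w.normH_nonneg
    positivity
  · have h3 := abs_integral_gBar_sub_le hA₁ hA₂ hb₁ hb₂ hC₂ hm v.memLp_fn w.memLp_fn
      (V.fn_sub v.toV w.toV) z
    rwa [nrm_fn, nrm_fn] at h3
  · have h1 : v.normH ≤ √(v.normV ^ 2 + w.normV ^ 2) := v.normH_le_normV.trans
      (Real.le_sqrt_of_sq_le (by linarith [sq_nonneg w.normV]))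
    have h2 : w.normH ≤ √(v.normV ^ 2 + w.normV ^ 2) := w.normH_le_normV.trans
      (Real.le_sqrt_of_sq_le (by linarith [sq_nonneg v.normV]))
    unfold difBound
    have ha := Real.sqrt_nonneg (v.normV ^ 2 + w.normV ^ 2)
    have hb := Real.sqrt_nonneg (v.normDA ^ 2 + w.normDA ^ 2)
    set a := √(v.normV ^ 2 + w.normV ^ 2)
    set b := √(v.normDA ^ 2 + w.normDA ^ 2)
    have h3 : 1 + v.normH + w.normH ≤ 2 * ((1 + a) * (1 + b)) := by
      have : 0 ≤ a * b := mul_nonneg ha hb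
      linarith
    have h4 := mul_le_mul_of_nonneg_left h3 (by positivity : 0 ≤ (A₁ + A₂) * (1 + C₂))
    have h5 := mul_le_mul_of_nonneg_right h4 (norm_nonneg (v.toV - w.toV))
    linarith

/-! ### Bounds along a bounded target. -/

lemma EssBdd.exists_bound (hS : S.Admissible) {y : ℝ → E d → ℝ} (hy : S.EssBdd y) :
    ∃ Y : ℝ, 0 ≤ Y ∧ ∀ᵐ t ∂(volume.restrict (Ioi (0 : ℝ))),
      AEStronglyMeasurable (y t) S.mu ∧ ∀ᵐ x ∂S.mu, |y t x| ≤ Y := by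
  have := hS.isFiniteMeasure
  obtain ⟨Y, hY, h⟩ := exists_ae_abs_le hy
  refine ⟨Y, hY, ?_⟩
  filter_upwards [hy.1.prodMk_left, Measure.ae_ae_of_ae_prod h] with t h1 h2
  exact ⟨h1, h2⟩

lemma ae_abs_add_le {p q : E d → ℝ} {P Q : ℝ} (hp : ∀ᵐ x ∂S.mu, |p x| ≤ P)
    (hq : ∀ᵐ x ∂S.mu, |q x| ≤ Q) : ∀ᵐ x ∂S.mu, |p x + q x| ≤ P + Q := by
  filter_upwards [hp, hq] with x h1 h2 using (abs_add_le _ _).trans (add_le_add h1 h2)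

lemma boundNg_gBar (hS : S.Admissible) {C : ℝ} (hC : S.SobolevBound C)
    (ha₁ : MemLp a₁ ∞ S.mu) (ha₂ : MemLp a₂ ∞ S.mu) (h₁ : ∀ᵐ x ∂S.mu, 0 < a₁ x)
    (h₂ : ∀ᵐ x ∂S.mu, 0 < a₂ x) {n : ℕ} (hn : 0 < n) {y : ℝ → E d → ℝ} (hy : S.EssBdd y) :
    S.BoundNg n (gBar a₁ a₂) y := by
  obtain ⟨K, hK, hag⟩ := exists_abs_fn_le hS hC
  obtain ⟨A₂, hA₂, hb₂⟩ := exists_ae_abs_le ha₂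
  obtain ⟨Y, hY, hyb⟩ := hy.exists_bound hS
  -- One-sided Lipschitz continuity bounds everything by `A₂ ‖z‖_H²`, so `ζ = 2` and `η = 0`.
  -- Repeating this term `n` times lets `n` agree with the number of terms for `f`.
  refine ⟨A₂, fun _ => 2, fun _ => 0, hA₂, fun _ => by norm_num, ?_⟩
  filter_upwards [hyb] with t ht z
  have hg := (memLp_gBar hS ha₁ ha₂ (ht.1.add z.memLp_fn.1) (ae_abs_add_le ht.2 (hag z))).sub
    (memLp_gBar hS ha₁ ha₂ ht.1 ht.2)
  constructor
  · refine ⟨_, fun u => ⟨integrable_mul hg u.memLp_fn, (abs_integral_mul_le hg u.memLp_fn).trans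
      (mul_le_mul_of_nonneg_left ?_ (nrm_nonneg _ _ _))⟩⟩
    rw [nrm_fn]
    exact u.normH_le_normDA
  · refine (neg_integral_gBar_sub_mul_le h₁ h₂ hb₂ z hg fun x => by simp).trans
      (mul_le_mul_of_nonneg_left ?_ hA₂)
    have hn' : (1 : ℝ) ≤ n := by exact_mod_cast hn
    simp only [Real.rpow_two, Real.rpow_zero, mul_one, Finset.sum_const, Finset.card_univ,
      Fintype.card_fin, nsmul_eq_mul]
    exact le_mul_of_one_le_left (sq_nonneg _) hn'

/-- Splitting `z⁴ = z · z³` gives `‖z²‖² ≤ C³ ‖z‖_H ‖z‖_V³`. Then `‖z‖_V² ≤ ‖z‖_H ‖Az‖` produces the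
exponents `5/4` and `3/4`. The constant `(1 + C)²` avoids a fractional power of `C`. -/
lemma nrm_sq_fn_le {C : ℝ} (hC : S.SobolevBound C) (z : S.DomA)
    (hz : MemLp (fun x => z.fn x ^ 2) 2 S.mu) : nrm 2 S.mu (fun x => z.fn x ^ 2) ≤
      (1 + C) ^ 2 * (z.normH ^ (5 / 4 : ℝ) * z.normDA ^ (3 / 4 : ℝ)) := by
  have hC0 := hC.1
  have hH := z.normH_nonneg
  have hV := z.normV_nonneg
  have hD := z.normDA_nonneg
  obtain ⟨h1, h2⟩ := hC.mul_mul z.toV z.toV z.toV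
  have h3 : nrm 2 S.mu (fun x => z.fn x ^ 2) ^ 2 =
      ∫ x, z.fn x * (V.fn z.toV x * V.fn z.toV x * V.fn z.toV x) ∂S.mu := by
    rw [nrm_two_sq hz]
    refine integral_congr_ae (Eventually.of_forall fun x => ?_)
    change (z.fn x ^ 2) ^ 2 = z.fn x * (z.fn x * z.fn x * z.fn x)
    ring
  have h4 : nrm 2 S.mu (fun x => z.fn x ^ 2) ^ 2 ≤
      z.normH * (C ^ 3 * (z.normV * z.normV * z.normV)) := by
    rw [h3]
    refine (le_abs_self _).trans ((abs_integral_mul_le z.memLp_fn h1).trans ?_)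
    rw [nrm_fn]
    exact mul_le_mul_of_nonneg_left h2 hH
  have h5 : z.normV ^ 6 ≤ (z.normH * z.normDA) ^ 3 := by
    have := pow_le_pow_left₀ (sq_nonneg _) z.normV_sq_le 3
    rwa [← pow_mul] at this
  have h6 : C ^ 6 ≤ (1 + C) ^ 8 :=
    (pow_le_pow_left₀ hC0 (by linarith) 6).trans (pow_le_pow_right₀ (by linarith) (by norm_num))
  have h7 : (z.normH ^ (5 / 4 : ℝ) * z.normDA ^ (3 / 4 : ℝ)) ^ 4 = z.normH ^ 5 * z.normDA ^ 3 := by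
    rw [mul_pow, ← Real.rpow_natCast, ← Real.rpow_natCast, ← Real.rpow_mul hH, ← Real.rpow_mul hD]
    norm_num
  refine le_of_pow_le_pow_left₀ (n := 4) (by norm_num) (by positivity) ?_
  calc nrm 2 S.mu (fun x => z.fn x ^ 2) ^ 4 = (nrm 2 S.mu (fun x => z.fn x ^ 2) ^ 2) ^ 2 := by ring
    _ ≤ (z.normH * (C ^ 3 * (z.normV * z.normV * z.normV))) ^ 2 :=
        pow_le_pow_left₀ (sq_nonneg _) h4 2
    _ = z.normH ^ 2 * C ^ 6 * z.normV ^ 6 := by ring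
    _ ≤ z.normH ^ 2 * (1 + C) ^ 8 * (z.normH * z.normDA) ^ 3 :=
        mul_le_mul (mul_le_mul_of_nonneg_left h6 (sq_nonneg _)) h5 (by positivity) (by positivity)
    _ = (1 + C) ^ 8 * (z.normH ^ 5 * z.normDA ^ 3) := by ring
    _ = ((1 + C) ^ 2 * (z.normH ^ (5 / 4 : ℝ) * z.normDA ^ (3 / 4 : ℝ))) ^ 4 := by
        rw [mul_pow, h7]; ring

lemma memLp_bounded_mul {c w : E d → ℝ} {R : ℝ} (hR : 0 ≤ R) (hc : AEStronglyMeasurable c S.mu)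
    (hcR : ∀ᵐ x ∂S.mu, |c x| ≤ R) (hw : MemLp w 2 S.mu) :
    MemLp (fun x => c x * w x) 2 S.mu ∧ nrm 2 S.mu (fun x => c x * w x) ≤ R * nrm 2 S.mu w := by
  have h : ∀ᵐ x ∂S.mu, |c x * w x| ≤ |R * w x| := by
    filter_upwards [hcR] with x hx
    rw [abs_mul, abs_mul, abs_of_nonneg hR]
    exact mul_le_mul_of_nonneg_right hx (abs_nonneg _)
  have hRw : MemLp (fun x => R * w x) 2 S.mu := hw.const_mul R
  refine ⟨hRw.mono (hc.mul hw.1) h, (nrm_mono hRw h).trans_eq ?_⟩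
  rw [nrm_const_mul, abs_of_nonneg hR]

lemma boundNf_doubleWell (hS : S.Admissible) {C : ℝ} (hC : S.SobolevBound C) {τ : ℝ}
    (hτ : 0 < τ) {y : ℝ → E d → ℝ} (hy : S.EssBdd y) : S.BoundNf 2 (doubleWellNL τ) y := by
  have hC0 := hC.1
  obtain ⟨K, hK, hag⟩ := exists_abs_fn_le hS hC
  obtain ⟨Y, hY, hyb⟩ := hy.exists_bound hS
  -- The pair `(1, 1)` comes from the term linear in `z`. The pair `(5/4, 7/4)` comes from the
  -- quadratic one: `nrm_sq_fn_le` supplies `3/4` and the factor `‖A₀ z‖` one more power of the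
  -- `D(A)` norm, still below two.
  refine ⟨8 * τ * (3 * Y ^ 2 + 1 + 3 * Y * (1 + C) ^ 2), ![1, 5 / 4], ![1, 7 / 4], by positivity,
    fun i => by fin_cases i <;> norm_num, ?_⟩
  filter_upwards [hyb] with t ht z
  have hzm := z.memLp_fn.1
  have hsum : MemLp (fun x => doubleWellNL τ (y t x + z.fn x)) 2 S.mu :=
    memLp_comp_of_ae_bounded hS (ht.1.add hzm) (ae_abs_add_le ht.2 (hag z))
      (contDiff_doubleWellNL τ).continuous 2
  refine ⟨hsum.sub (memLp_comp_of_ae_bounded hS ht.1 ht.2 (contDiff_doubleWellNL τ).continuous 2),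
    ?_⟩
  have m3 : MemLp (fun x => z.fn x ^ 3) 2 S.mu :=
    memLp_comp_of_ae_bounded hS hzm (hag z) contDiff_cube.continuous 2
  have m2 : MemLp (fun x => z.fn x ^ 2) 2 S.mu :=
    memLp_comp_of_ae_bounded hS hzm (hag z) (continuous_pow 2) 2
  obtain ⟨n2, n2'⟩ := memLp_bounded_mul hY ht.1 ht.2 m2
  obtain ⟨n1, n1'⟩ := memLp_bounded_mul (c := fun x => 3 * y t x ^ 2 - 1) (R := 3 * Y ^ 2 + 1)
    (by positivity) (((ht.1.pow 2).const_mul 3).sub aestronglyMeasurable_const)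
    (by
      filter_upwards [ht.2] with x hx
      have := sq_le_sq' (abs_le.1 hx).1 (abs_le.1 hx).2
      exact abs_le.2 ⟨by linarith [sq_nonneg (y t x), sq_nonneg Y], by linarith⟩) z.memLp_fn
  -- Taylor expansion at `y`: the cubic term in `z` has the favourable sign, and the other
  -- coefficients are bounded functions of `y`.
  have e : (fun x => doubleWellNL τ (y t x + z.fn x) - doubleWellNL τ (y t x)) = fun x =>
      4 * τ * (z.fn x ^ 3 + (3 * (y t x * z.fn x ^ 2) + (3 * y t x ^ 2 - 1) * z.fn x)) := by
    ext x; simp only [doubleWellNL]; ring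
  have n2'' : MemLp (fun x => 3 * (y t x * z.fn x ^ 2)) 2 S.mu := n2.const_mul 3
  have n21 : MemLp (fun x => 3 * (y t x * z.fn x ^ 2) + (3 * y t x ^ 2 - 1) * z.fn x) 2 S.mu :=
    n2''.add n1
  rw [e, pairA0_const_mul, pairA0_add m3 n21, pairA0_add n2'' n1, pairA0_const_mul]
  have p3 := pairA0_cube_nonneg hS z (hag z)
  have p2 := (neg_le_abs _).trans (abs_pairA0_le n2 z)
  have p1 := (neg_le_abs _).trans (abs_pairA0_le n1 z)
  have hD := z.normDA_nonneg
  have hH := z.normH_nonneg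
  rw [nrm_fn] at n1'
  have q1 := p1.trans (mul_le_mul_of_nonneg_right n1' (by positivity))
  have q2 := p2.trans (mul_le_mul_of_nonneg_right
    (n2'.trans (mul_le_mul_of_nonneg_left (nrm_sq_fn_le hC z m2) hY)) (by positivity))
  have r : z.normDA ^ (7 / 4 : ℝ) = z.normDA ^ (3 / 4 : ℝ) * z.normDA := by
    rw [← Real.rpow_add_one' hD (by norm_num)]; norm_num
  simp only [Fin.sum_univ_two, Matrix.cons_val_zero, Matrix.cons_val_one, Real.rpow_one, r]
  set X := z.normH ^ (5 / 4 : ℝ) * (z.normDA ^ (3 / 4 : ℝ) * z.normDA) with hX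
  have hX0 : 0 ≤ X := by positivity
  have q2' : Y * ((1 + C) ^ 2 * (z.normH ^ (5 / 4 : ℝ) * z.normDA ^ (3 / 4 : ℝ))) *
      (2 * z.normDA) = 2 * Y * (1 + C) ^ 2 * X := by rw [hX]; ring
  rw [q2'] at q2
  have u1 : 0 ≤ (3 * Y ^ 2 + 1) * X := by positivity
  have u2 : 0 ≤ 3 * Y * (1 + C) ^ 2 * (z.normH * z.normDA) := by positivity
  have fin : -(S.pairA0 (fun x => z.fn x ^ 3) z + (3 * S.pairA0 (fun x => y t x * z.fn x ^ 2) z +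
      S.pairA0 (fun x => (3 * y t x ^ 2 - 1) * z.fn x) z)) ≤
      2 * (3 * Y ^ 2 + 1 + 3 * Y * (1 + C) ^ 2) * (z.normH * z.normDA + X) := by linarith
  have := mul_le_mul_of_nonneg_left fin (by positivity : 0 ≤ 4 * τ)
  linarith

lemma represents_gBar_iff (ha₀ : MemLp a₀ 2 S.mu) (v : S.DomA) (l : S.V') :
    S.Represents (fun x => gBar a₁ a₂ x (v.fn x)) l ↔
      S.Represents (fun x => gClass a₀ a₁ a₂ x (v.fn x)) (S.ofH (ha₀.toLp a₀) + l) := by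
  have h0 := represents_of_memLp ha₀
  refine forall_congr' fun z => ?_
  obtain ⟨h1, h2⟩ := h0 z
  simp only [gClass_eq, add_mul, add_apply]
  constructor
  · rintro ⟨h3, h4⟩
    exact ⟨h1.add h3, by rw [integral_add h1 h3, h2, h4]⟩
  · rintro ⟨h3, h4⟩
    have h5 : Integrable (fun x => gBar a₁ a₂ x (v.fn x) * V.fn z x) S.mu := by
      refine (h3.sub h1).congr (Eventually.of_forall fun x => ?_)
      simp only [Pi.sub_apply, add_sub_cancel_left]
    refine ⟨h5, ?_⟩
    rw [integral_add h1 h5, h2] at h4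
    linarith

lemma AssumptionH.sub_const {h : ℝ → S.V' × S.V'} (hh : S.AssumptionH h) (l : S.V') :
    S.AssumptionH fun t => ((h t).1 - l, (h t).2) := fun T hT =>
  ⟨(hh T hT).1.sub (memLp_const l), (hh T hT).2⟩

end Setting

end CahnHilliard

end

theorem mainTheorem4 (d : ℕ) (hd1 : 1 ≤ d) (hd3 : d ≤ 3)
    (S : CahnHilliard.Setting d) (hS : S.Admissible)
    (τ : ℝ) (hτ : 0 < τ)
    (a₀ a₁ a₂ : CahnHilliard.E d → ℝ)
    (ha₀ : MemLp a₀ 2 S.mu) (ha₁ : MemLp a₁ ∞ S.mu) (ha₂ : MemLp a₂ ∞ S.mu)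
    (ha₁pos : ∀ᵐ x ∂S.mu, 0 < a₁ x) (ha₂pos : ∀ᵐ x ∂S.mu, 0 < a₂ x) :
    -- the assumptions for the double-well nonlinearity and for `g - a₀`
    (S.AssumptionFGV (CahnHilliard.doubleWell τ) (CahnHilliard.doubleWellNL τ)
        (CahnHilliard.gBar a₁ a₂) ∧
      S.AssumptionNdif (CahnHilliard.doubleWellNL τ) (CahnHilliard.gBar a₁ a₂) ∧
      (∀ y : ℝ → CahnHilliard.E d → ℝ, S.AssumptionYrBdd y →
        S.AssumptionNfNg (CahnHilliard.doubleWellNL τ) (CahnHilliard.gBar a₁ a₂) y) ∧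
      (∀ y : ℝ → CahnHilliard.E d → ℝ, S.EssBdd y →
        ∃ n : ℕ, 0 < n ∧ S.BoundNg n (CahnHilliard.gBar a₁ a₂) y)) ∧
    -- the two assumptions on differences for `g` itself
    (S.AssumptionNdif (CahnHilliard.doubleWellNL τ) (CahnHilliard.gClass a₀ a₁ a₂) ∧
      (∀ y : ℝ → CahnHilliard.E d → ℝ, S.AssumptionYrBdd y →
        S.AssumptionNfNg (CahnHilliard.doubleWellNL τ) (CahnHilliard.gClass a₀ a₁ a₂) y) ∧
      (∀ y : ℝ → CahnHilliard.E d → ℝ, S.EssBdd y →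
        ∃ n : ℕ, 0 < n ∧ S.BoundNg n (CahnHilliard.gClass a₀ a₁ a₂) y)) ∧
    -- `a₀` can be moved into the external force: `g(v) = a₀ + (g - a₀)(v)` in `V'`, and
    -- `(h₁ - a₀, h₂)` is an admissible external force whenever `(h₁, h₂)` is
    ((∀ (v : S.DomA) (l : S.V'),
        S.Represents (fun x => CahnHilliard.gBar a₁ a₂ x (v.fn x)) l ↔
          S.Represents (fun x => CahnHilliard.gClass a₀ a₁ a₂ x (v.fn x))
            (S.ofH (ha₀.toLp a₀) + l)) ∧
      (∀ h : ℝ → S.V' × S.V', S.AssumptionH h →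
        S.AssumptionH (fun t => ((h t).1 - S.ofH (ha₀.toLp a₀), (h t).2)))) := by
  obtain ⟨C, hC⟩ := CahnHilliard.Setting.exists_sobolevBound hd1 hd3 hS
  have hNdif : S.AssumptionNdif (CahnHilliard.doubleWellNL τ) (CahnHilliard.gBar a₁ a₂) :=
    ⟨CahnHilliard.Setting.difF_doubleWell hS hC τ, CahnHilliard.Setting.difG_gBar hS hC ha₁ ha₂⟩
  have hNg : ∀ {n : ℕ}, 0 < n → ∀ y : ℝ → CahnHilliard.E d → ℝ, S.EssBdd y →
      S.BoundNg n (CahnHilliard.gBar a₁ a₂) y := fun hn y hy =>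
    CahnHilliard.Setting.boundNg_gBar hS hC ha₁ ha₂ ha₁pos ha₂pos hn hy
  -- Two terms are needed for `f`; the bound for `g` adapts to any positive number of terms.
  have hNfNg : ∀ y : ℝ → CahnHilliard.E d → ℝ, S.AssumptionYrBdd y →
      S.AssumptionNfNg (CahnHilliard.doubleWellNL τ) (CahnHilliard.gBar a₁ a₂) y := fun y hy =>
    ⟨2, two_pos, CahnHilliard.Setting.boundNf_doubleWell hS hC hτ hy.1, hNg two_pos y hy.1⟩
  refine ⟨⟨⟨CahnHilliard.Setting.growthF_doubleWell hS hC hτ,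
      CahnHilliard.Setting.growthG_gBar hS hC ha₁ ha₂ ha₁pos ha₂pos⟩, hNdif, hNfNg,
      fun y hy => ⟨1, one_pos, hNg one_pos y hy⟩⟩, ?_,
    CahnHilliard.Setting.represents_gBar_iff ha₀, fun h hh => hh.sub_const _⟩
  -- The conditions on differences do not see `a₀`, so the results for `g - a₀` transfer by
  -- rewriting. The growth condition cannot be transferred this way, because at `v = 0` it forces
  -- `g(0)` to vanish in `V'`.
  simp only [CahnHilliard.Setting.AssumptionNdif, CahnHilliard.Setting.AssumptionNfNg,
    CahnHilliard.Setting.DifG, CahnHilliard.Setting.BoundNg,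
    CahnHilliard.gClass_sub] at hNdif hNfNg hNg ⊢
  exact ⟨hNdif, hNfNg, fun y hy => ⟨1, one_pos, hNg one_pos y hy⟩⟩
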